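/- Let $K\subset\mathbb C$ be a field and $D=t\frac{d}{dt}$. Let $L=\sum_{j=0}^m q_j(t)D^{m-j}$ with $q_j\in K(t)$, $q_0\neq 0$, be a differential operator with at most a regular singularity at $t=0$ (i.e. no $q_j/q_0$ has a pole at $0$). Assume that the only local exponent of $L$ at $t=0$ (the only complex root of the indicial polynomial $\sum_j (q_j/q_0)(0)\,s^{m-j}$) is $0$, and that the local monodromy $\sigma_0$ of the solutions of $L$ around $t=0$ is maximally unipotent: in some basis it is $\exp$ of a single nilpotent Jordan block of size $m$. Let $\Delta^*=\{0<|t|<\varepsilon\}$ be a punctured disc on which no $q_j$ has a pole and $q_0$ has no zero, let $p\in\Delta^*$, let $V=Sol_p(L)$ be the space of germs at $p$ of analytic solutions of $L$, and fix a branch of $\log t$ near $p$. Let $\phi_k^{an}=\sum_{n\ge0}\frac{a_n^{(k)}(0)}{k!}t^n\in K[[t]]$ be the Frobenius series: writing $q_0^{-1}L=\sum_{i\ge0}t^ip_i(D)$, the rational functions $a_n(s)$ are given by $a_0=1$ and $\sum_{i=0}^n p_i(n-i+s)a_{n-i}(s)=0$ for $n\ge1$. Then $\phi_k^{an}(0)=\delta_{k,0}$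 and $\phi^{an}_k$ converges for $|t|<\varepsilon$ ($0\le k\le m-1$), every solution in $V$ continues analytically to the universal covering of $\Delta^*$, and the functions $\phi_k(t)=\sum_{j=0}^k\frac{\log(t)^j}{j!}\phi_{k-j}^{an}(t)$, $0\le k\le m-1$, form a basis of $V$. Let $\phi_0^\vee,\dots,\phi_{m-1}^\vee$ be the dual basis of $V^\vee=\mathrm{Hom}_{\mathbb C}(V,\mathbb C)$. (i) Let $\mathcal O$ be the ring of analytic functions on $\Delta^*$ that are meromorphic at $0$, $\mathcal D=\mathcal O[D]$ and $H=\mathcal D/\mathcal DL$. Then $H$ is a free $\mathcal O$-module with basis $1,D,\dots,D^{m-1}$. Put $F^kH=\sum_{j=0}^{m-1-k}\mathcal O D^j$. Let $e(z)=\exp(2\pi iz)$, $G=\{z\in\mathbb C:|e(z)|<\varepsilon\}$, regard solutions as functions $u(z)$ on $G$, so that $(\sigma_0u)(z)=u(z+1)$, and let $N=\log\sigma_0$, acting on $V^\vee$ by $\langle N\lambda,u\rangle=\langle\lambda,Nu\rangle$. For $z\in G$ and $v\in H$ define $\pi_z(v)\in V^\vee$ by $\langle\pi_z(v),u\rangle=(vu)(z)$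 (where $D$ acts as $\frac1{2\pi i}\frac{d}{dz}$), and put $\pi'_z=\exp(-zN)\circ\pi_z$. Then Schmid's limiting filtration exists: as $\mathrm{Im}\,z\to+\infty$, the subspaces $\pi'_z(F^kH)\subset V^\vee$ converge in the Grassmannian, and the limit is $$F^k_\infty V^\vee=\mathbb C\phi_0^\vee+\dots+\mathbb C\phi_{m-1-k}^\vee ,$$ which is also the set of all existing limits $\lim_{\mathrm{Im} z\to+\infty}\pi'_z(v)$ with $v\in F^kH$. Moreover, the existing limits of algebraic classes $v=\sum_j v_jD^j\in F^kH$ with $v_j\in K(t)$ span over $K$ the space $F^k_\infty(K)=K\phi_0^\vee+\dots+K\phi_{m-1-k}^\vee$. (ii) The operator $N$ on $V^\vee$ is nilpotent, and its Jacobson (monodromy weight) filtration shifted by $m-1$, i.e. the filtration $W_*$ with $W_{k+m-1}$ the $k$-th step of the Jacobson filtration, is $W_kV^\vee=N^{m-1-\lfloor k/2\rfloor}(V^\vee)$ (with $N^a=1$ for $a<0$). The triple $\mathbb H=(V^\vee,W_*,F_\infty^*)$ is a mixed Hodge structure with $gr^W\mathbb H=\bigoplus_{k=0}^{m-1}\mathbb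 C(-k)$: with the filtration induced by $F_\infty^*$, $gr^W_{2k}$ is isomorphic to $\mathbb C(-k)$ for $0\le k\le m-1$, all other graded pieces vanish, and for every real structure on $V^\vee$ over which $W_*$ is defined (such real structures exist) $F_\infty^*$ induces on each $gr^W_n$ a pure Hodge structure of weight $n$. -/

import Mathlib

open Filter Topology

noncomputable section

namespace LimMHS

/-! ### Functions on open subsets of the complex plane -/

/-- Extension by zero of a function defined on a subset of `ℂ`. -/
def ext0 {S : Set ℂ} (f : S → ℂ) : ℂ → ℂ := Function.extend Subtype.val f 0

theorem ext0_of_mem {S : Set ℂ} (f : S → ℂ) {z : ℂ} (hz : z ∈ S) : ext0 f z = f ⟨z, hz⟩ :=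
  Subtype.val_injective.extend_apply f 0 ⟨z, hz⟩

theorem ext0_coe {S : Set ℂ} (f : S → ℂ) (z : S) : ext0 f z = f z := ext0_of_mem f z.2

theorem differentiableOn_ext0 {S : Set ℂ} {f : S → ℂ} {g : ℂ → ℂ} (hg : DifferentiableOn ℂ g S)
    (h : ∀ z : S, f z = g z) : DifferentiableOn ℂ (ext0 f) S :=
  hg.congr fun z hz => by rw [ext0_of_mem f hz, h]

/-- The punctured disc `Δ* = {0 < |t| < ε}`. -/
def punctDisc (ε : ℝ) : Set ℂ := {t | 0 < ‖t‖ ∧ ‖t‖ < ε}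

/-- The covering map `e(z) = exp(2πiz)`. -/
def eMap (z : ℂ) : ℂ := Complex.exp (2 * Real.pi * Complex.I * z)

/-- The upper half plane `G = {z : |e(z)| < ε} = {Im z > -log ε / 2π}`: through `e : G → Δ*`
it is the universal covering of the punctured disc. -/
def upperG (ε : ℝ) : Set ℂ := {z | ‖eMap z‖ < ε}

theorem differentiable_eMap : Differentiable ℂ eMap := by unfold eMap; fun_prop

theorem isOpen_upperG (ε : ℝ) : IsOpen (upperG ε) :=
  isOpen_lt differentiable_eMap.continuous.norm continuous_const

theorem isOpen_punctDisc (ε : ℝ) : IsOpen (punctDisc ε) :=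
  (isOpen_lt continuous_const continuous_norm).inter (isOpen_lt continuous_norm continuous_const)

theorem eMap_mem {ε : ℝ} {z : ℂ} (hz : z ∈ upperG ε) : eMap z ∈ punctDisc ε :=
  ⟨norm_pos_iff.2 (Complex.exp_ne_zero _), hz⟩

theorem eMap_add_one (z : ℂ) : eMap (z + 1) = eMap z := by
  unfold eMap
  rw [mul_add, mul_one]
  exact Complex.exp_periodic _

theorem add_one_mem {ε : ℝ} {z : ℂ} (hz : z ∈ upperG ε) : z + 1 ∈ upperG ε := by
  simpa only [upperG, Set.mem_ofPred_eq, eMap_add_one] using hz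

/-- The map `e : G → Δ*`. -/
def eG {ε : ℝ} (z : upperG ε) : punctDisc ε := ⟨eMap z, eMap_mem z.2⟩

/-- The deck transformation `z ↦ z + 1` of `G`. -/
def shiftG {ε : ℝ} (z : upperG ε) : upperG ε := ⟨z + 1, add_one_mem z.2⟩

/-- The ring `𝓞` of analytic functions on `Δ*` that are meromorphic at `0`. -/
def ringO (ε : ℝ) : Subalgebra ℂ (punctDisc ε → ℂ) where
  carrier := {f | ∃ g : ℂ → ℂ, DifferentiableOn ℂ g (punctDisc ε) ∧ MeromorphicAt g 0 ∧
    ∀ t, f t = g t}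
  mul_mem' := by
    rintro _ _ ⟨g, hg, hg', h⟩ ⟨k, hk, hk', h'⟩
    exact ⟨g * k, hg.mul hk, hg'.mul hk', fun t => by simp [h, h']⟩
  add_mem' := by
    rintro _ _ ⟨g, hg, hg', h⟩ ⟨k, hk, hk', h'⟩
    exact ⟨g + k, hg.add hk, hg'.add hk', fun t => by simp [h, h']⟩
  algebraMap_mem' c := ⟨fun _ => c, differentiableOn_const c, MeromorphicAt.const c 0, fun _ => rfl⟩

/-- The space of holomorphic functions on `G`. -/
def holG (ε : ℝ) : Submodule ℂ (upperG ε → ℂ) where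
  carrier := {u | ∃ g : ℂ → ℂ, DifferentiableOn ℂ g (upperG ε) ∧ ∀ z, u z = g z}
  add_mem' := by
    rintro _ _ ⟨g, hg, h⟩ ⟨k, hk, h'⟩
    exact ⟨g + k, hg.add hk, fun t => by simp [h, h']⟩
  zero_mem' := ⟨fun _ => 0, differentiableOn_const 0, fun _ => rfl⟩
  smul_mem' := by
    rintro c _ ⟨g, hg, h⟩
    exact ⟨c • g, hg.const_smul c, fun t => by simp [h]⟩

/-- The type of holomorphic functions on `G`. -/
def HolG (ε : ℝ) : Type := holG ε

instance (ε : ℝ) : AddCommGroup (HolG ε) := inferInstanceAs (AddCommGroup (holG ε))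

instance (ε : ℝ) : Module ℂ (HolG ε) := inferInstanceAs (Module ℂ (holG ε))

/-- A holomorphic function on `G`, as a function. -/
def HolG.fn {ε : ℝ} (u : HolG ε) : upperG ε → ℂ := Subtype.val (show holG ε from u)

theorem HolG.prop {ε : ℝ} (u : HolG ε) :
    ∃ g : ℂ → ℂ, DifferentiableOn ℂ g (upperG ε) ∧ ∀ z, u.fn z = g z :=
  Subtype.property (show holG ε from u)

/-- Constructor for holomorphic functions on `G`. -/
def HolG.mk {ε : ℝ} (f : upperG ε → ℂ)
    (h : ∃ g : ℂ → ℂ, DifferentiableOn ℂ g (upperG ε) ∧ ∀ z, f z = g z) : HolG ε :=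
  (⟨f, h⟩ : holG ε)

theorem HolG.ext {ε : ℝ} {u v : HolG ε} (h : ∀ z, u.fn z = v.fn z) : u = v :=
  Subtype.ext (funext h)

theorem holG_diff {ε : ℝ} (u : HolG ε) : DifferentiableOn ℂ (ext0 u.fn) (upperG ε) := by
  obtain ⟨g, hg, h⟩ := u.prop
  exact differentiableOn_ext0 hg h

theorem holG_diffAt {ε : ℝ} (u : HolG ε) (z : upperG ε) : DifferentiableAt ℂ (ext0 u.fn) z :=
  (holG_diff u).differentiableAt ((isOpen_upperG ε).mem_nhds z.2)

theorem ext0_eventuallyEq {ε : ℝ} {u : upperG ε → ℂ} {g : ℂ → ℂ} {z : ℂ} (hz : z ∈ upperG ε)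
    (h : ∀ w : upperG ε, u w = g w) : ext0 u =ᶠ[𝓝 z] g := by
  filter_upwards [(isOpen_upperG ε).mem_nhds hz] with w hw
  rw [ext0_of_mem u hw, h]

/-! ### Differential operators -/

/-- An element `f` of `𝓞`, as the operator of multiplication by `e^* f` on functions on `G`. -/
def mulOp (ε : ℝ) : ringO ε →ₐ[ℂ] Module.End ℂ (HolG ε) where
  toFun f :=
    { toFun := fun u => HolG.mk (fun z => f.1 (eG z) * u.fn z) (by
        obtain ⟨g, hg, -, h⟩ := f.2
        obtain ⟨k, hk, h'⟩ := u.prop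
        refine ⟨fun z => g (eMap z) * k z, ?_, fun z => by
          rw [h, h']; rfl⟩
        exact (hg.comp differentiable_eMap.differentiableOn fun z hz => eMap_mem hz).mul hk)
      map_add' := fun u v => HolG.ext (fun z => mul_add _ _ _)
      map_smul' := fun c u => HolG.ext (fun z => mul_left_comm _ _ _) }
  map_one' := LinearMap.ext fun u => HolG.ext (fun z => one_mul _)
  map_mul' f g := LinearMap.ext fun u => HolG.ext (fun z => mul_assoc _ _ _)
  map_zero' := LinearMap.ext fun u => HolG.ext (fun z => zero_mul _)
  map_add' f g := LinearMap.ext fun u => HolG.ext (fun z => add_mul _ _ _)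
  commutes' c := LinearMap.ext fun u => HolG.ext (fun z => rfl)

/-- The derivation `D = t d/dt` acting on functions on `G`:
`e^* D = (2πi)⁻¹ d/dz`. -/
def opD (ε : ℝ) : Module.End ℂ (HolG ε) where
  toFun u := HolG.mk (fun z => (2 * Real.pi * Complex.I)⁻¹ * deriv (ext0 u.fn) z)
    ⟨fun z => (2 * Real.pi * Complex.I)⁻¹ * deriv (ext0 u.fn) z,
    ((holG_diff u).deriv (isOpen_upperG ε)).const_mul _, fun _ => rfl⟩
  map_add' u v := HolG.ext (fun z => by
    have : ext0 (u + v).fn =ᶠ[𝓝 (z : ℂ)] ext0 u.fn + ext0 v.fn :=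
      ext0_eventuallyEq z.2 fun w => by
        rw [Pi.add_apply, ext0_coe, ext0_coe]; rfl
    change _ * deriv (ext0 (u + v).fn) z = _ * deriv (ext0 u.fn) z + _ * deriv (ext0 v.fn) z
    rw [this.deriv_eq, deriv_add (holG_diffAt u z) (holG_diffAt v z), mul_add])
  map_smul' c u := HolG.ext (fun z => by
    have : ext0 (c • u).fn =ᶠ[𝓝 (z : ℂ)] c • ext0 u.fn :=
      ext0_eventuallyEq z.2 fun w => by
        rw [Pi.smul_apply, ext0_coe]; rfl
    change _ * deriv (ext0 (c • u).fn) z = c * (_ * deriv (ext0 u.fn) z)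
    rw [this.deriv_eq, deriv_const_smul c (holG_diffAt u z), smul_eq_mul, mul_left_comm])

/-- The ring `𝓓 = 𝓞[D]` of differential operators on `Δ*`, generated by `𝓞` and `D`. It is
realized by its (faithful) action on the holomorphic functions on the universal covering `G`. -/
def ringD (ε : ℝ) : Subalgebra ℂ (Module.End ℂ (HolG ε)) :=
  Algebra.adjoin ℂ (Set.range (mulOp ε) ∪ {opD ε})

/-- The inclusion `𝓞 → 𝓓`. -/
def oToD (ε : ℝ) : ringO ε →ₐ[ℂ] ringD ε :=
  (mulOp ε).codRestrict (ringD ε) fun f => Algebra.subset_adjoin (Or.inl ⟨f, rfl⟩)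

/-- `D` as an element of `𝓓`. -/
def elD (ε : ℝ) : ringD ε := ⟨opD ε, Algebra.subset_adjoin (Or.inr rfl)⟩

section Operator

variable {K : Subfield ℂ}

/-- The value of a rational function at a complex number. -/
def ratVal (r : RatFunc K) (t : ℂ) : ℂ := r.eval K.subtype t

/-- The rational function `r` has no pole at `t`. -/
def NoPole (r : RatFunc K) (t : ℂ) : Prop := r.denom.eval₂ K.subtype t ≠ 0

/-- A rational function without poles on `Δ*`, as an element of `𝓞`. -/
def ratO (ε : ℝ) (r : RatFunc K) (h : ∀ t ∈ punctDisc ε, NoPole r t) : ringO ε :=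
  ⟨fun t => ratVal r t, ratVal r, by
    have hp : ∀ f : Polynomial K, Differentiable ℂ fun t => f.eval₂ K.subtype t := fun f => by
      simp only [Polynomial.eval₂_eq_eval_map]
      exact Polynomial.differentiable _
    refine ⟨?_, ?_, fun _ => rfl⟩
    · exact (hp r.num).differentiableOn.div (hp r.denom).differentiableOn h
    · exact ((hp r.num).analyticAt 0).meromorphicAt.div ((hp r.denom).analyticAt 0).meromorphicAt⟩

variable {m : ℕ}

/-- The operator `L = ∑_{j=0}^m q_j(t) D^{m-j}` as an element of `𝓓`. -/
def opL {ε : ℝ} (q : Fin (m + 1) → RatFunc K)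
    (hq : ∀ j, ∀ t ∈ punctDisc ε, NoPole (q j) t) : ringD ε :=
  ∑ j : Fin (m + 1), oToD ε (ratO ε (q j) (hq j)) * elD ε ^ (m - (j : ℕ))

/-- The solutions of `L` on the universal covering `G`. -/
def solG {ε : ℝ} (q : Fin (m + 1) → RatFunc K)
    (hq : ∀ j, ∀ t ∈ punctDisc ε, NoPole (q j) t) : Submodule ℂ (HolG ε) :=
  LinearMap.ker (opL q hq).1

/-- `u(z) ↦ u(z + 1)` on holomorphic functions on `G`. -/
def shiftOp (ε : ℝ) : Module.End ℂ (HolG ε) where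
  toFun u := HolG.mk (fun z => u.fn (shiftG z)) (by
    obtain ⟨g, hg, h⟩ := u.prop
    refine ⟨fun z => g (z + 1), ?_, fun z => h _⟩
    exact hg.comp (by fun_prop) fun z hz => add_one_mem hz)
  map_add' _ _ := rfl
  map_smul' _ _ := rfl

theorem shiftOp_comm_opD (ε : ℝ) : Commute (shiftOp ε) (opD ε) :=
  LinearMap.ext fun u => HolG.ext (fun z => by
    have : ext0 (shiftOp ε u).fn =ᶠ[𝓝 (z : ℂ)] fun w => ext0 u.fn (w + 1) :=
      ext0_eventuallyEq z.2 fun w => (ext0_coe u.fn (shiftG w)).symm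
    change _ * deriv (ext0 u.fn) ((z : ℂ) + 1) = _ * deriv (ext0 (shiftOp ε u).fn) z
    rw [this.deriv_eq, deriv_comp_add_const])

theorem shiftOp_comm_mulOp (ε : ℝ) (f : ringO ε) : Commute (shiftOp ε) (mulOp ε f) :=
  LinearMap.ext fun u => HolG.ext (fun z => by
    have : eG (shiftG z) = eG z := Subtype.ext (eMap_add_one z)
    change f.1 (eG (shiftG z)) * _ = f.1 (eG z) * _
    rw [this]; rfl)

theorem shiftOp_mem {ε : ℝ} (q : Fin (m + 1) → RatFunc K)
    (hq : ∀ j, ∀ t ∈ punctDisc ε, NoPole (q j) t) :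
    ∀ u ∈ solG q hq, shiftOp ε u ∈ solG q hq := by
  have h : Commute (shiftOp ε) (opL q hq).1 := by
    have : (opL q hq).1 = ∑ j : Fin (m + 1),
        mulOp ε (ratO ε (q j) (hq j)) * opD ε ^ (m - (j : ℕ)) := by
      simp only [opL, AddSubmonoidClass.coe_finsetSum]; rfl
    rw [this]
    exact Commute.sum_right _ _ _ fun j _ =>
      (shiftOp_comm_mulOp ε _).mul_right ((shiftOp_comm_opD ε).pow_right _)
  intro u hu
  have h2 := LinearMap.congr_fun h.eq u
  simp only [Module.End.mul_apply] at h2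
  rw [solG, LinearMap.mem_ker] at hu ⊢
  rw [← h2, hu, map_zero]

/-- The local monodromy `σ₀` on solutions: analytic continuation along the counterclockwise loop
around `0`, i.e. `(σ₀ u)(z) = u(z + 1)`. -/
def monodromyG {ε : ℝ} (q : Fin (m + 1) → RatFunc K)
    (hq : ∀ j, ∀ t ∈ punctDisc ε, NoPole (q j) t) : Module.End ℂ (solG q hq) :=
  (shiftOp ε).restrict (shiftOp_mem q hq)

/-- The derivation `D = t d/dt` on functions of `t`. -/
def Dt (f : ℂ → ℂ) : ℂ → ℂ := fun t => t * deriv f t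

theorem analyticAt_Dt {f : ℂ → ℂ} {p : ℂ} (hf : AnalyticAt ℂ f p) : AnalyticAt ℂ (Dt f) p :=
  analyticAt_id.mul hf.deriv

theorem analyticAt_Dt_iter {f : ℂ → ℂ} {p : ℂ} (hf : AnalyticAt ℂ f p) (k : ℕ) :
    AnalyticAt ℂ (Dt^[k] f) p := by
  induction k with
  | zero => exact hf
  | succ k ih => rw [Function.iterate_succ_apply']; exact analyticAt_Dt ih

theorem Dt_congr {f g : ℂ → ℂ} {p : ℂ} (h : f =ᶠ[𝓝 p] g) : Dt f =ᶠ[𝓝 p] Dt g := by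
  filter_upwards [h.deriv] with t ht
  simp only [Dt, ht]

theorem Dt_iter_add {f g : ℂ → ℂ} {p : ℂ} (hf : AnalyticAt ℂ f p) (hg : AnalyticAt ℂ g p)
    (k : ℕ) : Dt^[k] (f + g) =ᶠ[𝓝 p] Dt^[k] f + Dt^[k] g := by
  induction k with
  | zero => rfl
  | succ k ih =>
    simp only [Function.iterate_succ_apply']
    refine (Dt_congr ih).trans ?_
    filter_upwards [(analyticAt_Dt_iter hf k).eventually_analyticAt,
      (analyticAt_Dt_iter hg k).eventually_analyticAt] with t h1 h2
    simp only [Dt, Pi.add_apply]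
    rw [deriv_add h1.differentiableAt h2.differentiableAt, mul_add]

theorem Dt_iter_smul (c : ℂ) (f : ℂ → ℂ) (k : ℕ) : Dt^[k] (c • f) = c • Dt^[k] f := by
  induction k with
  | zero => rfl
  | succ k ih =>
    simp only [Function.iterate_succ_apply', ih]
    funext t
    simp only [Dt, Pi.smul_apply, smul_eq_mul]
    rw [deriv_const_smul_field, smul_eq_mul, mul_left_comm]

/-- `(L f)(t)` for a function `f` of the variable `t`. -/
def applyL (q : Fin (m + 1) → RatFunc K) (f : ℂ → ℂ) (t : ℂ) : ℂ :=
  ∑ j : Fin (m + 1), ratVal (q j) t * Dt^[m - (j : ℕ)] f t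

/-- `Sol_p(L)`: the space of germs at `p` of analytic solutions of `L`. -/
def solAt (q : Fin (m + 1) → RatFunc K) (p : ℂ) : Submodule ℂ (Germ (𝓝 p) ℂ) where
  carrier := {u | ∃ f : ℂ → ℂ, u = (f : Germ (𝓝 p) ℂ) ∧ AnalyticAt ℂ f p ∧
    ∀ᶠ t in 𝓝 p, applyL q f t = 0}
  add_mem' := by
    rintro _ _ ⟨f, rfl, hf, h⟩ ⟨g, rfl, hg, h'⟩
    refine ⟨f + g, rfl, hf.add hg, ?_⟩
    have hall := eventually_all.2 fun j : Fin (m + 1) => Dt_iter_add hf hg (m - (j : ℕ))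
    filter_upwards [h, h', hall] with t h1 h2 h3
    simp only [applyL, h3, Pi.add_apply, mul_add, Finset.sum_add_distrib] at h1 h2 ⊢
    rw [h1, h2, add_zero]
  zero_mem' := by
    have h0 : ∀ k : ℕ, Dt^[k] 0 = 0 := fun k => by simpa using Dt_iter_smul 0 0 k
    refine ⟨0, rfl, analyticAt_const, Eventually.of_forall fun t => ?_⟩
    simp only [applyL, h0, Pi.zero_apply, mul_zero, Finset.sum_const_zero]
  smul_mem' := by
    rintro c _ ⟨f, rfl, hf, h⟩
    refine ⟨c • f, rfl, hf.const_smul, ?_⟩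
    filter_upwards [h] with t h1
    simp only [applyL, Dt_iter_smul, Pi.smul_apply, smul_eq_mul, mul_left_comm _ c,
      ← Finset.mul_sum] at h1 ⊢
    rw [h1, mul_zero]

/-! ### Local exponents and the Frobenius method -/

/-- The indicial polynomial at `t = 0` of `L` (divided by its leading coefficient `q₀`). -/
def indicial (q : Fin (m + 1) → RatFunc K) : Polynomial K :=
  ∑ j : Fin (m + 1), Polynomial.C ((q j / q 0).eval (RingHom.id K) 0) * Polynomial.X ^ (m - (j : ℕ))

/-- The set of local exponents of `L` at `t = 0`. -/
def localExponents (q : Fin (m + 1) → RatFunc K) : Set ℂ := {s | (indicial q).eval₂ K.subtype s = 0}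

/-- The Taylor expansion at `t = 0` of a rational function without pole at `0`. -/
def taylor0 (r : RatFunc K) : PowerSeries K := (r.num : PowerSeries K) * (r.denom : PowerSeries K)⁻¹

/-- The polynomials `p_i` in the expansion `q₀⁻¹ L = ∑_{i ≥ 0} t^i p_i(D)`. -/
def coeffPoly (q : Fin (m + 1) → RatFunc K) (i : ℕ) : Polynomial K :=
  ∑ j : Fin (m + 1),
    Polynomial.C (PowerSeries.coeff i (taylor0 (q j / q 0))) * Polynomial.X ^ (m - (j : ℕ))

/-- `p_i(n + s)` as a power series in `s`. -/
def shiftedPoly (q : Fin (m + 1) → RatFunc K) (i n : ℕ) : PowerSeries K :=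
  ((coeffPoly q i).comp (Polynomial.X + Polynomial.C (n : K)) : Polynomial K)

/-- The coefficients `a_n(s)`, expanded at `s = 0`, of the Frobenius series
`Φ(s,t) = ∑ a_n(s) t^{n+s}`: `a_0 = 1` and `∑_{i=0}^n p_i(n - i + s) a_{n-i}(s) = 0`, `n ≥ 1`. -/
def frobCoeff (q : Fin (m + 1) → RatFunc K) : ℕ → PowerSeries K
  | 0 => 1
  | n + 1 => -(shiftedPoly q 0 (n + 1))⁻¹ *
      ∑ l : Fin (n + 1), shiftedPoly q (n + 1 - (l : ℕ)) l * frobCoeff q l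

/-- The power series `φ_k^an = ∑_n (a_n^{(k)}(0) / k!) t^n ∈ K⟦t⟧`. -/
def frobSeries (q : Fin (m + 1) → RatFunc K) (k : ℕ) : PowerSeries K :=
  PowerSeries.mk fun n => PowerSeries.coeff k (frobCoeff q n)

/-- The sum of the series `φ_k^an` at a complex number `t`. -/
def frobAn (q : Fin (m + 1) → RatFunc K) (k : ℕ) (t : ℂ) : ℂ :=
  ∑' n : ℕ, ((PowerSeries.coeff n (frobSeries q k) : K) : ℂ) * t ^ n

/-- `φ_k(t) = ∑_{j=0}^k log(t)^j / j! φ_{k-j}^an(t)`, for a branch `ℓ` of the logarithm. -/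
def frobSol (q : Fin (m + 1) → RatFunc K) (ℓ : ℂ → ℂ) (k : ℕ) (t : ℂ) : ℂ :=
  ∑ j ∈ Finset.range (k + 1), ℓ t ^ j / (j.factorial : ℂ) * frobAn q (k - j) t

/-! ### The connection `H = 𝓓 / 𝓓 L` -/

/-- `H = 𝓓 / 𝓓 L`. -/
def connH {ε : ℝ} (q : Fin (m + 1) → RatFunc K)
    (hq : ∀ j, ∀ t ∈ punctDisc ε, NoPole (q j) t) : Type :=
  ringD ε ⧸ (Submodule.span (ringD ε) {opL q hq})

section

variable {ε : ℝ} (q : Fin (m + 1) → RatFunc K)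
  (hq : ∀ j, ∀ t ∈ punctDisc ε, NoPole (q j) t)

instance : AddCommGroup (connH q hq) :=
  inferInstanceAs (AddCommGroup (ringD ε ⧸ (Submodule.span (ringD ε) {opL q hq})))

/-- `H` is a left `𝓓`-module; the action of `D` is the connection. -/
instance : Module (ringD ε) (connH q hq) :=
  inferInstanceAs (Module (ringD ε) (ringD ε ⧸ (Submodule.span (ringD ε) {opL q hq})))

instance : Module ℂ (connH q hq) :=
  inferInstanceAs (Module ℂ (ringD ε ⧸ (Submodule.span (ringD ε) {opL q hq})))

/-- The structure of `𝓞`-module on `H`. -/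
instance : Module (ringO ε) (connH q hq) :=
  Module.compHom (connH q hq) (oToD ε).toRingHom

end

/-- The class of `D^j` in `H`. -/
def classD {ε : ℝ} (q : Fin (m + 1) → RatFunc K)
    (hq : ∀ j, ∀ t ∈ punctDisc ε, NoPole (q j) t) (j : ℕ) : connH q hq :=
  (Submodule.span (ringD ε) {opL q hq}).mkQ (elD ε ^ j)

/-- The filtration `F^k H = ∑_{0 ≤ j ≤ m-1-k} 𝓞 D^j`. -/
def filF {ε : ℝ} (q : Fin (m + 1) → RatFunc K)
    (hq : ∀ j, ∀ t ∈ punctDisc ε, NoPole (q j) t) (k : ℤ) : Submodule (ringO ε) (connH q hq) :=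
  Submodule.span (ringO ε) {h | ∃ j : ℕ, (j : ℤ) ≤ m - 1 - k ∧ j < m ∧ h = classD q hq j}

/-- Algebraic classes in `H`: the classes `∑_{j<m} v_j(t) D^j` with all `v_j ∈ K(t)`. -/
def IsAlgClass {ε : ℝ} (q : Fin (m + 1) → RatFunc K)
    (hq : ∀ j, ∀ t ∈ punctDisc ε, NoPole (q j) t) (h : connH q hq) : Prop :=
  ∃ (v : Fin m → RatFunc K) (hv : ∀ j, ∀ t ∈ punctDisc ε, NoPole (v j) t),
    h = ∑ j : Fin m, ratO ε (v j) (hv j) • classD q hq j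

/-- `P ↦ (u ↦ (P u)(z))`, for a differential operator `P` and a solution `u` of `L`. -/
def evalOp {ε : ℝ} (q : Fin (m + 1) → RatFunc K)
    (hq : ∀ j, ∀ t ∈ punctDisc ε, NoPole (q j) t) (z : upperG ε) :
    ringD ε →ₗ[ℂ] Module.Dual ℂ (solG q hq) where
  toFun P :=
    { toFun := fun u => (P.1 u.1).fn z
      map_add' := fun u v => congrArg (fun w => HolG.fn w z) (map_add P.1 u.1 v.1)
      map_smul' := fun c u => congrArg (fun w => HolG.fn w z) (map_smul P.1 c u.1) }
  map_add' _ _ := rfl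
  map_smul' _ _ := rfl

/-- The map `π_z` from `H` to the dual of the space of solutions,
`⟨π_z(v), u⟩ = (v u)(z) = ∑_j v_j(e(z)) ((e^* D)^j u)(z)` for `v = ∑_j v_j D^j`. -/
def piMap {ε : ℝ} (q : Fin (m + 1) → RatFunc K)
    (hq : ∀ j, ∀ t ∈ punctDisc ε, NoPole (q j) t) (z : upperG ε) :
    connH q hq →ₗ[ℂ] Module.Dual ℂ (solG q hq) :=
  (((Submodule.span (ringD ε) {opL q hq}).restrictScalars ℂ).liftQ (evalOp q hq z) (by
    intro P hP
    obtain ⟨Q, rfl⟩ := Submodule.mem_span_singleton.1 (Submodule.restrictScalars_mem ℂ _ _ |>.1 hP)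
    refine LinearMap.mem_ker.2 (LinearMap.ext fun u => ?_)
    change (Q.1 ((opL q hq).1 u.1)).fn z = 0
    rw [LinearMap.mem_ker.1 u.2, map_zero]
    rfl)).comp
  (Submodule.Quotient.restrictScalarsEquiv ℂ (Submodule.span (ringD ε) {opL q hq})).symm.toLinearMap

end Operator

/-! ### Exponentials and logarithms -/

/-- The exponential of a nilpotent element. -/
def expNil {A : Type*} [Ring A] [Algebra ℂ A] (a : A) : A :=
  ∑ h ∈ Finset.range (nilpotencyClass a), ((h.factorial : ℂ)⁻¹) • a ^ h

/-- The logarithm `∑_{h ≥ 1} (-1)^{h-1} (σ - 1)^h / h` of a unipotent element. -/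
def logUni {A : Type*} [Ring A] [Algebra ℂ A] (σ : A) : A :=
  ∑ h ∈ Finset.Ico 1 (nilpotencyClass (σ - 1)), ((-1 : ℂ) ^ (h - 1) / (h : ℂ)) • (σ - 1) ^ h

/-- The nilpotent matrix with a single Jordan block. -/
def jordanN (m : ℕ) : Matrix (Fin m) (Fin m) ℂ :=
  Matrix.of fun i j => if (i : ℕ) + 1 = (j : ℕ) then 1 else 0

/-- Maximally unipotent operators on a space of dimension `m`: in some basis the matrix is
`exp(N)` with `N` a single nilpotent Jordan block. -/
def IsMaxUnipotent {V : Type*} [AddCommGroup V] [Module ℂ V] (m : ℕ) (σ : Module.End ℂ V) : Prop :=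
  ∃ b : Module.Basis (Fin m) ℂ V, LinearMap.toMatrix b b σ = expNil (jordanN m)

section Transport

variable {K : Subfield ℂ} {m : ℕ} {ε : ℝ} {q : Fin (m + 1) → RatFunc K}
  {hq : ∀ j, ∀ t ∈ punctDisc ε, NoPole (q j) t} {p : ℂ}

/-- `c` is analytic continuation of the solutions near `p` to `G`, where a neighbourhood of `p` is
lifted to `G` by `z = ℓ(t) / 2πi` for a branch `ℓ` of the logarithm near `p`. -/
def IsContinuation (ℓ : ℂ → ℂ) (c : solAt q p ≃ₗ[ℂ] solG q hq) : Prop :=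
  ∀ u : solAt q p,
    (u : Germ (𝓝 p) ℂ) = ((fun t => ext0 (c u).1.fn (ℓ t / (2 * Real.pi * Complex.I)) : ℂ → ℂ) :
      Germ (𝓝 p) ℂ)

/-- The local monodromy `σ₀` on `Sol_p(L)`. -/
def monodromyAt (c : solAt q p ≃ₗ[ℂ] solG q hq) : Module.End ℂ (solAt q p) :=
  c.symm.toLinearMap ∘ₗ monodromyG q hq ∘ₗ c.toLinearMap

/-- `N = log σ₀`, acting on the dual of `Sol_p(L)` by `⟨N λ, u⟩ = ⟨λ, N u⟩`. -/
def dualN (c : solAt q p ≃ₗ[ℂ] solG q hq) : Module.End ℂ (Module.Dual ℂ (solAt q p)) :=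
  (logUni (monodromyAt c)).dualMap

/-- `π'_z = exp(-zN) ∘ π_z`, a map from `H` to the dual of `Sol_p(L)`. -/
def schmidMap (c : solAt q p ≃ₗ[ℂ] solG q hq) (z : upperG ε) :
    connH q hq →ₗ[ℂ] Module.Dual ℂ (solAt q p) :=
  expNil ((-(z : ℂ)) • dualN c) ∘ₗ c.toLinearMap.dualMap ∘ₗ piMap q hq z

/-- The subspace `exp(-zN) π_z(F^k H)`. -/
def schmidFil (c : solAt q p ≃ₗ[ℂ] solG q hq) (k : ℤ) (z : upperG ε) :
    Submodule ℂ (Module.Dual ℂ (solAt q p)) :=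
  Submodule.span ℂ (schmidMap c z '' (filF q hq k : Set (connH q hq)))

/-- `lim_{Im z → ∞} π'_z(h) = lam`. -/
def IsSchmidLimit (c : solAt q p ≃ₗ[ℂ] solG q hq) (h : connH q hq)
    (lam : Module.Dual ℂ (solAt q p)) : Prop :=
  ∀ u : solAt q p,
    Tendsto (fun z : upperG ε => schmidMap c z h u)
      (comap (fun z : upperG ε => (z : ℂ).im) atTop) (𝓝 (lam u))

/-- The `R`-span (`R = ℂ` or `R = K`) of `φ_0^∨, …, φ_{m-1-k}^∨`, where `φ_j^∨` is the basis dual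
to `φ_j`. -/
def dualFil {V : Type*} [AddCommGroup V] [Module ℂ V] (R : Type*) [Semiring R]
    [Module R (Module.Dual ℂ V)] (φ : Module.Basis (Fin m) ℂ V) (k : ℤ) :
    Submodule R (Module.Dual ℂ V) :=
  Submodule.span R {x | ∃ j : Fin m, (j : ℤ) ≤ m - 1 - k ∧ x = φ.dualBasis j}

/-- `W_k = N^{m-1-⌊k/2⌋}(V^∨)`, with `V = Sol_p(L)`; the exponent is read as `0` if negative. -/
def weightFil (c : solAt q p ≃ₗ[ℂ] solG q hq) (k : ℤ) :
    Submodule ℂ (Module.Dual ℂ (solAt q p)) :=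
  LinearMap.range (dualN c ^ ((m : ℤ) - 1 - k / 2).toNat)

end Transport

/-- Convergence `F a → W` along a filter, in the Grassmannian of subspaces of the dual of a
finite-dimensional space `V`: there are bases of the `F a` that converge to a basis of `W`. -/
def TendstoGrass {α V : Type*} [AddCommGroup V] [Module ℂ V] (l : Filter α)
    (F : α → Submodule ℂ (Module.Dual ℂ V)) (W : Submodule ℂ (Module.Dual ℂ V)) : Prop :=
  ∃ (d : ℕ) (w : α → Fin d → Module.Dual ℂ V) (w' : Fin d → Module.Dual ℂ V),
    (∀ᶠ a in l, LinearIndependent ℂ (w a) ∧ Submodule.span ℂ (Set.range (w a)) = F a) ∧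
    LinearIndependent ℂ w' ∧ Submodule.span ℂ (Set.range w') = W ∧
    ∀ i u, Tendsto (fun a => w a i u) l (𝓝 (w' i u))

/-! ### Filtrations and mixed Hodge structures -/

section Hodge

variable {E : Type*} [AddCommGroup E] [Module ℂ E]

/-- `J` is the Jacobson filtration of the nilpotent operator `N`: a finite increasing filtration
with `N J_k ⊆ J_{k-2}` such that `N^k : gr_k → gr_{-k}` is injective and surjective, `k ≥ 0`. -/
structure IsJacobson (N : Module.End ℂ E) (J : ℤ → Submodule ℂ E) : Prop where
  mono : Monotone J
  exists_bot : ∃ k, J k = ⊥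
  exists_top : ∃ k, J k = ⊤
  map_le : ∀ k, (J k).map N ≤ J (k - 2)
  inj : ∀ k : ℕ, J k ⊓ (J (-(k : ℤ) - 1)).comap (N ^ k) ≤ J ((k : ℤ) - 1)
  surj : ∀ k : ℕ, J (-(k : ℤ)) ≤ (J k).map (N ^ k) ⊔ J (-(k : ℤ) - 1)

/-- The graded piece `gr_n^W = W_n / W_{n-1}`. -/
abbrev grW (W : ℤ → Submodule ℂ E) (n : ℤ) : Type _ := W n ⧸ (W (n - 1)).submoduleOf (W n)

/-- The subspace induced by `F ⊆ E` on `gr_n^W`. -/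
def inducedGr (W : ℤ → Submodule ℂ E) (n : ℤ) (F : Submodule ℂ E) : Submodule ℂ (grW W n) :=
  (F.submoduleOf (W n)).map ((W (n - 1)).submoduleOf (W n)).mkQ

/-- `(E, W, F)` is a mixed Hodge structure with respect to the real structure on `E` given by the
complex conjugation `conj`: `W` is a finite increasing filtration defined over `ℝ`, `F` is a finite
decreasing filtration, and on each `gr_n^W` the filtrations induced by `F` and by its complex
conjugate are `n`-opposed, i.e. `F` induces a pure Hodge structure of weight `n`. -/
structure IsMixedHodge (conj : E →ₛₗ[starRingEnd ℂ] E) (W F : ℤ → Submodule ℂ E) : Prop where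
  conj_conj : ∀ x, conj (conj x) = x
  W_real : ∀ n, (W n).map conj = W n
  W_mono : Monotone W
  W_bot : ∃ n, W n = ⊥
  W_top : ∃ n, W n = ⊤
  F_anti : Antitone F
  F_bot : ∃ p, F p = ⊥
  F_top : ∃ p, F p = ⊤
  opposed : ∀ n p : ℤ,
    IsCompl (inducedGr W n (F p)) (inducedGr W n ((F (n + 1 - p)).map conj))

/-- The Hodge filtration of the Tate structure `ℂ(-k)` (of weight `2k`) on `ℂ`: it is everything
in degrees `≤ k` and zero in degrees `> k`. -/
def tateF (k p : ℤ) : Submodule ℂ ℂ := if p ≤ k then ⊤ else ⊥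

/-- `gr^W (E, W, F) = ⊕_{k=0}^{m-1} ℂ(-k)`: the graded piece of weight `2k` is isomorphic to
`ℂ(-k)` with its Hodge filtration, `0 ≤ k ≤ m-1`, and all other graded pieces vanish. -/
def GrIsTate (m : ℕ) (W F : ℤ → Submodule ℂ E) : Prop :=
  (∀ k : ℕ, k < m → ∃ e : grW W (2 * k) ≃ₗ[ℂ] ℂ,
    ∀ p, (inducedGr W (2 * k) (F p)).map e.toLinearMap = tateF k p) ∧
  ∀ n : ℤ, (¬ ∃ k : ℕ, k < m ∧ n = 2 * k) → Subsingleton (grW W n)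

end Hodge

end LimMHS

end

open Filter Topology

noncomputable section

namespace LimMHS

/-! ### Exponentials and logarithms of nilpotent elements -/

section NilpotentLog

open Polynomial

/-! Write θ = t d/dt, let s be a formal variable, and put Φ(s,t) = ∑ a_n(s) tⁿ, whose coefficient of
s^k is φ_k^an. Since 0 is the only local exponent, the indicial polynomial is s^m, and the recursion
for the a_n says that q₀⁻¹L with θ replaced by θ + s sends Φ to s^m (`sum_qSer_mul_thetaS`). Hence
the coefficients of s^k, k < m, in exp(s log t) Φ(s,t) are solutions (`logHol_mem_solG`). They
converge because, modulo a power of s, the recursion loses only a factor 1 + O(1/n) at each step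
(`convS_phiSer`). On G one has log t = 2πiz, so z ↦ z + 1 multiplies the generating series by
exp(2πis). Thus N is 2πi times multiplication by s: φ_k ↦ 2πi φ_{k-1}.

Maximal unipotence supplies the dimension m of the space of solutions on G. A solution with zero
m-jet at one point vanishes (`eventually_eq_zero_of_norm_deriv_le` and the identity theorem), so by
dimension every m-jet is attained. This identifies solutions on G with germs at p
(`restrictSol_bijective`) and proves that 1, D, …, D^{m-1} are independent over 𝓞.

The values ⟨π_z(D^j), φ_k⟩ are the coefficients of s^k in exp(2πizs)(θ+s)^jΦ at t = e(z). The twist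
by exp(-zN) cancels exactly the exponential (`IsFrobBasis.schmidMap_sum`) and leaves a matrix
P(e(z)) with P holomorphic at t = 0. Since a_0 = 1, P(0) = 1 (`periodMatrix_zero`). So π'_z(D^j)
tends to φ_j^∨, and π'_z(∑ v_j D^j) converges exactly when all v_j(e(z)) do
(`IsFrobBasis.isSchmidLimit_iff`). Part (i) follows; rationality over K holds because a rational
function over K with a finite limit at 0 takes a value in K there. Near t = 0 the invertibility of P
also shows that the φ_k form a basis (`span_frobG`).

For (ii), N φ_j^∨ = 2πi φ_{j+1}^∨ is a single Jordan block. Its only invariant subspaces are the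
images of powers of N (`IsBlock.exists_eq_range`), so a Jacobson filtration is a sequence of
exponents, and the axioms determine it (`jacobson_exponent`). Finally gr_{2k} is the line of
φ_{m-1-k}^∨, on which the filtration induced by F_∞ jumps exactly at k. The same holds for its
conjugate under any real structure preserving W, which gives opposedness. -/

/-- The truncated exponential series. -/
def expPoly (n : ℕ) : ℂ[X] := ∑ h ∈ Finset.range n, C ((h.factorial : ℂ)⁻¹) * X ^ h

/-- The truncated logarithm series. -/
def logPoly (n : ℕ) : ℂ[X] := ∑ h ∈ Finset.Ico 1 n, C ((-1 : ℂ) ^ (h - 1) / (h : ℂ)) * X ^ h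

theorem derivative_expPoly (n : ℕ) : derivative (expPoly (n + 1)) = expPoly n := by
  simp only [expPoly, map_sum, Finset.sum_range_succ', derivative_C_mul_X_pow, map_add]
  simp only [Nat.cast_zero, mul_zero, C_0, zero_mul, add_zero]
  refine Finset.sum_congr rfl fun h _ => ?_
  have : (h + 1 : ℂ) ≠ 0 := Nat.cast_add_one_ne_zero h
  have h2 : ((h + 1).factorial : ℂ)⁻¹ * ((h + 1 : ℕ) : ℂ) = (h.factorial : ℂ)⁻¹ := by
    rw [Nat.factorial_succ]
    push_cast
    field_simp
  rw [h2, Nat.add_sub_cancel]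

theorem derivative_logPoly (n : ℕ) :
    (1 + X) * derivative (logPoly (n + 1)) = 1 - (-X) ^ n := by
  induction n with
  | zero => simp [logPoly]
  | succ n ih =>
    have : logPoly (n + 2) = logPoly (n + 1) + C ((-1 : ℂ) ^ n / ((n + 1 : ℕ) : ℂ)) * X ^ (n + 1) := by
      unfold logPoly
      rw [Finset.sum_Ico_succ_top (by omega)]
      simp
    rw [this, derivative_add, mul_add, ih, derivative_C_mul_X_pow,
      div_mul_cancel₀ _ (Nat.cast_ne_zero.2 n.succ_ne_zero), Nat.add_sub_cancel]
    simp only [map_pow, map_neg, map_one]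
    rw [neg_pow (X : ℂ[X]) n, neg_pow (X : ℂ[X]) (n + 1)]
    ring

/-- The identity log(exp X) = X up to order n: the difference has zero constant term, and its
derivative is divisible by X^n. -/
theorem X_pow_dvd_logPoly_comp_expPoly (n : ℕ) :
    X ^ (n + 1) ∣ (logPoly (n + 1)).comp (expPoly (n + 1) - 1) - X := by
  set y := expPoly (n + 1) - 1 with hy
  have hy0 : y.coeff 0 = 0 := by
    simp [hy, expPoly, Finset.sum_range_succ', coeff_zero_eq_eval_zero, eval_finsetSum]
  have hXy : X ∣ y := X_dvd_iff.2 hy0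
  have hy1 : derivative y = 1 + y - C ((n.factorial : ℂ)⁻¹) * X ^ n := by
    rw [hy, derivative_sub, derivative_expPoly, derivative_one]
    simp only [expPoly, Finset.sum_range_succ]
    ring
  have hF' : X ^ n ∣ derivative ((logPoly (n + 1)).comp y - X) := by
    have h1 := congrArg (fun P => comp P y) (derivative_logPoly n)
    simp only [mul_comp, add_comp, one_comp, X_comp, sub_comp, pow_comp, neg_comp] at h1
    -- Chain rule, with y' = 1 + y - X^n/n!. The factor 1 + y combines with the derivative of the
    -- logarithm to give 1 - (-y)^n, whose 1 cancels the derivative of X.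
    have : derivative ((logPoly (n + 1)).comp y - X) = -(-y) ^ n -
        X ^ n * (C ((n.factorial : ℂ)⁻¹) * (derivative (logPoly (n + 1))).comp y) := by
      rw [derivative_sub, derivative_comp, derivative_X, hy1]
      linear_combination h1
    rw [this]
    exact dvd_sub ((pow_dvd_pow_of_dvd (hXy.neg_right) n).neg_right) (dvd_mul_right _ _)
  rw [X_pow_dvd_iff]
  rintro (_ | d) hd
  · have hL : (logPoly (n + 1)).eval 0 = 0 := by
      unfold logPoly
      rw [eval_finsetSum]
      refine Finset.sum_eq_zero fun h hh => ?_
      have : h ≠ 0 := by have := (Finset.mem_Ico.1 hh).1; omega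
      simp [this]
    rw [coeff_zero_eq_eval_zero] at hy0
    rw [coeff_zero_eq_eval_zero]
    simp [hy0, hL]
  · have := X_pow_dvd_iff.1 hF' d (by omega)
    rw [coeff_derivative] at this
    exact (mul_eq_zero.1 this).resolve_right (Nat.cast_add_one_ne_zero d)

variable {A : Type*} [Ring A] [Algebra ℂ A]

/-- The truncation order is immaterial once it kills a, so one common order can serve several
nilpotent elements. -/
theorem expNil_eq_aeval {a : A} {n : ℕ} (h : a ^ n = 0) : expNil a = aeval a (expPoly n) := by
  have hle : nilpotencyClass a ≤ n := Nat.sInf_le h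
  have h0 : a ^ nilpotencyClass a = 0 := pow_nilpotencyClass ⟨n, h⟩
  simp only [expNil, expPoly, map_sum, map_mul, aeval_C, map_pow, aeval_X, ← Algebra.smul_def]
  refine Finset.sum_subset (Finset.range_mono hle) fun i _ hi => ?_
  rw [pow_eq_zero_of_le (by simpa using hi) h0, smul_zero]

theorem expNil_eq_sum {a : A} {n : ℕ} (h : a ^ n = 0) :
    expNil a = ∑ h ∈ Finset.range n, ((h.factorial : ℂ)⁻¹) • a ^ h := by
  rw [expNil_eq_aeval h]
  simp only [expPoly, map_sum, map_mul, aeval_C, map_pow, aeval_X, ← Algebra.smul_def]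

theorem logUni_eq_aeval {s : A} {n : ℕ} (h : (s - 1) ^ n = 0) :
    logUni s = aeval (s - 1) (logPoly n) := by
  have hle : nilpotencyClass (s - 1) ≤ n := Nat.sInf_le h
  have h0 : (s - 1) ^ nilpotencyClass (s - 1) = 0 := pow_nilpotencyClass ⟨n, h⟩
  simp only [logUni, logPoly, map_sum, map_mul, aeval_C, map_pow, aeval_X, ← Algebra.smul_def]
  refine Finset.sum_subset (Finset.Ico_subset_Ico_right hle) fun i hi hi' => ?_
  have : nilpotencyClass (s - 1) ≤ i := by
    simp only [Finset.mem_Ico, not_and, not_lt] at hi hi'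
    exact hi' hi.1
  rw [pow_eq_zero_of_le this h0, smul_zero]

/-- The polynomial congruence is evaluated at a. Since exp(a) - 1 is a multiple of a, the same order
truncates the logarithm. -/
theorem logUni_expNil {a : A} (h : IsNilpotent a) : logUni (expNil a) = a := by
  obtain ⟨n, h⟩ := h
  have h : a ^ (n + 1) = 0 := by rw [pow_succ, h, zero_mul]
  have he := expNil_eq_aeval h
  have hX : X ∣ expPoly (n + 1) - 1 :=
    X_dvd_iff.2 (by simp [expPoly, Finset.sum_range_succ', coeff_zero_eq_eval_zero, eval_finsetSum])
  have h1 : (expNil a - 1) ^ (n + 1) = 0 := by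
    obtain ⟨P, hP⟩ := pow_dvd_pow_of_dvd hX (n + 1)
    have := congrArg (aeval a) hP
    rw [map_mul, map_pow, map_pow, aeval_X, h, zero_mul, map_sub, map_one, ← he] at this
    exact this
  rw [logUni_eq_aeval h1]
  obtain ⟨P, hP⟩ := X_pow_dvd_logPoly_comp_expPoly n
  have := congrArg (aeval a) hP
  rw [map_mul, map_pow, aeval_X, h, zero_mul, map_sub, aeval_comp, map_sub, map_one, ← he,
    aeval_X] at this
  exact sub_eq_zero.1 this

end NilpotentLog

/-! ### A single nilpotent Jordan block -/

section Block

variable {E : Type*} [AddCommGroup E] [Module ℂ E] {m : ℕ}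

/-- The `j`-th coordinate with respect to a basis, extended by zero to all natural numbers. -/
def natCoord (e : Module.Basis (Fin m) ℂ E) (j : ℕ) : E →ₗ[ℂ] ℂ :=
  if h : j < m then e.coord ⟨j, h⟩ else 0

theorem natCoord_of_lt (e : Module.Basis (Fin m) ℂ E) {j : ℕ} (h : j < m) :
    natCoord e j = e.coord ⟨j, h⟩ := dif_pos h

theorem natCoord_coe (e : Module.Basis (Fin m) ℂ E) (j : Fin m) :
    natCoord e j = e.coord j := natCoord_of_lt e j.2

theorem natCoord_of_le (e : Module.Basis (Fin m) ℂ E) {j : ℕ} (h : m ≤ j) :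
    natCoord e j = 0 := dif_neg h.not_gt

theorem natCoord_basis (e : Module.Basis (Fin m) ℂ E) (j : ℕ) (i : Fin m) :
    natCoord e j (e i) = if j = i then 1 else 0 := by
  by_cases h : j < m
  · rw [natCoord_of_lt e h, Module.Basis.coord_apply, Module.Basis.repr_self,
      Finsupp.single_apply]
    simp only [Fin.ext_iff, eq_comm]
  · rw [natCoord_of_le e (not_lt.1 h), LinearMap.zero_apply, if_neg]
    have := i.2
    omega

theorem ext_natCoord (e : Module.Basis (Fin m) ℂ E) {x y : E}
    (h : ∀ j < m, natCoord e j x = natCoord e j y) : x = y :=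
  e.ext_elem fun i => by simpa [natCoord_coe] using h i i.2

theorem exists_natCoord (e : Module.Basis (Fin m) ℂ E) (f : ℕ → ℂ) :
    ∃ x : E, ∀ j < m, natCoord e j x = f j :=
  ⟨e.equivFun.symm fun i => f i, fun j hj => by
    rw [natCoord_of_lt e hj, Module.Basis.coord_apply, ← Module.Basis.equivFun_apply,
      LinearEquiv.apply_symm_apply]⟩

/-- `N` is a nilpotent Jordan block (up to the nonzero factor `lam`) in the basis `e`:
`N e_j = lam e_{j+1}`. -/
structure IsBlock (e : Module.Basis (Fin m) ℂ E) (N : Module.End ℂ E) (lam : ℂ) : Prop where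
  ne_zero : lam ≠ 0
  coord_zero : ∀ x, natCoord e 0 (N x) = 0
  coord_succ : ∀ j x, j + 1 < m → natCoord e (j + 1) (N x) = lam * natCoord e j x

variable {e : Module.Basis (Fin m) ℂ E} {N : Module.End ℂ E} {lam : ℂ}

theorem IsBlock.coord_pow_lt (hN : IsBlock e N lam) (a : ℕ) :
    ∀ (j : ℕ) (x : E), j < a → natCoord e j ((N ^ a) x) = 0 := by
  induction a with
  | zero => intro j x h; omega
  | succ a ih =>
    intro j x h
    rw [pow_succ', Module.End.mul_apply]
    rcases j with _ | j
    · exact hN.coord_zero _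
    · by_cases hj : j + 1 < m
      · rw [hN.coord_succ _ _ hj, ih j x (by omega), mul_zero]
      · rw [natCoord_of_le e (by omega), LinearMap.zero_apply]

theorem IsBlock.coord_pow (hN : IsBlock e N lam) (a : ℕ) :
    ∀ (j : ℕ) (x : E), j + a < m → natCoord e (j + a) ((N ^ a) x) = lam ^ a * natCoord e j x := by
  induction a with
  | zero => intro j x h; simp
  | succ a ih =>
    intro j x h
    rw [pow_succ', Module.End.mul_apply, ← add_assoc, hN.coord_succ _ _ (by omega),
      ih j x (by omega), pow_succ', mul_assoc]

theorem IsBlock.mem_range (hN : IsBlock e N lam) {a : ℕ} {x : E} :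
    x ∈ LinearMap.range (N ^ a) ↔ ∀ j < a, natCoord e j x = 0 := by
  constructor
  · rintro ⟨y, rfl⟩ j hj
    exact hN.coord_pow_lt a j y hj
  · intro h
    -- The preimage moves the coordinates down by a places and divides by the factor produced by
    -- N^a.
    obtain ⟨y, hy⟩ := exists_natCoord e fun i => (lam ^ a)⁻¹ * natCoord e (i + a) x
    refine ⟨y, ext_natCoord e fun j hj => ?_⟩
    by_cases hja : j < a
    · rw [hN.coord_pow_lt a j y hja, h j hja]
    · obtain ⟨i, rfl⟩ := Nat.exists_eq_add_of_le' (not_lt.1 hja)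
      rw [hN.coord_pow a i y hj, hy i (by omega),
        mul_inv_cancel_left₀ (pow_ne_zero _ hN.ne_zero)]

theorem IsBlock.pow_eq_zero (hN : IsBlock e N lam) : N ^ m = 0 :=
  LinearMap.ext fun x => ext_natCoord e fun j hj => by
    rw [hN.coord_pow_lt m j x hj, LinearMap.zero_apply, map_zero]

/-- For a < m the vector e_a separates im N^a from the smaller images. The minimum with m appears
because all powers from the m-th on vanish. -/
theorem IsBlock.range_le_range (hN : IsBlock e N lam) {a b : ℕ} :
    LinearMap.range (N ^ a) ≤ LinearMap.range (N ^ b) ↔ min b m ≤ a := by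
  constructor
  · intro h
    by_contra! hab
    have h1 : e ⟨a, by omega⟩ ∈ LinearMap.range (N ^ a) := hN.mem_range.2 fun j hj => by
      rw [natCoord_basis, if_neg]
      simp only; omega
    have h2 := hN.mem_range.1 (h h1) a (by omega)
    rw [natCoord_basis, if_pos rfl] at h2
    exact one_ne_zero h2
  · intro h x hx
    refine hN.mem_range.2 fun j hj => ?_
    by_cases hjm : j < m
    · exact hN.mem_range.1 hx j (by omega)
    · rw [natCoord_of_le e (by omega), LinearMap.zero_apply]

/-- The bound on b matters: for b > m the image is still that of N^m, and its preimage is im N^(m-k)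
instead. -/
theorem IsBlock.comap_range (hN : IsBlock e N lam) {k b : ℕ} (hb : b ≤ m) :
    (LinearMap.range (N ^ b)).comap (N ^ k) = LinearMap.range (N ^ (b - k)) := by
  ext x
  rw [Submodule.mem_comap]
  constructor
  · intro h
    refine hN.mem_range.2 fun j hj => ?_
    have := hN.mem_range.1 h (j + k) (by omega)
    rw [hN.coord_pow k j x (by omega)] at this
    exact (mul_eq_zero.1 this).resolve_left (pow_ne_zero _ hN.ne_zero)
  · rintro ⟨y, rfl⟩
    rw [← Module.End.mul_apply, ← pow_add]
    exact hN.range_le_range.2 (by omega : min b m ≤ k + (b - k)) ⟨y, rfl⟩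

theorem map_range_pow (a k : ℕ) :
    (LinearMap.range (N ^ a)).map (N ^ k) = LinearMap.range (N ^ (a + k)) := by
  rw [← LinearMap.range_comp, add_comm, pow_add]
  rfl

theorem IsBlock.range_inf (hN : IsBlock e N lam) (a b : ℕ) :
    LinearMap.range (N ^ a) ⊓ LinearMap.range (N ^ b) = LinearMap.range (N ^ max a b) := by
  ext x
  simp only [Submodule.mem_inf, hN.mem_range, lt_max_iff]
  exact ⟨fun h j hj => hj.elim (h.1 j) (h.2 j), fun h => ⟨fun j hj => h j (Or.inl hj),
    fun j hj => h j (Or.inr hj)⟩⟩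

theorem IsBlock.range_sup (hN : IsBlock e N lam) (a b : ℕ) :
    LinearMap.range (N ^ a) ⊔ LinearMap.range (N ^ b) = LinearMap.range (N ^ min a b) := by
  apply le_antisymm
  · exact sup_le (hN.range_le_range.2 (by omega)) (hN.range_le_range.2 (by omega))
  · rcases le_total a b with h | h
    · rw [min_eq_left h]; exact le_sup_left
    · rw [min_eq_right h]; exact le_sup_right

/-- A single Jordan block is uniserial. Take the largest a ≤ m with U inside im N^a. If a < m, some
x in U has nonzero e_a-coordinate, and the vectors N^k x, with leading coordinate at a + k, generate
all of im N^a. -/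
theorem IsBlock.exists_eq_range (hN : IsBlock e N lam) {U : Submodule ℂ E} (hU : U.map N ≤ U) :
    ∃ a ≤ m, U = LinearMap.range (N ^ a) := by
  have hpow : ∀ (k : ℕ) (x : E), x ∈ U → (N ^ k) x ∈ U := by
    intro k
    induction k with
    | zero => intro x hx; simpa using hx
    | succ k ih =>
      intro x hx
      rw [pow_succ', Module.End.mul_apply]
      exact hU ⟨_, ih x hx, rfl⟩
  classical
  set a := Nat.findGreatest (fun a => U ≤ LinearMap.range (N ^ a)) m with ha
  have ham : a ≤ m := Nat.findGreatest_le m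
  have hUa : U ≤ LinearMap.range (N ^ a) :=
    Nat.findGreatest_spec (P := fun a => U ≤ LinearMap.range (N ^ a)) (Nat.zero_le m)
      (fun x _ => ⟨x, by simp⟩)
  refine ⟨a, ham, le_antisymm hUa ?_⟩
  rcases ham.eq_or_lt with h | hlt
  · rw [h, hN.pow_eq_zero, LinearMap.range_zero]; exact bot_le
  have hnot : ¬ U ≤ LinearMap.range (N ^ (a + 1)) :=
    Nat.findGreatest_is_greatest (P := fun a => U ≤ LinearMap.range (N ^ a)) (Nat.lt_succ_self a) hlt
  obtain ⟨x, hx, hxa⟩ := Set.not_subset.1 hnot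
  have hxa0 : natCoord e a x ≠ 0 := fun h0 => hxa <| hN.mem_range.2 fun j hj => by
    rcases (Nat.lt_succ_iff.1 hj).eq_or_lt with rfl | h
    · exact h0
    · exact hN.mem_range.1 (hUa hx) j h
  -- Descending induction on b from m, with d = m - b: subtracting a multiple of N^k x kills the
  -- leading coordinate at b = a + k.
  have key : ∀ d b : ℕ, a ≤ b → b + d = m → LinearMap.range (N ^ b) ≤ U := by
    intro d
    induction d with
    | zero =>
      intro b _ hb
      rw [show b = m from hb, hN.pow_eq_zero, LinearMap.range_zero]; exact bot_le
    | succ d ih =>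
      intro b hab hbm y hy
      obtain ⟨k, rfl⟩ := Nat.exists_eq_add_of_le hab
      set z := (N ^ k) x
      set c := natCoord e (a + k) y / (lam ^ k * natCoord e a x)
      have hz : y - c • z ∈ LinearMap.range (N ^ (a + k + 1)) := by
        refine hN.mem_range.2 fun j hj => ?_
        rw [map_sub, map_smul, smul_eq_mul]
        rcases (Nat.lt_succ_iff.1 hj).eq_or_lt with rfl | h
        · rw [hN.coord_pow k a x (by omega),
            div_mul_cancel₀ _ (mul_ne_zero (pow_ne_zero _ hN.ne_zero) hxa0), sub_self]
        · have hz' : z ∈ LinearMap.range (N ^ (a + k)) := by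
            rw [← map_range_pow]
            exact ⟨x, hUa hx, rfl⟩
          rw [hN.mem_range.1 hy j h, hN.mem_range.1 hz' j h, mul_zero, sub_zero]
      have := U.add_mem (ih _ (by omega) (by omega) hz) (U.smul_mem c (hpow k x hx))
      rwa [sub_add_cancel] at this
  exact key (m - a) a le_rfl (by omega)

end Block

/-! ### The Jacobson filtration of a single Jordan block -/

/-- The integer sequences satisfying the inequalities that express the defining properties of
the Jacobson filtration for a single Jordan block of size `m`. -/
theorem jacobson_exponent {m : ℕ} (hm : 0 < m) {α : ℤ → ℤ} (h0 : ∀ k, 0 ≤ α k)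
    (hle : ∀ k, α k ≤ m) (hanti : Antitone α) (htop : ∃ k, α k = 0) (hbot : ∃ k, α k = m)
    (hC : ∀ k, α (k - 2) ≤ α k + 1)
    (hA : ∀ k : ℕ, α (k - 1) ≤ max (α k) (α (-(k : ℤ) - 1) - k))
    (hB : ∀ k : ℕ, min (α k + k) (α (-(k : ℤ) - 1)) ≤ α (-(k : ℤ))) (k : ℤ) :
    α k = max 0 (min (m : ℤ) ((m : ℤ) - 1 - (k + (m - 1)) / 2)) := by
  obtain ⟨kb, hkb⟩ := hbot
  obtain ⟨K, hK0, hKmin⟩ : ∃ K : ℤ, α K = 0 ∧ ∀ z, α z = 0 → K ≤ z := by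
    refine Int.exists_least_of_bdd ⟨kb, fun z hz => ?_⟩ htop
    by_contra! h
    have := hanti h.le
    omega
  have hCi : ∀ (i : ℕ) (k : ℤ), α (k - 2 * i) ≤ α k + i := by
    intro i
    induction i with
    | zero => intro k; simp
    | succ i ih =>
      intro k
      have h1 := ih (k - 2)
      have h2 := hC k
      rw [show k - 2 - 2 * (i : ℤ) = k - 2 * ((i + 1 : ℕ) : ℤ) by push_cast; ring] at h1
      push_cast at h1 ⊢
      omega
  have hK1 : α (K - 1) ≠ 0 := fun h => by have := hKmin _ h; omega
  -- If K < 0, then the surjectivity inequality at -K bounds min(-K, α(K-1)) by α(K) = 0, although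
  -- both terms are positive.
  have hKpos : 0 ≤ K := by
    by_contra! hneg
    have hB' := hB (-K).toNat
    have e1 : (((-K).toNat : ℕ) : ℤ) = -K := Int.toNat_of_nonneg (by omega)
    rw [e1, neg_neg] at hB'
    have h3 := hanti (show K ≤ -K by omega)
    have h4 := h0 (-K)
    have h5 := h0 (K - 1)
    omega
  obtain ⟨κ, rfl⟩ := Int.eq_ofNat_of_zero_le hKpos
  -- Just below the first zero κ, the steps of hC force α(κ-1) = 1. Injectivity at κ and κ steps
  -- down then squeeze α(-κ-1) to κ + 1.
  have hA' := hA κ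
  have h1 := hCi κ ((κ : ℤ) - 1)
  rw [show (κ : ℤ) - 1 - 2 * κ = -κ - 1 by ring] at h1
  have h2 : α ((κ : ℤ) - 1) ≤ α ((κ : ℤ) - 2) := hanti (by omega)
  have h3 := hC κ
  have h4 := h0 ((κ : ℤ) - 1)
  have hK1' : α ((κ : ℤ) - 1) = 1 := by omega
  have hneg : α (-(κ : ℤ) - 1) = κ + 1 := by omega
  -- Further down α cannot exceed κ + 1, by surjectivity. At the first step the other term of the
  -- minimum is also κ + 1 and gives nothing; there the bound comes from κ + 1 steps down from κ.
  have hlow : ∀ j : ℕ, α (-(κ : ℤ) - 1 - j) ≤ κ + 1 := by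
    intro j
    induction j with
    | zero => simpa using hneg.le
    | succ j ih =>
      rcases Nat.eq_zero_or_pos j with rfl | hj
      · have := hCi (κ + 1) κ
        rw [show (κ : ℤ) - 2 * ((κ + 1 : ℕ) : ℤ) = -κ - 1 - ((0 + 1 : ℕ) : ℤ) by push_cast; ring]
          at this
        push_cast at this ⊢
        omega
      · have := hB (κ + 1 + j)
        have h5 := h0 ((κ + 1 + j : ℕ) : ℤ)
        rw [show -((κ + 1 + j : ℕ) : ℤ) - 1 = -κ - 1 - ((j + 1 : ℕ) : ℤ) by push_cast; ring,
          show -((κ + 1 + j : ℕ) : ℤ) = -κ - 1 - (j : ℤ) by push_cast; ring] at this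
        push_cast at this h5 ⊢
        omega
  -- The sequence attains m somewhere and is bounded by κ + 1, so the bound is m.
  have hKm : (κ : ℤ) + 1 = m := by
    refine le_antisymm (hneg ▸ hle _) ?_
    by_contra! h
    rcases le_or_gt kb (-(κ : ℤ) - 1) with h6 | h6
    · have := hlow (-(κ : ℤ) - 1 - kb).toNat
      rw [Int.toNat_of_nonneg (by omega), show -(κ : ℤ) - 1 - (-κ - 1 - kb) = kb by ring] at this
      omega
    · have := hanti h6.le
      omega
  have hm1 : α (-(m : ℤ)) = m := by rw [show -(m : ℤ) = -κ - 1 by omega]; omega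
  have hm2 : α ((m : ℤ) - 1) = 0 := by rw [show (m : ℤ) - 1 = κ by omega]; omega
  have hm3 : α ((m : ℤ) - 2) = 1 := by rw [show (m : ℤ) - 2 = κ - 1 by omega]; omega
  rcases le_or_gt ((m : ℤ) - 1) k with hk | hk
  · have := hanti hk
    have := h0 k
    omega
  rcases le_or_gt k (-(m : ℤ)) with hk' | hk'
  · have := hanti hk'
    have := hle k
    omega
  obtain ⟨j, hj⟩ : ∃ j : ℕ, k = m - 1 - 2 * j ∨ k = m - 2 - 2 * j := by
    refine ⟨(((m : ℤ) - 1 - k) / 2).toNat, ?_⟩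
    rw [Int.toNat_of_nonneg (by omega)]
    omega
  -- Between -m and m - 1 the values are pinched: steps down from the top bound α above, and the
  -- same steps read upwards from α(-m) = m bound it below.
  have hlower : ∀ i : ℕ, (m : ℤ) - i ≤ α (-m + 2 * i) := fun i => by
    have := hCi i (-m + 2 * i)
    rw [add_sub_cancel_right, hm1] at this
    omega
  rcases hj with rfl | rfl
  · have h6 := hCi j ((m : ℤ) - 1)
    rcases Nat.eq_zero_or_pos j with rfl | hj
    · push_cast at h6 ⊢
      have := h0 ((m : ℤ) - 1 - 2 * 0)
      omega
    · have h7 := hlower (m - j)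
      rw [Nat.cast_sub (by omega)] at h7
      have h8 := hanti (show (m : ℤ) - 1 - 2 * j ≤ -m + 2 * (m - j) by omega)
      omega
  · have h6 := hCi j ((m : ℤ) - 2)
    have h7 := hlower (m - 1 - j)
    rw [show ((m - 1 - j : ℕ) : ℤ) = m - 1 - j by omega,
      show -(m : ℤ) + 2 * (m - 1 - j) = m - 2 - 2 * j by ring] at h7
    omega

section Block

variable {E : Type*} [AddCommGroup E] [Module ℂ E] {m : ℕ}
  {e : Module.Basis (Fin m) ℂ E} {N : Module.End ℂ E} {lam : ℂ}

theorem IsBlock.range_inj (hN : IsBlock e N lam) {a b : ℕ}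
    (h : min a m = min b m) : LinearMap.range (N ^ a) = LinearMap.range (N ^ b) :=
  le_antisymm (hN.range_le_range.2 (by omega)) (hN.range_le_range.2 (by omega))

theorem IsBlock.range_eq_bot (hN : IsBlock e N lam) {a : ℕ} (h : m ≤ a) :
    LinearMap.range (N ^ a) = ⊥ := by
  rw [hN.range_inj (b := m) (by omega), hN.pow_eq_zero, LinearMap.range_zero]

theorem range_pow_zero : LinearMap.range (N ^ 0) = ⊤ := by
  rw [pow_zero]; exact LinearMap.range_id

theorem map_range_pow_one (a : ℕ) :
    (LinearMap.range (N ^ a)).map N = LinearMap.range (N ^ (a + 1)) := by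
  rw [← map_range_pow, pow_one]

/-- The Jacobson axioms make every step N-invariant, hence an image of a power of N. In terms of the
exponents they become the inequalities of `jacobson_exponent`. The converse is a check with the
explicit exponents. -/
theorem IsBlock.isJacobson_iff (hN : IsBlock e N lam) (hm : 0 < m) (W : ℤ → Submodule ℂ E) :
    IsJacobson N (fun k => W (k + (m - 1))) ↔
      W = fun k => LinearMap.range (N ^ ((m : ℤ) - 1 - k / 2).toNat) := by
  constructor
  · intro hJ
    have hinv : ∀ k : ℤ, ∃ a ≤ m, W (k + (m - 1)) = LinearMap.range (N ^ a) := fun k =>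
      hN.exists_eq_range ((hJ.map_le k).trans (hJ.mono (by omega)))
    choose a ham ha using hinv
    have hform := jacobson_exponent hm (α := fun k => (a k : ℤ)) (fun k => by positivity)
      (fun k => by exact_mod_cast ham k) (fun k l hkl => by
        have := hJ.mono hkl
        simp only [ha, hN.range_le_range] at this
        have := ham l
        change (a l : ℤ) ≤ a k
        omega)
      (by
        obtain ⟨k, hk⟩ := hJ.exists_top
        refine ⟨k, ?_⟩
        rw [ha, ← range_pow_zero (N := N)] at hk
        have := hN.range_le_range.1 hk.ge
        have := ham k
        omega)
      (by
        obtain ⟨k, hk⟩ := hJ.exists_bot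
        refine ⟨k, ?_⟩
        rw [ha, ← hN.range_eq_bot le_rfl] at hk
        have := hN.range_le_range.1 hk.le
        have := ham k
        omega)
      (fun k => by
        have := hJ.map_le k
        simp only [ha] at this
        rw [map_range_pow_one, hN.range_le_range] at this
        have := ham (k - 2)
        omega)
      (fun k => by
        have := hJ.inj k
        simp only [ha] at this
        rw [hN.comap_range (ham _), hN.range_inf, hN.range_le_range] at this
        have := ham ((k : ℤ) - 1)
        omega)
      (fun k => by
        have := hJ.surj k
        simp only [ha] at this
        rw [map_range_pow, hN.range_sup, hN.range_le_range] at this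
        have := ham (-(k : ℤ) - 1)
        omega)
    funext k
    have h1 := ha (k - (m - 1))
    have h2 := hform (k - (m - 1))
    rw [sub_add_cancel] at h1 h2
    rw [h1]
    refine hN.range_inj ?_
    omega
  · rintro rfl
    refine ⟨fun k l hkl => hN.range_le_range.2 ?_, ⟨-(m : ℤ) - 1, hN.range_eq_bot ?_⟩, ⟨m, ?_⟩,
      fun k => ?_, fun k => ?_, fun k => ?_⟩
    · have : (k + ((m : ℤ) - 1)) / 2 ≤ (l + ((m : ℤ) - 1)) / 2 :=
        Int.ediv_le_ediv (by norm_num) (by omega)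
      omega
    · omega
    · rw [← range_pow_zero (N := N)]
      exact hN.range_inj (by omega)
    · simp only
      rw [map_range_pow_one]
      exact hN.range_le_range.2 (by omega)
    · simp only
      rcases le_or_gt m k with h | h
      · rw [show (m : ℤ) - 1 - ((k : ℤ) - 1 + (m - 1)) / 2 = (m : ℤ) - 1 - ((k : ℤ) + m - 2) / 2 by
          congr 2; ring]
        exact le_top.trans ((range_pow_zero (N := N)).ge.trans (hN.range_le_range.2 (by omega)))
      · rw [hN.comap_range (by omega)]
        exact inf_le_right.trans (hN.range_le_range.2 (by omega))
    · simp only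
      rw [map_range_pow]
      exact le_sup_of_le_left (hN.range_le_range.2 (by omega))

/-! ### The mixed Hodge structure -/

/-- The weight filtration of a single Jordan block. -/
def blockW (m : ℕ) (N : Module.End ℂ E) (k : ℤ) : Submodule ℂ E :=
  LinearMap.range (N ^ ((m : ℤ) - 1 - k / 2).toNat)

/-- The filtration by the spans of the first vectors of a basis. -/
def basisFil (e : Module.Basis (Fin m) ℂ E) (k : ℤ) : Submodule ℂ E :=
  Submodule.span ℂ {x | ∃ j : Fin m, (j : ℤ) ≤ m - 1 - k ∧ x = e j}

theorem mem_basisFil {k : ℤ} {x : E} :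
    x ∈ basisFil e k ↔ ∀ j : ℕ, (m : ℤ) - 1 - k < j → natCoord e j x = 0 := by
  constructor
  · intro h j hj
    have : basisFil e k ≤ LinearMap.ker (natCoord e j) := Submodule.span_le.2 (by
      rintro _ ⟨i, hi, rfl⟩
      rw [SetLike.mem_coe, LinearMap.mem_ker, natCoord_basis, if_neg]
      omega)
    exact this h
  · intro h
    rw [← e.sum_repr x]
    refine Submodule.sum_mem _ fun i _ => ?_
    by_cases hi : (i : ℤ) ≤ m - 1 - k
    · exact Submodule.smul_mem _ _ (Submodule.subset_span ⟨i, hi, rfl⟩)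
    · have := h i (by omega)
      rw [natCoord_coe, Module.Basis.coord_apply] at this
      rw [this, zero_smul]
      exact Submodule.zero_mem _

theorem basisFil_antitone (e : Module.Basis (Fin m) ℂ E) : Antitone (basisFil e) :=
  fun k l hkl => Submodule.span_mono (by rintro _ ⟨j, hj, rfl⟩; exact ⟨j, by omega, rfl⟩)

theorem IsBlock.blockW_mono (hN : IsBlock e N lam) : Monotone (blockW m N) :=
  fun k l hkl => hN.range_le_range.2 (by
    have : k / 2 ≤ l / 2 := Int.ediv_le_ediv (by norm_num) hkl
    omega)

/-- The exponent depends on n only through ⌊n/2⌋, and its effect is constant once it leaves the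
range 0, …, m. -/
theorem IsBlock.subsingleton_gr (hN : IsBlock e N lam) {n : ℤ}
    (hn : ¬ ∃ k : ℕ, k < m ∧ n = 2 * k) : Subsingleton (grW (blockW m N) n) := by
  rw [Submodule.Quotient.subsingleton_iff, Submodule.submoduleOf_eq_top]
  refine hN.range_le_range.2 ?_
  by_contra! h
  exact hn ⟨(n / 2).toNat, by omega, by omega⟩

theorem mem_inducedGr_top {W : ℤ → Submodule ℂ E} {n : ℤ} {F : Submodule ℂ E} {x : E}
    (hxF : x ∈ F) (hx : x ∈ W n) : Submodule.Quotient.mk ⟨x, hx⟩ ∈ inducedGr W n F :=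
  ⟨⟨x, hx⟩, hxF, rfl⟩

/-- The even graded pieces of the weight filtration are lines, spanned by the class of any vector
of `W_{2k}` that is not in `W_{2k-1}`. -/
theorem IsBlock.inducedGr_eq_top (hN : IsBlock e N lam) {k : ℕ} (hk : k < m) {F : Submodule ℂ E}
    {x : E} (hxF : x ∈ F) (hx : x ∈ blockW m N (2 * k)) (hx' : x ∉ blockW m N (2 * k - 1)) :
    inducedGr (blockW m N) (2 * k) F = ⊤ := by
  have e1 : ((m : ℤ) - 1 - 2 * (k : ℤ) / 2).toNat = m - 1 - k := by omega
  have e2 : ((m : ℤ) - 1 - (2 * (k : ℤ) - 1) / 2).toNat = m - 1 - k + 1 := by omega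
  have hx0 : natCoord e (m - 1 - k) x ≠ 0 := fun h0 => hx' <| by
    unfold blockW at hx ⊢
    rw [e1] at hx
    rw [e2]
    refine hN.mem_range.2 fun j hj => ?_
    rcases (Nat.lt_succ_iff.1 hj).eq_or_lt with rfl | h
    · exact h0
    · exact hN.mem_range.1 hx j h
  rw [eq_top_iff]
  rintro y -
  obtain ⟨⟨y, hy⟩, rfl⟩ := Submodule.Quotient.mk_surjective _ y
  set c := natCoord e (m - 1 - k) y / natCoord e (m - 1 - k) x
  have : (Submodule.Quotient.mk ⟨y, hy⟩ : grW (blockW m N) (2 * k)) =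
      Submodule.Quotient.mk ⟨c • x, Submodule.smul_mem _ c hx⟩ := by
    rw [Submodule.Quotient.eq]
    change y - c • x ∈ blockW m N (2 * k - 1)
    unfold blockW at hx hy ⊢
    rw [e1] at hx hy
    rw [e2]
    refine hN.mem_range.2 fun j hj => ?_
    rw [map_sub, map_smul, smul_eq_mul]
    rcases (Nat.lt_succ_iff.1 hj).eq_or_lt with rfl | h
    · rw [div_mul_cancel₀ _ hx0, sub_self]
    · rw [hN.mem_range.1 hx j h, hN.mem_range.1 hy j h, mul_zero, sub_zero]
  rw [this]
  exact mem_inducedGr_top (F.smul_mem c hxF) _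

theorem inducedGr_eq_bot {W : ℤ → Submodule ℂ E} {n : ℤ} {F : Submodule ℂ E}
    (h : F ⊓ W n ≤ ⊥) : inducedGr W n F = ⊥ := by
  rw [eq_bot_iff]
  rintro _ ⟨⟨x, hx⟩, hxF, rfl⟩
  have : x = 0 := h ⟨hxF, hx⟩
  subst this
  exact map_zero _

/-- F^p is spanned by the e_j with j ≤ m-1-p and W_{2k} by those with j ≥ m-1-k; for p > k no index
is common. -/
theorem IsBlock.basisFil_inf_blockW (hN : IsBlock e N lam) {k : ℕ} {p : ℤ} (hp : ¬ p ≤ k) :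
    basisFil e p ⊓ blockW m N (2 * k) ≤ ⊥ := by
  rintro x ⟨hx, hx'⟩
  refine ext_natCoord e fun j hj => ?_
  rw [map_zero]
  rcases lt_or_ge ((m : ℤ) - 1 - p) j with h | h
  · exact mem_basisFil.1 hx j h
  · exact hN.mem_range.1 hx' j (by omega)

theorem IsBlock.basis_mem (hN : IsBlock e N lam) {k : ℕ} (hk : k < m) :
    e ⟨m - 1 - k, by omega⟩ ∈ blockW m N (2 * k) ∧
      e ⟨m - 1 - k, by omega⟩ ∉ blockW m N (2 * k - 1) := by
  constructor
  · refine hN.mem_range.2 fun j hj => ?_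
    rw [natCoord_basis, if_neg]
    simp only
    omega
  · intro h
    have := hN.mem_range.1 h (m - 1 - k) (by omega)
    rw [natCoord_basis, if_pos rfl] at this
    exact one_ne_zero this

theorem IsBlock.inducedGr_basisFil (hN : IsBlock e N lam) {k : ℕ} (hk : k < m) (p : ℤ) :
    inducedGr (blockW m N) (2 * k) (basisFil e p) = if p ≤ k then ⊤ else ⊥ := by
  split_ifs with hp
  · exact hN.inducedGr_eq_top hk (Submodule.subset_span ⟨⟨m - 1 - k, by omega⟩, by
      simp only; omega, rfl⟩) (hN.basis_mem hk).1 (hN.basis_mem hk).2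
  · exact inducedGr_eq_bot (hN.basisFil_inf_blockW hp)

/-- No compatibility of the conjugation with the basis is needed. It preserves membership in each
step of W, so the conjugate of e_{m-1-k} still spans the line gr_{2k}, and a trivial intersection
stays trivial. -/
theorem IsBlock.inducedGr_conj (hN : IsBlock e N lam) {conj : E →ₛₗ[starRingEnd ℂ] E}
    (hcc : ∀ x, conj (conj x) = x) (hW : ∀ n, (blockW m N n).map conj = blockW m N n)
    {k : ℕ} (hk : k < m) (p : ℤ) :
    inducedGr (blockW m N) (2 * k) ((basisFil e p).map conj) = if p ≤ k then ⊤ else ⊥ := by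
  have hmem : ∀ n x, conj x ∈ blockW m N n ↔ x ∈ blockW m N n := fun n x =>
    ⟨fun h => by rw [← hW n]; exact ⟨_, h, hcc x⟩, fun h => by rw [← hW n]; exact ⟨x, h, rfl⟩⟩
  split_ifs with hp
  · refine hN.inducedGr_eq_top hk (x := conj (e ⟨m - 1 - k, by omega⟩))
      ⟨_, Submodule.subset_span ⟨⟨m - 1 - k, by omega⟩, by simp only; omega, rfl⟩, rfl⟩
      ((hmem _ _).2 (hN.basis_mem hk).1) fun h => (hN.basis_mem hk).2 ((hmem _ _).1 h)
  · refine inducedGr_eq_bot ?_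
    rintro _ ⟨⟨x, hx, rfl⟩, hx'⟩
    have : x = 0 := hN.basisFil_inf_blockW hp ⟨hx, (hmem _ _).1 hx'⟩
    rw [this, map_zero]
    exact Submodule.zero_mem _

/-- On the line gr_{2k} both filtrations jump at k, and exactly one of p ≤ k and 2k + 1 - p ≤ k
holds, so one of the two subspaces is everything and the other is zero. -/
theorem IsBlock.isMixedHodge (hN : IsBlock e N lam) {conj : E →ₛₗ[starRingEnd ℂ] E}
    (hcc : ∀ x, conj (conj x) = x) (hW : ∀ n, (blockW m N n).map conj = blockW m N n) :
    IsMixedHodge conj (blockW m N) (basisFil e) where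
  conj_conj := hcc
  W_real := hW
  W_mono := hN.blockW_mono
  W_bot := ⟨-2, hN.range_eq_bot (by omega)⟩
  W_top := ⟨2 * m, by
    rw [eq_top_iff, ← range_pow_zero (N := N)]
    exact hN.range_le_range.2 (by omega)⟩
  F_anti := basisFil_antitone e
  F_bot := ⟨m, by
    rw [eq_bot_iff]
    intro x hx
    refine ext_natCoord e fun j _ => ?_
    rw [mem_basisFil.1 hx j (by omega), map_zero]⟩
  F_top := ⟨0, by
    rw [eq_top_iff]
    rintro x -
    refine mem_basisFil.2 fun j hj => ?_
    rw [natCoord_of_le e (by omega), LinearMap.zero_apply]⟩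
  opposed n p := by
    by_cases hn : ∃ k : ℕ, k < m ∧ n = 2 * k
    · obtain ⟨k, hk, rfl⟩ := hn
      rw [hN.inducedGr_basisFil hk, hN.inducedGr_conj hcc hW hk]
      by_cases hp : p ≤ k
      · rw [if_pos hp, if_neg (by omega)]
        exact isCompl_top_bot
      · rw [if_neg hp, if_pos (by omega)]
        exact isCompl_bot_top
    · have := hN.subsingleton_gr hn
      rw [Subsingleton.elim (inducedGr (blockW m N) n (basisFil e p)) ⊤,
        Subsingleton.elim (inducedGr (blockW m N) n ((basisFil e (n + 1 - p)).map conj)) ⊥]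
      exact isCompl_top_bot

/-- Coordinatewise conjugation in e works, since each step of W is cut out by the vanishing of
coordinates. -/
theorem IsBlock.exists_conj (hN : IsBlock e N lam) :
    ∃ conj : E →ₛₗ[starRingEnd ℂ] E, (∀ x, conj (conj x) = x) ∧
      ∀ n, (blockW m N n).map conj = blockW m N n := by
  let conj : E →ₛₗ[starRingEnd ℂ] E :=
    { toFun := fun x => e.equivFun.symm fun i => starRingEnd ℂ (e.equivFun x i)
      map_add' := fun x y => by
        rw [← map_add]
        congr 1
        funext i
        simp
      map_smul' := fun c x => by
        rw [← map_smul]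
        congr 1
        funext i
        simp }
  have hcoord : ∀ j x, natCoord e j (conj x) = starRingEnd ℂ (natCoord e j x) := fun j x => by
    by_cases hj : j < m
    · rw [natCoord_of_lt e hj, Module.Basis.coord_apply, ← Module.Basis.equivFun_apply,
        Module.Basis.coord_apply, ← Module.Basis.equivFun_apply]
      exact congrFun (e.equivFun.apply_symm_apply _) _
    · simp [natCoord_of_le e (not_lt.1 hj)]
  have hcc : ∀ x, conj (conj x) = x := fun x => ext_natCoord e fun j _ => by
    rw [hcoord, hcoord, Complex.conj_conj]
  have hmem : ∀ n x, x ∈ blockW m N n → conj x ∈ blockW m N n := fun n x hx =>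
    hN.mem_range.2 fun j hj => by rw [hcoord, hN.mem_range.1 hx j hj, map_zero]
  refine ⟨conj, hcc, fun n => le_antisymm ?_ fun x hx => ⟨conj x, hmem n x hx, hcc x⟩⟩
  rintro _ ⟨x, hx, rfl⟩
  exact hmem n x hx

theorem IsBlock.grIsTate (hN : IsBlock e N lam) : GrIsTate m (blockW m N) (basisFil e) := by
  refine ⟨fun k hk => ?_, fun n hn => hN.subsingleton_gr hn⟩
  set x : grW (blockW m N) (2 * k) := Submodule.Quotient.mk ⟨_, (hN.basis_mem hk).1⟩ with hx
  have hx0 : x ≠ 0 := fun h =>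
    (hN.basis_mem hk).2 ((Submodule.Quotient.mk_eq_zero ((blockW m N (2 * k - 1)).submoduleOf _)).1 h)
  have htop : ∀ y : grW (blockW m N) (2 * k), ∃ c : ℂ, c • x = y := fun y => by
    have h1 := hN.inducedGr_eq_top hk (F := Submodule.span ℂ {e ⟨m - 1 - k, by omega⟩})
      (Submodule.mem_span_singleton_self _) (hN.basis_mem hk).1 (hN.basis_mem hk).2
    have h2 : y ∈ inducedGr (blockW m N) (2 * k) (Submodule.span ℂ {e ⟨m - 1 - k, by omega⟩}) :=
      h1 ▸ Submodule.mem_top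
    obtain ⟨⟨z, hz⟩, hz', rfl⟩ := h2
    obtain ⟨c, hc⟩ := Submodule.mem_span_singleton.1 (show z ∈ _ from hz')
    exact ⟨c, by subst hc; rfl⟩
  let f : ℂ ≃ₗ[ℂ] grW (blockW m N) (2 * k) :=
    LinearEquiv.ofBijective (LinearMap.toSpanSingleton ℂ _ x)
      ⟨fun a b hab => smul_left_injective ℂ hx0 hab, htop⟩
  refine ⟨f.symm, fun p => ?_⟩
  rw [hN.inducedGr_basisFil hk, tateF]
  split_ifs
  · rw [Submodule.map_top, LinearEquiv.range]
  · exact Submodule.map_bot _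

end Block

/-! ### Convergent power series -/

section PowerSeriesSum

open PowerSeries

/-- The power series `f` converges absolutely on the disc of radius `ε`. -/
def ConvS (ε : ℝ) (f : PowerSeries ℂ) : Prop :=
  ∀ ρ : ℝ, 0 ≤ ρ → ρ < ε → Summable fun n => ‖coeff n f‖ * ρ ^ n

/-- The sum of a power series at `t`. -/
def psv (f : PowerSeries ℂ) (t : ℂ) : ℂ := ∑' n, coeff n f * t ^ n

variable {ε : ℝ} {f g : PowerSeries ℂ} {t : ℂ}

theorem ConvS.summable_norm (hf : ConvS ε f) (ht : ‖t‖ < ε) :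
    Summable fun n => ‖coeff n f * t ^ n‖ := by
  simpa only [norm_mul, norm_pow] using hf ‖t‖ (norm_nonneg t) ht

theorem ConvS.summable (hf : ConvS ε f) (ht : ‖t‖ < ε) : Summable fun n => coeff n f * t ^ n :=
  (hf.summable_norm ht).of_norm

theorem convS_coe (p : Polynomial ℂ) : ConvS ε (p : PowerSeries ℂ) := fun ρ _ _ =>
  summable_of_ne_finset_zero (s := p.support) fun n hn => by
    rw [Polynomial.coeff_coe, Polynomial.notMem_support_iff.1 hn, norm_zero, zero_mul]

theorem psv_coe (p : Polynomial ℂ) (t : ℂ) : psv (p : PowerSeries ℂ) t = p.eval t := by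
  unfold psv
  rw [Polynomial.eval_eq_sum, Polynomial.sum, tsum_eq_sum (s := p.support)]
  · simp only [Polynomial.coeff_coe]
  · intro n hn
    rw [Polynomial.coeff_coe, Polynomial.notMem_support_iff.1 hn, zero_mul]

theorem ConvS.add (hf : ConvS ε f) (hg : ConvS ε g) : ConvS ε (f + g) := fun ρ h0 h1 =>
  Summable.of_nonneg_of_le (fun n => by positivity) (fun n => by
    rw [map_add, ← add_mul]
    gcongr
    exact norm_add_le _ _) ((hf ρ h0 h1).add (hg ρ h0 h1))

theorem psv_add (hf : ConvS ε f) (hg : ConvS ε g) (ht : ‖t‖ < ε) :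
    psv (f + g) t = psv f t + psv g t := by
  unfold psv
  rw [← (hf.summable ht).tsum_add (hg.summable ht)]
  exact tsum_congr fun n => by rw [map_add, add_mul]

theorem convS_zero : ConvS ε 0 := by simpa using convS_coe (ε := ε) (0 : Polynomial ℂ)

theorem psv_zero (t : ℂ) : psv 0 t = 0 := by simpa using psv_coe (0 : Polynomial ℂ) t

theorem convS_sum {ι : Type*} (s : Finset ι) {f : ι → PowerSeries ℂ}
    (hf : ∀ i ∈ s, ConvS ε (f i)) : ConvS ε (∑ i ∈ s, f i) :=
  Finset.sum_induction _ _ (fun _ _ => ConvS.add) convS_zero hf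

theorem psv_sum {ι : Type*} (s : Finset ι) {f : ι → PowerSeries ℂ}
    (hf : ∀ i ∈ s, ConvS ε (f i)) (ht : ‖t‖ < ε) : psv (∑ i ∈ s, f i) t = ∑ i ∈ s, psv (f i) t := by
  classical
  induction s using Finset.induction_on with
  | empty => simp [psv_zero]
  | insert i s hi ih =>
    rw [Finset.sum_insert hi, Finset.sum_insert hi,
      psv_add (hf i (Finset.mem_insert_self i s))
        (convS_sum s fun j hj => hf j (Finset.mem_insert_of_mem hj)) ht,
      ih fun j hj => hf j (Finset.mem_insert_of_mem hj)]

theorem ConvS.mul (hf : ConvS ε f) (hg : ConvS ε g) : ConvS ε (f * g) := fun ρ h0 h1 => by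
  have hρ : ‖(ρ : ℂ)‖ < ε := by rwa [Complex.norm_real, Real.norm_of_nonneg h0]
  have := summable_norm_sum_mul_antidiagonal_of_summable_norm (hf.summable_norm hρ)
    (hg.summable_norm hρ)
  refine this.congr fun n => ?_
  rw [coeff_mul]
  have h2 : ∑ kl ∈ Finset.HasAntidiagonal.antidiagonal n, coeff kl.1 f * (ρ : ℂ) ^ kl.1 * (coeff kl.2 g * (ρ : ℂ) ^ kl.2)
      = (∑ kl ∈ Finset.HasAntidiagonal.antidiagonal n, coeff kl.1 f * coeff kl.2 g) * (ρ : ℂ) ^ n := by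
    rw [Finset.sum_mul]
    refine Finset.sum_congr rfl fun kl hkl => ?_
    rw [← Finset.HasAntidiagonal.mem_antidiagonal.1 hkl, pow_add]
    ring
  rw [h2, norm_mul, norm_pow, Complex.norm_real, Real.norm_of_nonneg h0]

theorem psv_mul (hf : ConvS ε f) (hg : ConvS ε g) (ht : ‖t‖ < ε) :
    psv (f * g) t = psv f t * psv g t := by
  unfold psv
  rw [tsum_mul_tsum_eq_tsum_sum_antidiagonal_of_summable_norm (hf.summable_norm ht)
    (hg.summable_norm ht)]
  refine tsum_congr fun n => ?_
  rw [coeff_mul, Finset.sum_mul]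
  refine Finset.sum_congr rfl fun kl hkl => ?_
  rw [← Finset.HasAntidiagonal.mem_antidiagonal.1 hkl, pow_add]
  ring

theorem convS_inv_X_sub_C {a : ℂ} (ha : ε ≤ ‖a‖) (h0 : a ≠ 0) : ConvS ε (X - C a)⁻¹ := by
  have : (X - C a : PowerSeries ℂ)⁻¹ = PowerSeries.mk fun n => -(a ^ (n + 1))⁻¹ := by
    rw [PowerSeries.inv_eq_iff_mul_eq_one (by simpa using h0)]
    ext n
    rcases n with _ | n
    · simp [mul_sub, h0]
    · rw [mul_sub, map_sub, coeff_succ_mul_X, mul_comm _ (C a), coeff_C_mul, coeff_mk, coeff_mk,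
        coeff_one, if_neg (Nat.succ_ne_zero n)]
      field_simp
      ring
  rw [this]
  intro ρ hρ hρ'
  have hpos : 0 < ‖a‖ := norm_pos_iff.2 h0
  have : ∀ n, ‖coeff n (PowerSeries.mk fun n => -(a ^ (n + 1))⁻¹)‖ * ρ ^ n =
      ‖a‖⁻¹ * (ρ / ‖a‖) ^ n := fun n => by
    rw [coeff_mk, norm_neg, norm_inv, norm_pow, div_pow, pow_succ]
    field_simp
  simp only [this]
  exact (summable_geometric_of_lt_one (by positivity)
    ((div_lt_one hpos).2 (hρ'.trans_le ha))).mul_left _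

/-- Over ℂ the polynomial splits with all roots of norm at least ε. Each factor (X - a)⁻¹ is a
geometric series, and convergence passes to products. -/
theorem convS_inv_coe (p : Polynomial ℂ) (hε : 0 < ε) (hp : ∀ t : ℂ, ‖t‖ < ε → p.eval t ≠ 0) :
    ConvS ε (p : PowerSeries ℂ)⁻¹ := by
  have hp0 : p ≠ 0 := by
    rintro rfl
    exact hp 0 (by simpa using hε) (by simp)
  have key : ∀ s : Multiset ℂ, (∀ a ∈ s, ε ≤ ‖a‖) →
      ConvS ε ((s.map fun a => (X - C a : PowerSeries ℂ)).prod)⁻¹ := by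
    intro s
    induction s using Multiset.induction_on with
    | empty => intro _; simpa using convS_coe (1 : Polynomial ℂ)
    | cons a s ih =>
      intro h
      rw [Multiset.map_cons, Multiset.prod_cons, PowerSeries.mul_inv_rev]
      refine (ih fun b hb => h b (Multiset.mem_cons_of_mem hb)).mul (convS_inv_X_sub_C (h a (by simp)) ?_)
      rintro rfl
      have := h 0 (by simp)
      rw [norm_zero] at this
      linarith
  have hs := (IsAlgClosed.splits p).eq_prod_roots
  have : (p : PowerSeries ℂ) = C p.leadingCoeff *
      (p.roots.map fun a => (X - C a : PowerSeries ℂ)).prod := by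
    conv_lhs => rw [hs]
    rw [Polynomial.coe_mul, Polynomial.coe_C]
    congr 1
    rw [← Polynomial.coeToPowerSeries.ringHom_apply, map_multiset_prod, Multiset.map_map]
    congr 2
    funext a
    simp
  rw [this, PowerSeries.mul_inv_rev, PowerSeries.C_inv]
  refine (key _ fun a ha => ?_).mul (by simpa using convS_coe (Polynomial.C p.leadingCoeff⁻¹))
  by_contra! h
  exact hp a h ((Polynomial.mem_roots hp0).1 ha)

/-- The derivation `t d/dt` of power series. -/
def tDer (f : PowerSeries ℂ) : PowerSeries ℂ := PowerSeries.mk fun n => (n : ℂ) * coeff n f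

theorem exists_nat_mul_pow_le {ρ r : ℝ} (h0 : 0 ≤ ρ) (h : ρ < r) :
    ∃ B : ℝ, ∀ n : ℕ, (n : ℝ) * ρ ^ n ≤ B * r ^ n := by
  have hr : 0 < r := h0.trans_lt h
  obtain ⟨B, hB⟩ := (tendsto_self_mul_const_pow_of_lt_one (r := ρ / r) (by positivity)
    ((div_lt_one hr).2 h)).bddAbove_range
  refine ⟨B, fun n => ?_⟩
  have := hB ⟨n, rfl⟩
  simp only [div_pow, ← mul_div_assoc] at this
  exact (div_le_iff₀ (by positivity)).1 this

/-- The factor n is absorbed by passing to a slightly larger radius r < ε. -/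
theorem ConvS.tDer (hf : ConvS ε f) : ConvS ε (tDer f) := fun ρ h0 h1 => by
  obtain ⟨r, hr, hr'⟩ := exists_between h1
  obtain ⟨B, hB⟩ := exists_nat_mul_pow_le h0 hr
  refine Summable.of_nonneg_of_le (fun n => by positivity) (fun n => ?_)
    ((hf r (h0.trans hr.le) hr').mul_left B)
  rw [LimMHS.tDer, coeff_mk, norm_mul, Complex.norm_natCast]
  nlinarith [hB n, norm_nonneg (coeff n f)]

/-- Termwise differentiation on a ball of radius ρ between ‖t‖ and ε, with majorant ρ⁻¹ times the
series for θf at ρ. The product t * d avoids a division at t = 0. -/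
theorem hasDerivAt_psv (hf : ConvS ε f) (ht : ‖t‖ < ε) :
    ∃ d, HasDerivAt (psv f) d t ∧ t * d = psv (tDer f) t := by
  obtain ⟨ρ, hρ, hρ'⟩ := exists_between ht
  have hρ0 : 0 < ρ := (norm_nonneg t).trans_lt hρ
  refine ⟨∑' n, coeff n f * (n * t ^ (n - 1)), ?_, ?_⟩
  · have hu := (hf.tDer ρ hρ0.le hρ').mul_left ρ⁻¹
    refine hasDerivAt_tsum_of_isPreconnected (t := Metric.ball 0 ρ) (y₀ := t) hu Metric.isOpen_ball
      (convex_ball 0 ρ).isPreconnected (fun n y _ => (hasDerivAt_pow n y).const_mul _) ?_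
      (by simpa using hρ) (hf.summable ht) (by simpa using hρ)
    intro n y hy
    have hy' : ‖y‖ ≤ ρ := by simpa using (mem_ball_zero_iff.1 hy).le
    rw [norm_mul, norm_mul, norm_pow, tDer, coeff_mk, norm_mul, Complex.norm_natCast]
    rcases n with _ | n
    · simp
    · rw [Nat.add_sub_cancel, pow_succ]
      have : ‖y‖ ^ n ≤ ρ ^ n := pow_le_pow_left₀ (norm_nonneg y) hy' n
      calc ‖coeff (n + 1) f‖ * (((n + 1 : ℕ) : ℝ) * ‖y‖ ^ n)
          ≤ ‖coeff (n + 1) f‖ * (((n + 1 : ℕ) : ℝ) * ρ ^ n) := by gcongr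
        _ = _ := by field_simp
  · rw [← tsum_mul_left]
    refine tsum_congr fun n => ?_
    rw [tDer, coeff_mk]
    rcases n with _ | n
    · simp
    · rw [Nat.add_sub_cancel, pow_succ]
      ring

theorem psv_zero_right (f : PowerSeries ℂ) : psv f 0 = coeff 0 f := by
  unfold psv
  rw [tsum_eq_single 0 fun n hn => by rw [zero_pow hn, mul_zero]]
  simp

end PowerSeriesSum

/-! ### The growth of the coefficients of the Frobenius series -/

section Growth

open PowerSeries

/-- A recursive estimate that yields convergence. -/
theorem summable_of_recursive_bound {b : ℕ → ℝ} (hb : ∀ n, 0 ≤ b n) {r ρ B : ℝ}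
    (hr : 0 < r) (hρ : 0 ≤ ρ) (hρr : ρ < r)
    (h : ∀ n, b (n + 1) ≤ B / (n + 1) * ∑ l ∈ Finset.range (n + 1), b l / r ^ (n + 1 - l)) :
    Summable fun n => b n * ρ ^ n := by
  -- For these partial sums the recursion reads S(n+1) ≤ (1 + B/(n+1)) S(n). Their growth is
  -- subexponential, and the ratio test applies to S(n)(ρ/r)^n.
  set S : ℕ → ℝ := fun n => ∑ l ∈ Finset.range (n + 1), b l * r ^ l with hS
  have hS0 : ∀ n, 0 ≤ S n := fun n => Finset.sum_nonneg fun l _ => mul_nonneg (hb l) (by positivity)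
  have hSb : ∀ n, b n * r ^ n ≤ S n := fun n =>
    Finset.single_le_sum (f := fun l => b l * r ^ l)
      (fun l _ => mul_nonneg (hb l) (by positivity)) (Finset.self_mem_range_succ n)
  have hstep : ∀ n, S (n + 1) ≤ (1 + B / (n + 1)) * S n := fun n => by
    have h1 : b (n + 1) * r ^ (n + 1) ≤ B / (n + 1) * S n := by
      calc b (n + 1) * r ^ (n + 1)
          ≤ (B / (n + 1) * ∑ l ∈ Finset.range (n + 1), b l / r ^ (n + 1 - l)) * r ^ (n + 1) := by
            gcongr; exact h n
        _ = B / (n + 1) * S n := by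
            rw [mul_assoc, Finset.sum_mul]
            congr 1
            refine Finset.sum_congr rfl fun l hl => ?_
            have hl' : l ≤ n + 1 := (Finset.mem_range.1 hl).le
            conv_lhs => rw [← Nat.sub_add_cancel hl', pow_add, Nat.add_sub_cancel]
            field_simp
    have h2 : S (n + 1) = S n + b (n + 1) * r ^ (n + 1) := Finset.sum_range_succ _ _
    rw [h2]
    linarith
  have hx : ρ / r < 1 := (div_lt_one hr).2 hρr
  have hx0 : 0 ≤ ρ / r := by positivity
  obtain ⟨y, hy, hy1⟩ := exists_between hx
  have hlim : Tendsto (fun n : ℕ => (1 + B / ((n : ℝ) + 1)) * (ρ / r)) atTop (𝓝 ((1 + 0) * (ρ / r))) := by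
    refine (Tendsto.const_add 1 ?_).mul_const _
    exact tendsto_const_nhds.div_atTop (tendsto_natCast_atTop_atTop.atTop_add tendsto_const_nhds)
  have hev : ∀ᶠ n : ℕ in atTop, (1 + B / ((n : ℝ) + 1)) * (ρ / r) ≤ y :=
    (hlim.eventually_lt_const (by rw [add_zero, one_mul]; exact hy)).mono fun _ => le_of_lt
  have hsum : Summable fun n => S n * (ρ / r) ^ n := by
    refine summable_of_ratio_norm_eventually_le hy1 (hev.mono fun n hn => ?_)
    rw [Real.norm_of_nonneg (mul_nonneg (hS0 _) (by positivity)),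
      Real.norm_of_nonneg (mul_nonneg (hS0 _) (by positivity))]
    calc S (n + 1) * (ρ / r) ^ (n + 1)
        ≤ ((1 + B / (n + 1)) * S n) * (ρ / r) ^ (n + 1) := by gcongr; exact hstep n
      _ = ((1 + B / (n + 1)) * (ρ / r)) * (S n * (ρ / r) ^ n) := by ring
      _ ≤ y * (S n * (ρ / r) ^ n) := by
        gcongr
        exact mul_nonneg (hS0 _) (by positivity)
  refine Summable.of_nonneg_of_le (fun n => mul_nonneg (hb n) (by positivity)) (fun n => ?_) hsum
  calc b n * ρ ^ n = b n * r ^ n * (ρ / r) ^ n := by rw [div_pow]; field_simp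
    _ ≤ _ := by gcongr; exact hSb n

/-- The `ℓ¹`-norm of a power series modulo `X^M`. -/
def truncNorm (M : ℕ) (f : PowerSeries ℂ) : ℝ := ∑ k ∈ Finset.range M, ‖coeff k f‖

theorem truncNorm_nonneg (M : ℕ) (f : PowerSeries ℂ) : 0 ≤ truncNorm M f :=
  Finset.sum_nonneg fun _ _ => norm_nonneg _

theorem norm_coeff_le_truncNorm {M k : ℕ} (h : k < M) (f : PowerSeries ℂ) :
    ‖coeff k f‖ ≤ truncNorm M f :=
  Finset.single_le_sum (f := fun k => ‖coeff k f‖) (fun _ _ => norm_nonneg _) (Finset.mem_range.2 h)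

theorem truncNorm_mul_le (M : ℕ) (f g : PowerSeries ℂ) :
    truncNorm M (f * g) ≤ truncNorm M f * truncNorm M g := by
  have h1 : truncNorm M (f * g) ≤
      ∑ k ∈ Finset.range M, ∑ x ∈ Finset.HasAntidiagonal.antidiagonal k, ‖coeff x.1 f‖ * ‖coeff x.2 g‖ := by
    refine Finset.sum_le_sum fun k _ => ?_
    rw [coeff_mul]
    refine (norm_sum_le _ _).trans_eq (Finset.sum_congr rfl fun x _ => norm_mul _ _)
  refine h1.trans ?_
  rw [truncNorm, truncNorm, Finset.sum_mul_sum, ← Finset.sum_product', Finset.sum_sigma']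
  -- The pairs with sum below M embed in the square of pairs with both entries below M.
  have hinj : Set.InjOn (fun x : (Σ _ : ℕ, ℕ × ℕ) => x.2)
      ((Finset.range M).sigma fun k => Finset.HasAntidiagonal.antidiagonal k : Finset (Σ _ : ℕ, ℕ × ℕ)) := by
    rintro ⟨a, x⟩ ha ⟨b, y⟩ hb hab
    simp only [Finset.coe_sigma, Set.mem_sigma_iff, Finset.mem_coe, Finset.HasAntidiagonal.mem_antidiagonal] at ha hb hab
    subst hab
    rw [← ha.2, ← hb.2]
  rw [← Finset.sum_image (f := fun x : ℕ × ℕ => ‖coeff x.1 f‖ * ‖coeff x.2 g‖) hinj]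
  refine Finset.sum_le_sum_of_subset_of_nonneg ?_ fun _ _ _ => by positivity
  intro x hx
  simp only [Finset.mem_image, Finset.mem_sigma, Finset.HasAntidiagonal.mem_antidiagonal, Finset.mem_range] at hx
  obtain ⟨⟨k, y⟩, ⟨h2, h3⟩, rfl⟩ := hx
  simp only [Finset.mem_product, Finset.mem_range] at h2 h3 ⊢
  omega

theorem truncNorm_sum_le {ι : Type*} (M : ℕ) (s : Finset ι) (f : ι → PowerSeries ℂ) :
    truncNorm M (∑ i ∈ s, f i) ≤ ∑ i ∈ s, truncNorm M (f i) := by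
  unfold truncNorm
  rw [Finset.sum_comm]
  refine Finset.sum_le_sum fun k _ => ?_
  rw [map_sum]
  exact norm_sum_le _ _

theorem truncNorm_neg (M : ℕ) (f : PowerSeries ℂ) : truncNorm M (-f) = truncNorm M f := by
  simp [truncNorm]

theorem truncNorm_C_mul (M : ℕ) (c : ℂ) (f : PowerSeries ℂ) :
    truncNorm M (C c * f) = ‖c‖ * truncNorm M f := by
  simp [truncNorm, Finset.mul_sum]

theorem truncNorm_one_le (M : ℕ) : truncNorm M 1 ≤ 1 := by
  have : ∀ k, ‖coeff k (1 : PowerSeries ℂ)‖ = if k = 0 then 1 else 0 := fun k => by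
    rw [coeff_one]; split_ifs <;> simp
  simp only [truncNorm, this, Finset.sum_ite_eq', Finset.mem_range]
  split_ifs <;> norm_num

theorem truncNorm_pow_le (M n : ℕ) (f : PowerSeries ℂ) : truncNorm M (f ^ n) ≤ truncNorm M f ^ n := by
  induction n with
  | zero => simpa using truncNorm_one_le M
  | succ n ih =>
    rw [pow_succ, pow_succ]
    exact (truncNorm_mul_le _ _ _).trans (by gcongr; exact truncNorm_nonneg _ _)

theorem truncNorm_X_add_C_le (M n : ℕ) : truncNorm M (X + C (n : ℂ)) ≤ n + 1 := by
  have : truncNorm M (X + C (n : ℂ)) ≤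
      ∑ k ∈ Finset.range M, ((if k = 1 then (1 : ℝ) else 0) + if k = 0 then (n : ℝ) else 0) := by
    refine Finset.sum_le_sum fun k _ => ?_
    rw [map_add, coeff_X, coeff_C]
    refine (norm_add_le _ _).trans (le_of_eq ?_)
    congr 1 <;> split_ifs <;> simp
  refine this.trans ?_
  rw [Finset.sum_add_distrib, Finset.sum_ite_eq', Finset.sum_ite_eq']
  split_ifs <;> linarith [(Nat.cast_nonneg n : (0 : ℝ) ≤ n)]

/-- Each of the M coefficients has norm (n+1)^-(k+1), hence at most 1/(n+1). -/
theorem truncNorm_inv_le (M n : ℕ) : truncNorm M (X + C ((n + 1 : ℕ) : ℂ))⁻¹ ≤ M / (n + 1) := by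
  have h0 : ((n + 1 : ℕ) : ℂ) ≠ 0 := Nat.cast_ne_zero.2 n.succ_ne_zero
  have : (X + C ((n + 1 : ℕ) : ℂ) : PowerSeries ℂ)⁻¹ =
      PowerSeries.mk fun k => (-1) ^ k * (((n + 1 : ℕ) : ℂ) ^ (k + 1))⁻¹ := by
    rw [PowerSeries.inv_eq_iff_mul_eq_one (by simpa using h0)]
    generalize ((n + 1 : ℕ) : ℂ) = a at h0
    ext k
    rcases k with _ | k
    · simp [mul_add, h0]
    · rw [mul_add, map_add, coeff_succ_mul_X, mul_comm _ (C a), coeff_C_mul, coeff_mk, coeff_mk,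
        coeff_one, if_neg (Nat.succ_ne_zero k)]
      field_simp
      ring
  rw [this, truncNorm]
  have hle : ∀ k ∈ Finset.range M, ‖coeff k (PowerSeries.mk fun k =>
      (-1) ^ k * (((n + 1 : ℕ) : ℂ) ^ (k + 1))⁻¹)‖ ≤ 1 / ((n : ℝ) + 1) := fun k _ => by
    rw [coeff_mk, norm_mul, norm_pow, norm_neg, norm_one, one_pow, one_mul, norm_inv, norm_pow,
      Complex.norm_natCast, one_div]
    push_cast
    refine inv_anti₀ (by positivity) ?_
    exact le_self_pow₀ (by linarith [(Nat.cast_nonneg n : (0 : ℝ) ≤ n)]) (Nat.succ_ne_zero k)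
  refine (Finset.sum_le_card_nsmul _ _ _ hle).trans_eq ?_
  rw [Finset.card_range, nsmul_eq_mul]
  ring

end Growth

/-! ### The Frobenius series -/

section Frobenius

open PowerSeries

variable {K : Subfield ℂ} {m : ℕ} {ε : ℝ}

theorem ratVal_eq (r : RatFunc K) (t : ℂ) :
    ratVal r t = r.num.eval₂ K.subtype t / r.denom.eval₂ K.subtype t := rfl

/-- The denominator has no zero in the disc, so its inverse converges there. The sum is then
identified by multiplying back by the denominator. -/
theorem convS_taylor0 {r : RatFunc K} (hε : 0 < ε) (h : ∀ t : ℂ, ‖t‖ < ε → NoPole r t) :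
    ConvS ε (PowerSeries.map K.subtype (taylor0 r)) ∧
      ∀ t : ℂ, ‖t‖ < ε → psv (PowerSeries.map K.subtype (taylor0 r)) t = ratVal r t := by
  have hd0 : (r.denom.map K.subtype).eval 0 ≠ 0 := by
    rw [Polynomial.eval_map]
    exact h 0 (by simpa using hε)
  have hd0' : constantCoeff (r.denom : PowerSeries K) ≠ 0 := fun h0 => hd0 <| by
    rw [← Polynomial.coeff_zero_eq_eval_zero, Polynomial.coeff_map]
    have : r.denom.coeff 0 = 0 := by simpa using h0
    rw [this, map_zero]
  have hmul : PowerSeries.map K.subtype (taylor0 r) * (r.denom.map K.subtype : Polynomial ℂ) =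
      ((r.num.map K.subtype : Polynomial ℂ) : PowerSeries ℂ) := by
    rw [Polynomial.polynomial_map_coe, Polynomial.polynomial_map_coe, ← map_mul, taylor0,
      mul_assoc, PowerSeries.inv_mul_cancel _ hd0', mul_one]
  have hinv := convS_inv_coe (r.denom.map K.subtype) hε fun t ht => by
    rw [Polynomial.eval_map]; exact h t ht
  have hconv : ConvS ε (PowerSeries.map K.subtype (taylor0 r)) := by
    have h2 : constantCoeff ((r.denom.map K.subtype : Polynomial ℂ) : PowerSeries ℂ) ≠ 0 := by
      rw [← coeff_zero_eq_constantCoeff_apply, Polynomial.coeff_coe,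
        Polynomial.coeff_zero_eq_eval_zero]
      exact hd0
    rw [(PowerSeries.eq_mul_inv_iff_mul_eq h2).2 hmul]
    exact (convS_coe _).mul hinv
  refine ⟨hconv, fun t ht => ?_⟩
  have := congrArg (fun f => psv f t) hmul
  rw [psv_mul hconv (convS_coe _) ht, psv_coe, psv_coe, Polynomial.eval_map,
    Polynomial.eval_map] at this
  rw [ratVal_eq, eq_div_iff (h t ht), this]

theorem denom_div_dvd_mul_num (a b : RatFunc K) (hb : b ≠ 0) :
    (a / b).denom ∣ a.denom * b.num := by
  rw [div_eq_mul_inv]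
  exact (RatFunc.denom_mul_dvd _ _).trans (mul_dvd_mul_left _ (RatFunc.denom_inv_dvd hb))

theorem NoPole.div {a b : RatFunc K} {t : ℂ} (ha : NoPole a t) (hb : ratVal b t ≠ 0) :
    NoPole (a / b) t := by
  have hb0 : b ≠ 0 := by
    rintro rfl
    simp [ratVal] at hb
  intro h0
  have := Polynomial.eval₂_eq_zero_of_dvd_of_eval₂_eq_zero K.subtype t (denom_div_dvd_mul_num a b hb0) h0
  rw [Polynomial.eval₂_mul] at this
  rcases mul_eq_zero.1 this with h | h
  · exact ha h
  · rw [ratVal_eq, h, zero_div] at hb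
    exact hb rfl

variable (q : Fin (m + 1) → RatFunc K)

/-- The Taylor series of `q_j / q_0`. -/
def qSer (j : Fin (m + 1)) : PowerSeries ℂ := PowerSeries.map K.subtype (taylor0 (q j / q 0))

/-- The coefficients `a_n(s)` over `ℂ`. -/
def aSer (n : ℕ) : PowerSeries ℂ := PowerSeries.map K.subtype (frobCoeff q n)

/-- The Frobenius series `φ_k^an` over `ℂ`. -/
def phiSer (k : ℕ) : PowerSeries ℂ := PowerSeries.map K.subtype (frobSeries q k)

/-- The polynomials `p_i(l + s)` over `ℂ`. -/
def shP (i l : ℕ) : PowerSeries ℂ :=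
  ∑ j : Fin (m + 1), C (coeff i (qSer q j)) * (X + C (l : ℂ)) ^ (m - (j : ℕ))

theorem coeff_phiSer (k n : ℕ) : coeff n (phiSer q k) = coeff k (aSer q n) := by
  simp [phiSer, aSer, frobSeries]

theorem aSer_zero : aSer q 0 = 1 := by
  rw [aSer, frobCoeff, map_one]

theorem map_shiftedPoly (i l : ℕ) : PowerSeries.map K.subtype (shiftedPoly q i l) = shP q i l := by
  rw [shiftedPoly, ← Polynomial.polynomial_map_coe, Polynomial.map_comp, coeffPoly,
    Polynomial.map_sum, Polynomial.sum_comp]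
  rw [← Polynomial.coeToPowerSeries.ringHom_apply, map_sum, shP]
  refine Finset.sum_congr rfl fun j _ => ?_
  rw [Polynomial.coeToPowerSeries.ringHom_apply]
  simp only [Polynomial.map_mul, Polynomial.map_C, Polynomial.map_pow, Polynomial.map_X,
    Polynomial.map_add, Polynomial.mul_comp, Polynomial.C_comp, Polynomial.pow_comp,
    Polynomial.X_comp, Polynomial.coe_mul, Polynomial.coe_C, Polynomial.coe_pow, Polynomial.coe_add,
    Polynomial.coe_X, qSer, PowerSeries.coeff_map]
  rw [map_natCast K.subtype l]

variable {q}

theorem qSer_zero (hq0 : q 0 ≠ 0) : qSer q 0 = 1 := by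
  have : taylor0 (q 0 / q 0) = 1 := by
    rw [div_self hq0, taylor0, RatFunc.num_one, RatFunc.denom_one]
    simp
  rw [qSer, this, map_one]

theorem coeff_zero_taylor0 (r : RatFunc K) :
    coeff 0 (taylor0 r) = r.eval (RingHom.id K) 0 := by
  rw [taylor0, RatFunc.eval, div_eq_mul_inv]
  simp [Polynomial.coeff_zero_eq_eval_zero]

/-- A monic complex polynomial of degree m whose only root is 0 is X^m; monic because the leading
coefficient comes from q₀/q₀ = 1. -/
theorem indicial_map (hq0 : q 0 ≠ 0) (hexp : localExponents q = {0}) :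
    (indicial q).map K.subtype = Polynomial.X ^ m := by
  set P := (indicial q).map K.subtype with hP
  have hlead : P = Polynomial.X ^ m + ∑ j : Fin m, Polynomial.C (K.subtype
      ((q j.succ / q 0).eval (RingHom.id K) 0)) * Polynomial.X ^ (m - 1 - (j : ℕ)) := by
    rw [hP, indicial, Polynomial.map_sum, Fin.sum_univ_succ, div_self hq0]
    congr 1
    · simp
    · refine Finset.sum_congr rfl fun j _ => ?_
      rw [Polynomial.map_mul, Polynomial.map_C, Polynomial.map_pow, Polynomial.map_X, Fin.val_succ]
      congr 2
      omega
  have hdeg : Polynomial.degree (∑ j : Fin m, Polynomial.C (K.subtype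
      ((q j.succ / q 0).eval (RingHom.id K) 0)) * Polynomial.X ^ (m - 1 - (j : ℕ))) < m := by
    refine (Polynomial.degree_sum_le _ _).trans_lt ?_
    rw [Finset.sup_lt_iff (by exact_mod_cast WithBot.bot_lt_coe m)]
    intro j _
    refine (Polynomial.degree_C_mul_X_pow_le _ _).trans_lt ?_
    have := j.2
    exact_mod_cast (by omega : m - 1 - (j : ℕ) < m)
  have hmon : P.Monic := hlead ▸ Polynomial.monic_X_pow_add hdeg
  have hnat : P.natDegree = m := by
    rw [hlead]
    exact Polynomial.natDegree_eq_of_degree_eq_some (by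
      rw [Polynomial.degree_add_eq_left_of_degree_lt (by rwa [Polynomial.degree_X_pow]),
        Polynomial.degree_X_pow])
  have hsp := IsAlgClosed.splits P
  have hroots : P.roots = Multiset.replicate m 0 := by
    refine Multiset.eq_replicate.2 ⟨?_, fun b hb => ?_⟩
    · rw [← hsp.natDegree_eq_card_roots, hnat]
    · have h1 := (Polynomial.mem_roots hmon.ne_zero).1 hb
      have : b ∈ localExponents q := by
        rw [localExponents, Set.mem_ofPred_eq, ← Polynomial.eval_map]
        exact h1
      rw [hexp] at this
      exact this
  have := hsp.eq_prod_roots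
  rw [hmon.leadingCoeff, hroots] at this
  simpa using this

theorem coeff_zero_qSer (hq0 : q 0 ≠ 0) (hexp : localExponents q = {0}) (j : Fin (m + 1)) :
    coeff 0 (qSer q j) = if j = 0 then 1 else 0 := by
  have h := congrArg (fun P => Polynomial.coeff P (m - (j : ℕ))) (indicial_map hq0 hexp)
  simp only [indicial, Polynomial.map_sum, Polynomial.map_mul, Polynomial.map_C,
    Polynomial.map_pow, Polynomial.map_X, Polynomial.finsetSum_coeff, Polynomial.coeff_C_mul_X_pow,
    Polynomial.coeff_X_pow] at h
  have hj := j.2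
  rw [Finset.sum_eq_single j, if_pos rfl] at h
  · rw [qSer, PowerSeries.coeff_map, coeff_zero_taylor0, h]
    congr 1
    rw [Fin.ext_iff, Fin.val_zero, eq_iff_iff]
    omega
  · intro i _ hij
    have hi := i.2
    rw [if_neg]
    intro h'
    apply hij
    rw [Fin.ext_iff]
    omega
  · intro h'
    exact absurd (Finset.mem_univ j) h'

theorem shP_zero (hq0 : q 0 ≠ 0) (hexp : localExponents q = {0}) (l : ℕ) :
    shP q 0 l = (X + C (l : ℂ)) ^ m := by
  rw [shP, Finset.sum_eq_single 0]
  · rw [coeff_zero_qSer hq0 hexp, if_pos rfl, map_one, one_mul, Fin.val_zero, Nat.sub_zero]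
  · intro j _ hj
    rw [coeff_zero_qSer hq0 hexp, if_neg hj, map_zero, zero_mul]
  · simp

theorem aSer_succ (hq0 : q 0 ≠ 0) (hexp : localExponents q = {0}) (n : ℕ) :
    (X + C ((n + 1 : ℕ) : ℂ)) ^ m * aSer q (n + 1) =
      -∑ l ∈ Finset.range (n + 1), shP q (n + 1 - l) l * aSer q l := by
  have h1 : PowerSeries.map K.subtype (shiftedPoly q 0 (n + 1)) = (X + C ((n + 1 : ℕ) : ℂ)) ^ m := by
    rw [map_shiftedPoly, shP_zero hq0 hexp]
  have hne : constantCoeff (shiftedPoly q 0 (n + 1)) ≠ 0 := by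
    intro h0
    have := congrArg (coeff 0) h1
    rw [PowerSeries.coeff_map, coeff_zero_eq_constantCoeff_apply, h0, map_zero,
      coeff_zero_eq_constantCoeff_apply, map_pow] at this
    have h2 := eq_zero_of_pow_eq_zero this.symm
    exact Nat.cast_add_one_ne_zero (R := ℂ) n (by simpa using h2)
  rw [aSer, frobCoeff, ← h1, ← map_mul, neg_mul, mul_neg, ← mul_assoc,
    PowerSeries.mul_inv_cancel _ hne, one_mul, map_neg, map_sum,
    Finset.sum_range fun l => shP q (n + 1 - l) l * aSer q l]
  simp only [map_mul, map_shiftedPoly]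
  rfl

/-- The Frobenius equation q₀⁻¹L (t^s Φ) = s^m t^s, read off at t^(n+s). The term n = 0 is the
indicial polynomial. -/
theorem frobenius_recursion (hq0 : q 0 ≠ 0) (hexp : localExponents q = {0}) (n : ℕ) :
    ∑ x ∈ Finset.HasAntidiagonal.antidiagonal n, shP q x.1 x.2 * aSer q x.2 =
      if n = 0 then X ^ m else 0 := by
  rcases n with _ | n
  · simp [shP_zero hq0 hexp, aSer_zero]
  · have h1 := aSer_succ hq0 hexp n
    rw [if_neg n.succ_ne_zero, ← Finset.Nat.sum_antidiagonal_swap,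
      Finset.Nat.sum_antidiagonal_eq_sum_range_succ_mk, Finset.sum_range_succ]
    simp only [Prod.fst_swap, Prod.snd_swap]
    rw [Nat.sub_self, shP_zero hq0 hexp, h1, add_neg_cancel]

/-- The exponent is m - 1, not m: for i ≠ 0 the top term drops out because q₀/q₀ = 1 has no higher
coefficients. This saved factor yields the 1/(n+1) needed for convergence. -/
theorem truncNorm_shP_le (hq0 : q 0 ≠ 0) (M i l : ℕ) (hi : i ≠ 0) :
    truncNorm M (shP q i l) ≤
      (∑ j : Fin (m + 1), ‖coeff i (qSer q j)‖) * ((l : ℝ) + 1) ^ (m - 1) := by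
  rw [Finset.sum_mul]
  refine (truncNorm_sum_le _ _ _).trans (Finset.sum_le_sum fun j _ => ?_)
  rw [truncNorm_C_mul]
  rcases eq_or_ne j 0 with rfl | hj
  · rw [qSer_zero hq0, coeff_one, if_neg hi, norm_zero, zero_mul, zero_mul]
  · refine mul_le_mul_of_nonneg_left ?_ (norm_nonneg _)
    calc truncNorm M ((X + C (l : ℂ)) ^ (m - (j : ℕ)))
        ≤ truncNorm M (X + C (l : ℂ)) ^ (m - (j : ℕ)) := truncNorm_pow_le _ _ _
      _ ≤ ((l : ℝ) + 1) ^ (m - (j : ℕ)) := by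
        gcongr
        · exact truncNorm_nonneg _ _
        · exact truncNorm_X_add_C_le M l
      _ ≤ ((l : ℝ) + 1) ^ (m - 1) := by
        refine pow_le_pow_right₀ (by linarith [(Nat.cast_nonneg l : (0 : ℝ) ≤ l)]) ?_
        have : (j : ℕ) ≠ 0 := fun h => hj (Fin.ext h)
        omega

theorem ConvS.exists_bound {f : PowerSeries ℂ} (hf : ConvS ε f) {r : ℝ} (hr : 0 < r) (hrε : r < ε) :
    ∃ B : ℝ, ∀ n, ‖coeff n f‖ ≤ B / r ^ n := by
  obtain ⟨B, hB⟩ := (hf r hr.le hrε).tendsto_atTop_zero.bddAbove_range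
  exact ⟨B, fun n => (le_div_iff₀ (by positivity)).2 (hB ⟨n, rfl⟩)⟩

/-- The inverse of (n+1+s)^m contributes O((n+1)^-m) and the p_i contribute O((n+1)^(m-1) r^-i). So
the norms of the a_n satisfy the hypothesis of `summable_of_recursive_bound`. -/
theorem convS_phiSer (hm : 0 < m) (hq0 : q 0 ≠ 0) (hexp : localExponents q = {0})
    (hconv : ∀ j, ConvS ε (qSer q j)) (k : ℕ) : ConvS ε (phiSer q k) := by
  intro ρ h0 h1
  obtain ⟨r, hρr, hr⟩ := exists_between h1
  have hr0 : 0 < r := h0.trans_lt hρr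
  choose B hB using fun j => (hconv j).exists_bound hr0 hr
  -- The series φ_k^an involves only the coefficients of s^k, so it suffices to work modulo s^(k+1).
  set M := k + 1
  have hrec : ∀ n, truncNorm M (aSer q (n + 1)) ≤ ((M : ℝ) ^ m * ∑ j, B j) / (n + 1) *
      ∑ l ∈ Finset.range (n + 1), truncNorm M (aSer q l) / r ^ (n + 1 - l) := by
    intro n
    have hn : (0 : ℝ) < (n : ℝ) + 1 := by positivity
    have h2 : aSer q (n + 1) = -((X + C ((n + 1 : ℕ) : ℂ))⁻¹ ^ m *
        ∑ l ∈ Finset.range (n + 1), shP q (n + 1 - l) l * aSer q l) := by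
      rw [← mul_neg, ← aSer_succ hq0 hexp, ← mul_assoc, ← mul_pow, PowerSeries.inv_mul_cancel,
        one_pow, one_mul]
      simpa using Nat.cast_add_one_ne_zero (R := ℂ) n
    have h3 : ∀ l ∈ Finset.range (n + 1), truncNorm M (shP q (n + 1 - l) l * aSer q l) ≤
        ((n : ℝ) + 1) ^ (m - 1) * (∑ j, B j) * (truncNorm M (aSer q l) / r ^ (n + 1 - l)) := by
      intro l hl
      have hl' := Finset.mem_range.1 hl
      calc truncNorm M (shP q (n + 1 - l) l * aSer q l)
          ≤ truncNorm M (shP q (n + 1 - l) l) * truncNorm M (aSer q l) := truncNorm_mul_le _ _ _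
        _ ≤ ((∑ j, B j / r ^ (n + 1 - l)) * ((n : ℝ) + 1) ^ (m - 1)) * truncNorm M (aSer q l) := by
          refine mul_le_mul_of_nonneg_right ?_ (truncNorm_nonneg _ _)
          refine (truncNorm_shP_le hq0 M _ l (by omega)).trans ?_
          refine mul_le_mul (Finset.sum_le_sum fun j _ => hB j _) ?_ (by positivity)
            (Finset.sum_nonneg fun j _ => (norm_nonneg _).trans (hB j _))
          have : (l : ℝ) ≤ n := by exact_mod_cast Nat.lt_succ_iff.1 hl'
          gcongr
        _ = _ := by
          rw [← Finset.sum_div]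
          ring
    rw [h2, truncNorm_neg]
    calc truncNorm M ((X + C ((n + 1 : ℕ) : ℂ))⁻¹ ^ m *
          ∑ l ∈ Finset.range (n + 1), shP q (n + 1 - l) l * aSer q l)
        ≤ (M / ((n : ℝ) + 1)) ^ m * ∑ l ∈ Finset.range (n + 1),
          ((n : ℝ) + 1) ^ (m - 1) * (∑ j, B j) * (truncNorm M (aSer q l) / r ^ (n + 1 - l)) := by
          refine (truncNorm_mul_le _ _ _).trans (mul_le_mul ?_ ?_ (truncNorm_nonneg _ _)
            (by positivity))
          · refine (truncNorm_pow_le _ _ _).trans ?_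
            gcongr
            · exact truncNorm_nonneg _ _
            · exact truncNorm_inv_le M n
          · exact (truncNorm_sum_le _ _ _).trans (Finset.sum_le_sum h3)
      _ = _ := by
        rw [← Finset.mul_sum]
        obtain ⟨d, rfl⟩ : ∃ d, m = d + 1 := ⟨m - 1, by omega⟩
        rw [Nat.add_sub_cancel, div_pow, pow_succ ((n : ℝ) + 1)]
        field_simp
  refine Summable.of_nonneg_of_le (fun n => by positivity) (fun n => ?_)
    (summable_of_recursive_bound (fun n => truncNorm_nonneg M (aSer q n)) hr0 h0 hρr hrec)
  rw [coeff_phiSer]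
  gcongr
  exact norm_coeff_le_truncNorm (Nat.lt_succ_self k) _

/-- The action of `t d/dt` on the coefficients of the powers of `log t / (2πi)`. -/
def thetaS (Φ : ℕ → PowerSeries ℂ) : ℕ → PowerSeries ℂ
  | 0 => tDer (Φ 0)
  | k + 1 => tDer (Φ (k + 1)) + Φ k

theorem convS_thetaS_iterate {Φ : ℕ → PowerSeries ℂ} (h : ∀ k, ConvS ε (Φ k)) (a : ℕ) :
    ∀ k, ConvS ε (thetaS^[a] Φ k) := by
  induction a with
  | zero => exact h
  | succ a ih =>
    intro k
    rw [Function.iterate_succ_apply']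
    cases k with
    | zero => exact (ih 0).tDer
    | succ k => exact (ih (k + 1)).tDer.add (ih k)

/-- On the generating series in s, `thetaS` is θ + s, which multiplies the coefficient of t^l by l +
s. -/
theorem coeff_thetaS_phiSer (a l : ℕ) :
    ∀ k, coeff l (thetaS^[a] (phiSer q) k) = coeff k ((X + C (l : ℂ)) ^ a * aSer q l) := by
  induction a with
  | zero => intro k; simp [coeff_phiSer]
  | succ a ih =>
    intro k
    rw [Function.iterate_succ_apply', pow_succ', mul_assoc, add_mul, map_add, coeff_C_mul]
    cases k with
    | zero => rw [thetaS, tDer, coeff_mk, ih, coeff_zero_X_mul, zero_add]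
    | succ k => rw [thetaS, tDer, map_add, coeff_mk, ih, ih, coeff_succ_X_mul, add_comm]

theorem sum_qSer_mul_thetaS (hq0 : q 0 ≠ 0) (hexp : localExponents q = {0}) (k : ℕ) :
    ∑ j : Fin (m + 1), qSer q j * thetaS^[m - (j : ℕ)] (phiSer q) k = if k = m then 1 else 0 := by
  ext n
  have h1 : coeff n (∑ j : Fin (m + 1), qSer q j * thetaS^[m - (j : ℕ)] (phiSer q) k) =
      coeff k (∑ x ∈ Finset.HasAntidiagonal.antidiagonal n, shP q x.1 x.2 * aSer q x.2) := by
    simp only [map_sum, coeff_mul n, coeff_thetaS_phiSer, shP, Finset.sum_mul, mul_assoc, coeff_C_mul]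
    rw [Finset.sum_comm]
  rw [h1, frobenius_recursion hq0 hexp]
  rcases eq_or_ne n 0 with rfl | hn
  · rw [if_pos rfl, coeff_X_pow]
    split_ifs <;> simp
  · rw [if_neg hn, map_zero]
    split_ifs
    · rw [coeff_one, if_neg hn]
    · rw [map_zero]

end Frobenius

/-! ### Solutions with logarithms on the universal covering -/

section LogSeries

open PowerSeries

variable {ε : ℝ}

/-- The constant `2πi`. -/
abbrev tpi : ℂ := 2 * Real.pi * Complex.I

theorem tpi_ne_zero : tpi ≠ 0 := Complex.two_pi_I_ne_zero

/-- The power series `exp(x s)` in `s`. -/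
def expS (x : ℂ) : PowerSeries ℂ := rescale x (PowerSeries.exp ℂ)

theorem coeff_expS (x : ℂ) (i : ℕ) : coeff i (expS x) = x ^ i / (i.factorial : ℂ) := by
  rw [expS, coeff_rescale, coeff_exp]
  simp [div_eq_mul_inv]

theorem expS_add (x y : ℂ) : expS (x + y) = expS x * expS y :=
  (exp_mul_exp_eq_exp_add x y).symm

theorem expS_neg_mul (x : ℂ) : expS (-x) * expS x = 1 := by
  rw [← expS_add, neg_add_cancel, expS]
  simp

/-- The generating series of the values `Φ_l(t)`. -/
def valS (Φ : ℕ → PowerSeries ℂ) (t : ℂ) : PowerSeries ℂ := PowerSeries.mk fun l => psv (Φ l) t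

/-- The function `∑_{i + l = k} (2πiz)^i / i! Φ_l(e(z))`. -/
def logFn (Φ : ℕ → PowerSeries ℂ) (k : ℕ) (z : ℂ) : ℂ :=
  coeff k (expS (tpi * z) * valS Φ (eMap z))

theorem logFn_eq (Φ : ℕ → PowerSeries ℂ) (k : ℕ) (z : ℂ) :
    logFn Φ k z = ∑ x ∈ Finset.HasAntidiagonal.antidiagonal k,
      (tpi * z) ^ x.1 / (x.1.factorial : ℂ) * psv (Φ x.2) (eMap z) := by
  simp only [logFn, coeff_mul, coeff_expS, valS, coeff_mk]

theorem logFn_add_one (Φ : ℕ → PowerSeries ℂ) (k : ℕ) (z : ℂ) :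
    logFn Φ k (z + 1) = ∑ x ∈ Finset.HasAntidiagonal.antidiagonal k,
      tpi ^ x.1 / (x.1.factorial : ℂ) * logFn Φ x.2 z := by
  rw [logFn, mul_add, mul_one, add_comm, expS_add, eMap_add_one, mul_assoc, coeff_mul]
  simp only [coeff_expS, logFn]

/-- Multiplication by exp(-2πizs) removes the logarithms. This is the effect of exp(-zN) in Schmid's
twist. -/
theorem sum_neg_pow_mul_logFn (Φ : ℕ → PowerSeries ℂ) (k : ℕ) (z : ℂ) :
    ∑ x ∈ Finset.HasAntidiagonal.antidiagonal k,
      (-(tpi * z)) ^ x.1 / (x.1.factorial : ℂ) * logFn Φ x.2 z = psv (Φ k) (eMap z) := by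
  have : coeff k (expS (-(tpi * z)) * (expS (tpi * z) * valS Φ (eMap z))) = psv (Φ k) (eMap z) := by
    rw [← mul_assoc, expS_neg_mul, one_mul, valS, coeff_mk]
  rw [← this, coeff_mul]
  simp only [coeff_expS, logFn]

theorem hasDerivAt_eMap (z : ℂ) : HasDerivAt eMap (eMap z * tpi) z := by
  have : HasDerivAt (fun z => Complex.exp (tpi * z)) (Complex.exp (tpi * z) * tpi) z := by
    simpa using ((hasDerivAt_id z).const_mul tpi).cexp
  exact this

theorem valS_thetaS {Φ : ℕ → PowerSeries ℂ} (hΦ : ∀ k, ConvS ε (Φ k)) {t : ℂ} (ht : ‖t‖ < ε) :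
    valS (thetaS Φ) t = X * valS Φ t + valS (fun l => tDer (Φ l)) t := by
  ext k
  cases k with
  | zero => rw [map_add, coeff_zero_X_mul, zero_add, valS, valS, coeff_mk, coeff_mk, thetaS]
  | succ k =>
    rw [map_add, coeff_succ_X_mul, valS, valS, valS, coeff_mk, coeff_mk, coeff_mk, thetaS,
      psv_add (hΦ _).tDer (hΦ k) ht, add_comm]

/-- Product rule for exp(2πizs) Φ(e(z)): the exponential contributes s and the series contributes θ,
each with the factor 2πi. -/
theorem hasDerivAt_logFn {Φ : ℕ → PowerSeries ℂ} (hΦ : ∀ k, ConvS ε (Φ k)) (k : ℕ) {z : ℂ}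
    (hz : z ∈ upperG ε) : HasDerivAt (logFn Φ k) (tpi * logFn (thetaS Φ) k z) z := by
  have hsum : HasDerivAt (fun z => ∑ x ∈ Finset.HasAntidiagonal.antidiagonal k,
      (tpi * z) ^ x.1 / (x.1.factorial : ℂ) * psv (Φ x.2) (eMap z))
      (∑ x ∈ Finset.HasAntidiagonal.antidiagonal k, tpi *
        (coeff x.1 (X * expS (tpi * z)) * coeff x.2 (valS Φ (eMap z)) +
        coeff x.1 (expS (tpi * z)) * coeff x.2 (valS (fun l => tDer (Φ l)) (eMap z)))) z := by
    refine HasDerivAt.fun_sum fun x _ => ?_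
    obtain ⟨d, hd, hd'⟩ := hasDerivAt_psv (hΦ x.2) (eMap_mem hz).2
    have h1 : HasDerivAt (fun z : ℂ => (tpi * z) ^ x.1 / (x.1.factorial : ℂ))
        (tpi * coeff x.1 (X * expS (tpi * z))) z := by
      have := (((hasDerivAt_id z).const_mul tpi).pow x.1).div_const (x.1.factorial : ℂ)
      refine this.congr_deriv ?_
      rcases x.1 with _ | i
      · rw [coeff_zero_X_mul]; simp
      · rw [coeff_succ_X_mul, coeff_expS, Nat.factorial_succ]
        have h2 : ((i : ℂ) + 1) ≠ 0 := Nat.cast_add_one_ne_zero i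
        have h3 : (i.factorial : ℂ) ≠ 0 := Nat.cast_ne_zero.2 i.factorial_ne_zero
        push_cast
        simp only [id]
        field_simp
    refine (h1.mul (hd.comp z (hasDerivAt_eMap z))).congr_deriv ?_
    simp only [valS, coeff_mk, coeff_expS, Function.comp]
    rw [← hd']
    ring
  have h4 : logFn Φ k = fun z => ∑ x ∈ Finset.HasAntidiagonal.antidiagonal k,
      (tpi * z) ^ x.1 / (x.1.factorial : ℂ) * psv (Φ x.2) (eMap z) := funext (logFn_eq Φ k)
  rw [h4]
  refine hsum.congr_deriv ?_
  rw [← Finset.mul_sum, Finset.sum_add_distrib, ← coeff_mul, ← coeff_mul, ← map_add, logFn,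
    valS_thetaS hΦ (eMap_mem hz).2]
  congr 2
  ring

end LogSeries

/-! ### The action of differential operators on functions -/

section Action

variable {ε : ℝ}

/-- Evaluation at a point of `G`. -/
def evG (z : upperG ε) : HolG ε →ₗ[ℂ] ℂ where
  toFun u := u.fn z
  map_add' _ _ := rfl
  map_smul' _ _ := rfl

theorem opD_fn (u : HolG ε) (z : upperG ε) :
    (opD ε u).fn z = tpi⁻¹ * deriv (ext0 u.fn) z := rfl

theorem mulOp_fn (f : ringO ε) (u : HolG ε) (z : upperG ε) :
    (mulOp ε f u).fn z = f.1 (eG z) * u.fn z := rfl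

theorem opD_pow_logFn {Φ : ℕ → PowerSeries ℂ} (hΦ : ∀ k, ConvS ε (Φ k)) (k : ℕ) {u : HolG ε}
    (hu : ∀ z, u.fn z = logFn Φ k z) (a : ℕ) (z : upperG ε) :
    ((opD ε ^ a) u).fn z = logFn (thetaS^[a] Φ) k z := by
  induction a generalizing z with
  | zero => exact hu z
  | succ a ih =>
    rw [pow_succ', Module.End.mul_apply, opD_fn, (ext0_eventuallyEq z.2 ih).deriv_eq,
      (hasDerivAt_logFn (convS_thetaS_iterate hΦ a) k z.2).deriv,
      inv_mul_cancel_left₀ tpi_ne_zero, Function.iterate_succ_apply']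

/-- The function `logFn Φ k` as an element of the space of holomorphic functions on `G`. -/
def logHol {Φ : ℕ → PowerSeries ℂ} (hΦ : ∀ k, ConvS ε (Φ k)) (k : ℕ) : HolG ε :=
  HolG.mk (fun z => logFn Φ k z) ⟨logFn Φ k, fun _ hz =>
    (hasDerivAt_logFn hΦ k hz).differentiableAt.differentiableWithinAt, fun _ => rfl⟩

theorem logHol_fn {Φ : ℕ → PowerSeries ℂ} (hΦ : ∀ k, ConvS ε (Φ k)) (k : ℕ) (z : upperG ε) :
    (logHol hΦ k).fn z = logFn Φ k z := rfl

variable {K : Subfield ℂ} {m : ℕ} (q : Fin (m + 1) → RatFunc K)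
  (hq : ∀ j, ∀ t ∈ punctDisc ε, NoPole (q j) t)

theorem opL_val : (opL q hq).1 =
    ∑ j : Fin (m + 1), mulOp ε (ratO ε (q j) (hq j)) * opD ε ^ (m - (j : ℕ)) := by
  simp only [opL, AddSubmonoidClass.coe_finsetSum]
  rfl

theorem opL_fn (u : HolG ε) (z : upperG ε) : ((opL q hq).1 u).fn z =
    ∑ j : Fin (m + 1), ratVal (q j) (eMap z) * ((opD ε ^ (m - (j : ℕ))) u).fn z := by
  rw [opL_val, LinearMap.sum_apply]
  exact map_sum (evG z) _ _

variable {q hq}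

theorem mem_solG {u : HolG ε} : u ∈ solG q hq ↔ ∀ z : upperG ε,
    ∑ j : Fin (m + 1), ratVal (q j) (eMap z) * ((opD ε ^ (m - (j : ℕ))) u).fn z = 0 := by
  rw [solG, LinearMap.mem_ker]
  exact ⟨fun h z => by rw [← opL_fn q hq, h]; rfl, fun h => HolG.ext fun z => by
    rw [opL_fn, h z]; rfl⟩

theorem ne_zero_of_ratVal {r : RatFunc K} {t : ℂ} (h : ratVal r t ≠ 0) : r ≠ 0 := by
  rintro rfl
  simp [ratVal] at h

theorem ratVal_mul_div {a b : RatFunc K} {t : ℂ} (ha : NoPole a t) (hb : NoPole b t)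
    (hb0 : ratVal b t ≠ 0) : ratVal a t = ratVal b t * ratVal (a / b) t := by
  have h := RatFunc.eval_mul (f := K.subtype) (a := t) (x := b) (y := a / b) hb (ha.div hb0)
  rwa [mul_div_cancel₀ _ (ne_zero_of_ratVal hb0)] at h

theorem convS_qSer (hε : 0 < ε) (hq : ∀ j, ∀ t ∈ punctDisc ε, NoPole (q j) t)
    (hq0 : ∀ t ∈ punctDisc ε, ratVal (q 0) t ≠ 0) (hreg : ∀ j, NoPole (q j / q 0) 0)
    (j : Fin (m + 1)) : ConvS ε (qSer q j) ∧
      ∀ t : ℂ, ‖t‖ < ε → psv (qSer q j) t = ratVal (q j / q 0) t := by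
  refine convS_taylor0 hε fun t ht => ?_
  rcases eq_or_ne t 0 with rfl | h0
  · exact hreg j
  · have : t ∈ punctDisc ε := ⟨norm_pos_iff.2 h0, ht⟩
    exact (hq j t this).div (hq0 t this)

theorem pos_of_localExponents (hq0 : q 0 ≠ 0) (hexp : localExponents q = {0}) : 0 < m := by
  rcases Nat.eq_zero_or_pos m with rfl | h
  · have h1 := indicial_map hq0 hexp
    have h2 : (0 : ℂ) ∈ localExponents q := by rw [hexp]; rfl
    rw [localExponents, Set.mem_ofPred_eq, ← Polynomial.eval_map, h1] at h2
    simp at h2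
  · exact h

/-- L sends the generating series to q₀ exp(2πizs) s^m, whose coefficients below s^m vanish. -/
theorem logHol_mem_solG (hε : 0 < ε) (hq0 : ∀ t ∈ punctDisc ε, ratVal (q 0) t ≠ 0)
    (hreg : ∀ j, NoPole (q j / q 0) 0) (hexp : localExponents q = {0})
    (hΦ : ∀ k, ConvS ε (phiSer q k)) {k : ℕ} (hk : k < m) : logHol hΦ k ∈ solG q hq := by
  refine mem_solG.2 fun z => ?_
  have hz := eMap_mem z.2
  have hq0' := ne_zero_of_ratVal (hq0 _ hz)
  have h1 : ∀ j : Fin (m + 1), ratVal (q j) (eMap z) *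
      ((opD ε ^ (m - (j : ℕ))) (logHol hΦ k)).fn z =
      ∑ x ∈ Finset.HasAntidiagonal.antidiagonal k,
        ratVal (q 0) (eMap z) * ((tpi * z) ^ x.1 / (x.1.factorial : ℂ) *
        psv (qSer q j * thetaS^[m - (j : ℕ)] (phiSer q) x.2) (eMap z)) := fun j => by
    rw [opD_pow_logFn hΦ k (logHol_fn hΦ k), logFn_eq, Finset.mul_sum,
      ratVal_mul_div (hq j _ hz) (hq 0 _ hz) (hq0 _ hz)]
    refine Finset.sum_congr rfl fun x _ => ?_
    rw [psv_mul (convS_qSer hε hq hq0 hreg j).1 (convS_thetaS_iterate hΦ _ _) hz.2,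
      (convS_qSer hε hq hq0 hreg j).2 _ hz.2]
    ring
  simp only [h1]
  rw [Finset.sum_comm]
  refine Finset.sum_eq_zero fun x hx => ?_
  rw [← Finset.mul_sum, ← Finset.mul_sum, ← psv_sum Finset.univ (fun j _ =>
    (convS_qSer hε hq hq0 hreg j).1.mul (convS_thetaS_iterate hΦ _ _)) hz.2,
    sum_qSer_mul_thetaS hq0' hexp, if_neg, psv_zero, mul_zero, mul_zero]
  have := Finset.HasAntidiagonal.mem_antidiagonal.1 hx
  omega

end Action

/-! ### Uniqueness for the Cauchy problem -/

section Uniqueness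

/-- A zero of finite positive order would be a zero of order one less of the derivative, which
contradicts the bound of the derivative by the function. -/
theorem eventually_eq_zero_of_norm_deriv_le {E : Type*} [NormedAddCommGroup E] [NormedSpace ℂ E]
    [CompleteSpace E] {F : ℂ → E} {p : ℂ} (hF : AnalyticAt ℂ F p) {B : ℝ}
    (h : ∀ᶠ t in 𝓝 p, ‖deriv F t‖ ≤ B * ‖F t‖) (h0 : F p = 0) : ∀ᶠ t in 𝓝 p, F t = 0 := by
  by_contra hne
  obtain ⟨n, g, hg, hg0, hFg⟩ := hF.exists_eventuallyEq_pow_smul_nonzero_iff.2 hne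
  rcases n with _ | n
  · have := hFg.self_of_nhds
    rw [pow_zero, one_smul, h0] at this
    exact hg0 this.symm
  -- The inequality after division by ‖t - p‖^n. As t → p its right side tends to 0 and its left
  -- side to (n+1)‖g(p)‖ > 0.
  have hev : ∀ᶠ t in 𝓝[≠] p,
      ‖((n : ℂ) + 1) • g t + (t - p) • deriv g t‖ ≤ B * (‖t - p‖ * ‖g t‖) := by
    rw [eventually_nhdsWithin_iff]
    filter_upwards [h, hFg, hFg.eventually_nhds, hg.eventually_analyticAt] with t h1 h2 h3 h4 htp
    have htp' : t - p ≠ 0 := sub_ne_zero.2 htp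
    have hd : deriv F t = (t - p) ^ n • (((n : ℂ) + 1) • g t + (t - p) • deriv g t) := by
      have h5 : HasDerivAt (fun t => (t - p) ^ (n + 1) • g t)
          ((t - p) ^ (n + 1) • deriv g t + (((n + 1 : ℕ) : ℂ) * (t - p) ^ n * 1) • g t) t :=
        (((hasDerivAt_id t).sub_const p).pow (n + 1)).smul h4.differentiableAt.hasDerivAt
      rw [EventuallyEq.deriv_eq h3, h5.deriv, smul_add, smul_smul, smul_smul, mul_one, add_comm,
        mul_comm ((t - p) ^ n), pow_succ]
      push_cast
      rfl
    rw [hd, h2, norm_smul, norm_smul, norm_pow, norm_pow, pow_succ] at h1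
    have hpos : 0 < ‖t - p‖ ^ n := pow_pos (norm_pos_iff.2 htp') n
    refine le_of_mul_le_mul_left (h1.trans_eq ?_) hpos
    ring
  have hlim1 : Tendsto (fun t => ‖((n : ℂ) + 1) • g t + (t - p) • deriv g t‖) (𝓝[≠] p)
      (𝓝 ‖((n : ℂ) + 1) • g p + (p - p) • deriv g p‖) := by
    have : ContinuousAt (fun t => ‖((n : ℂ) + 1) • g t + (t - p) • deriv g t‖) p := by
      have h1 := hg.continuousAt
      have h2 := hg.deriv.continuousAt
      fun_prop
    exact this.tendsto.mono_left nhdsWithin_le_nhds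
  have hlim2 : Tendsto (fun t => B * (‖t - p‖ * ‖g t‖)) (𝓝[≠] p)
      (𝓝 (B * (‖p - p‖ * ‖g p‖))) := by
    have : ContinuousAt (fun t => B * (‖t - p‖ * ‖g t‖)) p := by
      have h1 := hg.continuousAt
      fun_prop
    exact this.tendsto.mono_left nhdsWithin_le_nhds
  have := le_of_tendsto_of_tendsto hlim1 hlim2 hev
  rw [sub_self, zero_smul, add_zero, norm_zero, zero_mul, mul_zero, norm_smul] at this
  have h3 : 0 < ‖(n : ℂ) + 1‖ * ‖g p‖ :=
    mul_pos (norm_pos_iff.2 (Nat.cast_add_one_ne_zero n)) (norm_pos_iff.2 hg0)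
  linarith

/-- Uniqueness for a linear differential equation `∑ c_j δ^{m-j} f = 0`, `δ = a d/dt`, in terms of
the sequence `f_j = δ^j f`. -/
theorem eventually_eq_zero_of_jet {m : ℕ} (hm : 0 < m) {p : ℂ} {f : ℕ → ℂ → ℂ}
    (hf : ∀ j, AnalyticAt ℂ (f j) p) {a : ℂ → ℂ} (ha : ContinuousAt a p) (ha0 : a p ≠ 0)
    (hstep : ∀ j, ∀ᶠ t in 𝓝 p, f (j + 1) t = a t * deriv (f j) t)
    {c : Fin (m + 1) → ℂ → ℂ} (hc : ∀ j, ContinuousAt (c j) p) (hc0 : c 0 p ≠ 0)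
    (heq : ∀ᶠ t in 𝓝 p, ∑ j : Fin (m + 1), c j t * f (m - (j : ℕ)) t = 0)
    (hjet : ∀ j < m, f j p = 0) : ∀ᶠ t in 𝓝 p, f 0 t = 0 := by
  set F : ℂ → (Fin m → ℂ) := fun t j => f j t
  have hF : AnalyticAt ℂ F p := analyticAt_pi_iff.2 fun j => hf j
  have hF0 : F p = 0 := funext fun j => hjet j j.2
  set b : ℂ → ℝ := fun t => ∑ j : Fin m, ‖c j.succ t‖ / ‖c 0 t‖
  have hb : ContinuousAt b p := by
    refine tendsto_finsetSum _ fun j _ => ?_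
    exact (hc j.succ).norm.div (hc 0).norm (norm_ne_zero_iff.2 hc0)
  have hb0 : ∀ t, 0 ≤ b t := fun t => Finset.sum_nonneg fun j _ => by positivity
  have hinv : ContinuousAt (fun t => ‖(a t)⁻¹‖) p := (ha.inv₀ ha0).norm
  -- The equation as a first-order system for (f_0, …, f_{m-1}), with f_m eliminated. The constant
  -- b(p) + 2 dominates both 1, for the shifted components, and b(t) < b(p) + 1, for f_m.
  have key : ∀ᶠ t in 𝓝 p, ‖deriv F t‖ ≤ ((‖(a p)⁻¹‖ + 1) * (b p + 2)) * ‖F t‖ := by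
    filter_upwards [hb.eventually_lt_const (lt_add_one (b p)),
      hinv.eventually_lt_const (lt_add_one ‖(a p)⁻¹‖), heq,
      eventually_all.2 fun j : Fin m => hstep j, ha.eventually_ne ha0, (hc 0).eventually_ne hc0,
      eventually_all.2 fun j : Fin m => (hf j).eventually_analyticAt] with t h1 h2 h3 h4 h5 h6 h7
    have hd : deriv F t = fun j : Fin m => deriv (f j) t :=
      (hasDerivAt_pi.2 fun j => (h7 j).differentiableAt.hasDerivAt).deriv
    have hFj : ∀ j (hj : j < m), ‖f j t‖ ≤ ‖F t‖ := fun j hj => norm_le_pi_norm (F t) ⟨j, hj⟩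
    have hfm : ‖f m t‖ ≤ b t * ‖F t‖ := by
      rw [Fin.sum_univ_succ] at h3
      simp only [Fin.val_zero, Nat.sub_zero, Fin.val_succ] at h3
      have h8 : f m t = -∑ j : Fin m, c j.succ t / c 0 t * f (m - ((j : ℕ) + 1)) t := by
        have : ∑ j : Fin m, c j.succ t / c 0 t * f (m - ((j : ℕ) + 1)) t =
            (∑ j : Fin m, c j.succ t * f (m - ((j : ℕ) + 1)) t) / c 0 t := by
          rw [Finset.sum_div]
          exact Finset.sum_congr rfl fun j _ => by ring
        rw [this, ← neg_div, eq_div_iff h6]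
        linear_combination h3
      rw [h8, norm_neg, Finset.sum_mul]
      refine (norm_sum_le _ _).trans (Finset.sum_le_sum fun j _ => ?_)
      rw [norm_mul, norm_div]
      gcongr
      exact hFj _ (by omega)
    have hnext : ∀ j : Fin m, ‖f (j + 1) t‖ ≤ (b p + 2) * ‖F t‖ := fun j => by
      rcases Nat.lt_or_ge ((j : ℕ) + 1) m with hj | hj
      · refine (hFj _ hj).trans ?_
        nlinarith [norm_nonneg (F t), hb0 p]
      · rw [show (j : ℕ) + 1 = m by omega]
        refine hfm.trans ?_
        gcongr
        linarith
    rw [hd, pi_norm_le_iff_of_nonneg (mul_nonneg (mul_nonneg (by positivity)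
      (by linarith [hb0 p])) (norm_nonneg _))]
    intro j
    have h9 : deriv (f j) t = (a t)⁻¹ * f (j + 1) t := by rw [h4 j, inv_mul_cancel_left₀ h5]
    rw [h9, norm_mul, mul_assoc]
    exact mul_le_mul h2.le (hnext j) (norm_nonneg _) (by positivity)
  filter_upwards [eventually_eq_zero_of_norm_deriv_le hF key hF0] with t ht
  exact congrFun ht ⟨0, hm⟩

end Uniqueness

/-! ### Jets of solutions on the covering, and comparison with germs at a point -/

section Solutions

variable {K : Subfield ℂ} {m : ℕ} {ε : ℝ} {q : Fin (m + 1) → RatFunc K}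
  {hq : ∀ j, ∀ t ∈ punctDisc ε, NoPole (q j) t}

theorem norm_eMap (z : ℂ) : ‖eMap z‖ = Real.exp (-(2 * Real.pi * z.im)) := by
  rw [eMap, Complex.norm_exp]
  congr 1
  simp [Complex.mul_re, Complex.mul_im]

theorem upperG_eq (hε : 0 < ε) : upperG ε = {z : ℂ | -Real.log ε / (2 * Real.pi) < z.im} := by
  ext z
  rw [upperG, Set.mem_ofPred_eq, Set.mem_ofPred_eq, norm_eMap, ← Real.lt_log_iff_exp_lt hε,
    div_lt_iff₀ Real.two_pi_pos]
  constructor <;> intro h <;> linarith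

theorem isPreconnected_upperG (hε : 0 < ε) : IsPreconnected (upperG ε) := by
  rw [upperG_eq hε]
  exact (convex_halfSpace_im_gt _).isPreconnected

theorem continuousAt_ratVal {r : RatFunc K} {t : ℂ} (h : NoPole r t) : ContinuousAt (ratVal r) t := by
  have hp : ∀ f : Polynomial K, Continuous fun t => f.eval₂ K.subtype t := fun f => by
    simp only [Polynomial.eval₂_eq_eval_map]
    exact Polynomial.continuous _
  exact (hp r.num).continuousAt.div (hp r.denom).continuousAt h

theorem analyticAt_ext0 (u : HolG ε) {z : ℂ} (hz : z ∈ upperG ε) : AnalyticAt ℂ (ext0 u.fn) z :=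
  (holG_diff u).analyticAt ((isOpen_upperG ε).mem_nhds hz)

/-- Local uniqueness for the Cauchy problem, spread over the half plane G by the identity theorem.
-/
theorem eq_zero_of_jetG (hε : 0 < ε) (hm : 0 < m) (hq0 : ∀ t ∈ punctDisc ε, ratVal (q 0) t ≠ 0)
    {u : HolG ε} (hu : u ∈ solG q hq) (z : upperG ε)
    (hjet : ∀ j < m, ((opD ε ^ j) u).fn z = 0) : u = 0 := by
  have hz := eMap_mem z.2
  have hloc : ∀ᶠ w in 𝓝 (z : ℂ), ext0 u.fn w = 0 := by
    refine eventually_eq_zero_of_jet hm (f := fun j => ext0 ((opD ε ^ j) u).fn)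
      (fun j => analyticAt_ext0 _ z.2) (a := fun _ => tpi⁻¹) continuousAt_const
      (inv_ne_zero tpi_ne_zero) (fun j => ?_) (c := fun j w => ratVal (q j) (eMap w)) (fun j => ?_)
      (hq0 _ hz) ?_ fun j hj => by rw [ext0_of_mem _ z.2]; exact hjet j hj
    · filter_upwards [(isOpen_upperG ε).mem_nhds z.2] with w hw
      rw [ext0_of_mem _ hw, pow_succ', Module.End.mul_apply, opD_fn]
    · exact ContinuousAt.comp (f := eMap) (g := ratVal (q j)) (continuousAt_ratVal (hq j _ hz))
        differentiable_eMap.continuous.continuousAt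
    · filter_upwards [(isOpen_upperG ε).mem_nhds z.2] with w hw
      rw [← mem_solG.1 hu ⟨w, hw⟩]
      exact Finset.sum_congr rfl fun j _ => by rw [ext0_of_mem _ hw]
  have hall := AnalyticOnNhd.eqOn_zero_of_preconnected_of_eventuallyEq_zero
    (fun w hw => analyticAt_ext0 u hw) (isPreconnected_upperG hε) z.2 hloc
  exact HolG.ext fun w => by rw [← ext0_coe u.fn w]; exact hall w.2

/-- The jet `(u(z), (Du)(z), …, (D^{m-1}u)(z))` of a solution. -/
def jetG (q : Fin (m + 1) → RatFunc K) (hq : ∀ j, ∀ t ∈ punctDisc ε, NoPole (q j) t)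
    (z : upperG ε) : solG q hq →ₗ[ℂ] (Fin m → ℂ) :=
  LinearMap.pi fun j => evG z ∘ₗ (opD ε ^ (j : ℕ)) ∘ₗ (solG q hq).subtype

theorem jetG_apply (z : upperG ε) (u : solG q hq) (j : Fin m) :
    jetG q hq z u j = ((opD ε ^ (j : ℕ)) u.1).fn z := rfl

theorem jetG_injective (hε : 0 < ε) (hm : 0 < m) (hq0 : ∀ t ∈ punctDisc ε, ratVal (q 0) t ≠ 0)
    (z : upperG ε) : Function.Injective (jetG q hq z) := by
  rw [injective_iff_map_eq_zero]
  intro u hu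
  exact Subtype.ext (eq_zero_of_jetG hε hm hq0 u.2 z fun j hj => congrFun hu ⟨j, hj⟩)

/-- Existence for the Cauchy problem is deduced from uniqueness by counting dimensions, given a
basis of m solutions on G. -/
theorem jetG_surjective (hε : 0 < ε) (hm : 0 < m) (hq0 : ∀ t ∈ punctDisc ε, ratVal (q 0) t ≠ 0)
    (b : Module.Basis (Fin m) ℂ (solG q hq)) (z : upperG ε) :
    Function.Surjective (jetG q hq z) := by
  have := Module.Finite.of_basis b
  refine (LinearMap.injective_iff_surjective_of_finrank_eq_finrank ?_).1
    (jetG_injective hε hm hq0 z)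
  rw [Module.finrank_eq_card_basis b, Module.finrank_pi]

/-! ### Restriction of solutions to a neighbourhood of a point -/

variable {p : ℂ} {ℓ : ℂ → ℂ}

/-- The lift of a point to `G` by a branch of the logarithm. -/
def liftG (ℓ : ℂ → ℂ) (t : ℂ) : ℂ := ℓ t / tpi

theorem eMap_liftG {t : ℂ} (h : Complex.exp (ℓ t) = t) : eMap (liftG ℓ t) = t := by
  rw [eMap, liftG, mul_div_cancel₀ _ tpi_ne_zero, h]

theorem liftG_mem {t : ℂ} (h : Complex.exp (ℓ t) = t) (ht : ‖t‖ < ε) : liftG ℓ t ∈ upperG ε := by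
  rw [upperG, Set.mem_ofPred_eq, eMap_liftG h]
  exact ht

theorem analyticAt_liftG (hℓ : AnalyticAt ℂ ℓ p) : AnalyticAt ℂ (liftG ℓ) p :=
  hℓ.div_const

theorem eventually_liftG (hp : p ∈ punctDisc ε) (hℓ : AnalyticAt ℂ ℓ p)
    (hℓexp : ∀ᶠ t in 𝓝 p, Complex.exp (ℓ t) = t) :
    ∀ᶠ t in 𝓝 p, t ∈ punctDisc ε ∧ Complex.exp (ℓ t) = t ∧ liftG ℓ t ∈ upperG ε ∧
      HasDerivAt (liftG ℓ) (t⁻¹ / tpi) t := by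
  filter_upwards [(isOpen_punctDisc ε).mem_nhds hp, hℓexp, hℓexp.eventually_nhds,
    hℓ.eventually_analyticAt] with t h1 h2 h3 h4
  refine ⟨h1, h2, liftG_mem h2 h1.2, HasDerivAt.div_const ?_ _⟩
  have hd := h4.differentiableAt.hasDerivAt
  have h5 := hd.cexp
  have h6 : HasDerivAt (fun t => Complex.exp (ℓ t)) 1 t :=
    (hasDerivAt_id t).congr_of_eventuallyEq h3
  have h7 := h5.unique h6
  rw [h2] at h7
  rwa [eq_inv_of_mul_eq_one_right h7] at hd

/-- The function near `p` defined by a function on `G`. -/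
def descend (ℓ : ℂ → ℂ) (w : HolG ε) : ℂ → ℂ := fun t => ext0 w.fn (liftG ℓ t)

theorem Dt_iter_descend (hp : p ∈ punctDisc ε) (hℓ : AnalyticAt ℂ ℓ p)
    (hℓexp : ∀ᶠ t in 𝓝 p, Complex.exp (ℓ t) = t) (w : HolG ε) (k : ℕ) :
    Dt^[k] (descend ℓ w) =ᶠ[𝓝 p] descend ℓ ((opD ε ^ k) w) := by
  induction k with
  | zero => rfl
  | succ k ih =>
    rw [Function.iterate_succ_apply']
    refine (Dt_congr ih).trans ?_
    filter_upwards [eventually_liftG hp hℓ hℓexp] with t ⟨h1, h2, h3, h4⟩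
    have h5 := (holG_diffAt ((opD ε ^ k) w) ⟨_, h3⟩).hasDerivAt
    have h6 := HasDerivAt.comp t h5 h4
    have h7 : deriv (descend ℓ ((opD ε ^ k) w)) t = _ := h6.deriv
    have ht : t ≠ 0 := norm_pos_iff.1 h1.1
    rw [Dt, h7, descend, ext0_of_mem _ h3, pow_succ', Module.End.mul_apply, opD_fn]
    field_simp

theorem analyticAt_descend (hp : p ∈ punctDisc ε) (hℓ : AnalyticAt ℂ ℓ p)
    (hℓexp : ∀ᶠ t in 𝓝 p, Complex.exp (ℓ t) = t) (w : HolG ε) : AnalyticAt ℂ (descend ℓ w) p :=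
  (analyticAt_ext0 w (eventually_liftG hp hℓ hℓexp).self_of_nhds.2.2.1).fun_comp (analyticAt_liftG hℓ)

theorem descend_mem (hp : p ∈ punctDisc ε) (hℓ : AnalyticAt ℂ ℓ p)
    (hℓexp : ∀ᶠ t in 𝓝 p, Complex.exp (ℓ t) = t) {w : HolG ε} (hw : w ∈ solG q hq) :
    (descend ℓ w : Germ (𝓝 p) ℂ) ∈ solAt q p := by
  refine ⟨_, rfl, analyticAt_descend hp hℓ hℓexp w, ?_⟩
  filter_upwards [eventually_liftG hp hℓ hℓexp,
    eventually_all.2 fun j : Fin (m + 1) => Dt_iter_descend hp hℓ hℓexp w (m - (j : ℕ))]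
    with t ⟨_, h2, h3, _⟩ h5
  rw [← mem_solG.1 hw ⟨_, h3⟩, applyL]
  refine Finset.sum_congr rfl fun j _ => ?_
  rw [h5 j, eMap_liftG h2, descend, ext0_of_mem _ h3]

/-- Restriction of solutions on `G` to germs of solutions at `p`. -/
def restrictSol (q : Fin (m + 1) → RatFunc K) (hq : ∀ j, ∀ t ∈ punctDisc ε, NoPole (q j) t)
    (hp : p ∈ punctDisc ε) (hℓ : AnalyticAt ℂ ℓ p)
    (hℓexp : ∀ᶠ t in 𝓝 p, Complex.exp (ℓ t) = t) : solG q hq →ₗ[ℂ] solAt q p where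
  toFun w := ⟨(descend ℓ w.1 : ℂ → ℂ), descend_mem hp hℓ hℓexp w.2⟩
  map_add' v w := Subtype.ext (Germ.coe_eq.2 (by
    filter_upwards [eventually_liftG hp hℓ hℓexp] with t ⟨_, _, h3, _⟩
    simp only [descend, ext0_of_mem _ h3]
    rfl))
  map_smul' c w := Subtype.ext (Germ.coe_eq.2 (by
    filter_upwards [eventually_liftG hp hℓ hℓexp] with t ⟨_, _, h3, _⟩
    simp only [descend, Function.comp, ext0_of_mem _ h3]
    rfl))

/-- This is where germs at p continue to all of G: some solution on G has the same m-jet as the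
germ, and the difference vanishes by uniqueness. Injectivity is uniqueness on G. -/
theorem restrictSol_bijective (hε : 0 < ε) (hm : 0 < m)
    (hq0 : ∀ t ∈ punctDisc ε, ratVal (q 0) t ≠ 0) (b : Module.Basis (Fin m) ℂ (solG q hq))
    (hp : p ∈ punctDisc ε) (hℓ : AnalyticAt ℂ ℓ p)
    (hℓexp : ∀ᶠ t in 𝓝 p, Complex.exp (ℓ t) = t) :
    Function.Bijective (restrictSol q hq hp hℓ hℓexp) := by
  have hz : liftG ℓ p ∈ upperG ε := (eventually_liftG hp hℓ hℓexp).self_of_nhds.2.2.1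
  have hjet : ∀ (w : HolG ε) (k : ℕ), Dt^[k] (descend ℓ w) p = ((opD ε ^ k) w).fn ⟨_, hz⟩ :=
    fun w k => by
      rw [(Dt_iter_descend hp hℓ hℓexp w k).self_of_nhds, descend, ext0_of_mem _ hz]
  constructor
  · rw [injective_iff_map_eq_zero]
    intro w hw
    have h1 : descend ℓ w.1 =ᶠ[𝓝 p] 0 := Germ.coe_eq.1 (congrArg Subtype.val hw)
    have h2 : ∀ k, Dt^[k] (descend ℓ w.1) =ᶠ[𝓝 p] 0 := fun k => by
      induction k with
      | zero => exact h1
      | succ k ih =>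
        rw [Function.iterate_succ_apply']
        refine (Dt_congr ih).trans ?_
        filter_upwards with t
        simp [Dt]
    refine Subtype.ext (eq_zero_of_jetG hε hm hq0 w.2 ⟨_, hz⟩ fun j _ => ?_)
    rw [← hjet, (h2 j).self_of_nhds, Pi.zero_apply]
  · rintro ⟨u, f, rfl, hf, hLf⟩
    obtain ⟨w, hw⟩ := jetG_surjective hε hm hq0 b ⟨_, hz⟩ fun j => Dt^[j] f p
    refine ⟨w, ?_⟩
    have hmem : ((f + (-1 : ℂ) • descend ℓ w.1 : ℂ → ℂ) : Germ (𝓝 p) ℂ) ∈ solAt q p :=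
      (solAt q p).add_mem ⟨f, rfl, hf, hLf⟩
        ((solAt q p).smul_mem (-1) (descend_mem hp hℓ hℓexp w.2))
    -- Membership yields only some analytic representative g of the germ, so its jets are compared
    -- with those of the difference through equality near p.
    obtain ⟨g, hgeq, hg, hLg⟩ := hmem
    have hgeq' : f + (-1 : ℂ) • descend ℓ w.1 =ᶠ[𝓝 p] g := Germ.coe_eq.1 hgeq
    have hiter : ∀ k, Dt^[k] (f + (-1 : ℂ) • descend ℓ w.1) =ᶠ[𝓝 p] Dt^[k] g := fun k => by
      induction k with
      | zero => exact hgeq'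
      | succ k ih =>
        rw [Function.iterate_succ_apply', Function.iterate_succ_apply']
        exact Dt_congr ih
    have hgjet : ∀ j < m, Dt^[j] g p = 0 := fun j hj => by
      rw [← (hiter j).self_of_nhds, (Dt_iter_add hf
        ((analyticAt_descend hp hℓ hℓexp w.1).const_smul) j).self_of_nhds, Pi.add_apply,
        Dt_iter_smul, Pi.smul_apply, hjet, ← jetG_apply ⟨_, hz⟩ w ⟨j, hj⟩, hw]
      simp
    have hg0 : ∀ᶠ t in 𝓝 p, g t = 0 := by
      refine eventually_eq_zero_of_jet hm (f := fun j => Dt^[j] g)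
        (fun j => analyticAt_Dt_iter hg j) (a := id) continuousAt_id (norm_pos_iff.1 hp.1)
        (fun j => ?_) (c := fun j => ratVal (q j)) (fun j => continuousAt_ratVal (hq j p hp))
        (hq0 p hp) hLg hgjet
      filter_upwards with t
      rw [Function.iterate_succ_apply']
      rfl
    refine Subtype.ext (Germ.coe_eq.2 ?_)
    filter_upwards [hgeq', hg0] with t h1 h2
    rw [h2] at h1
    simp only [Pi.add_apply, Pi.smul_apply, smul_eq_mul] at h1
    linear_combination -h1

end Solutions

/-! ### Freeness of `H` -/

section Free

variable {K : Subfield ℂ} {m : ℕ} {ε : ℝ} {q : Fin (m + 1) → RatFunc K}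
  {hq : ∀ j, ∀ t ∈ punctDisc ε, NoPole (q j) t}

theorem eG_surjective : Function.Surjective (eG : upperG ε → punctDisc ε) := by
  rintro ⟨t, ht⟩
  have h : Complex.exp (Complex.log t) = t := Complex.exp_log (norm_pos_iff.1 ht.1)
  exact ⟨⟨liftG Complex.log t, liftG_mem h ht.2⟩, Subtype.ext (eMap_liftG h)⟩

theorem piMap_classD (z : upperG ε) (j : ℕ) (u : solG q hq) :
    piMap q hq z (classD q hq j) u = ((opD ε ^ j) u.1).fn z := rfl

theorem connH_smul_def (f : ringO ε) (h : connH q hq) : f • h = oToD ε f • h := rfl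

/-- The class of a differential operator in `H`. -/
def toH (q : Fin (m + 1) → RatFunc K) (hq : ∀ j, ∀ t ∈ punctDisc ε, NoPole (q j) t)
    (P : ringD ε) : connH q hq := (Submodule.span (ringD ε) {opL q hq}).mkQ P

theorem toH_surjective (h : connH q hq) : ∃ P : ringD ε, h = toH q hq P := by
  obtain ⟨P, hP⟩ := Submodule.mkQ_surjective (Submodule.span (ringD ε) {opL q hq}) h
  exact ⟨P, hP.symm⟩

theorem smul_toH (P Q : ringD ε) : P • toH q hq Q = toH q hq (P * Q) := rfl

theorem classD_eq_toH (j : ℕ) : classD q hq j = toH q hq (elD ε ^ j) := rfl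

theorem piMap_toH (z : upperG ε) (P : ringD ε) (u : solG q hq) :
    piMap q hq z (toH q hq P) u = (P.1 u.1).fn z := rfl

theorem piMap_smul (z : upperG ε) (f : ringO ε) (h : connH q hq) :
    piMap q hq z (f • h) = f.1 (eG z) • piMap q hq z h := by
  obtain ⟨P, rfl⟩ := toH_surjective h
  refine LinearMap.ext fun u => ?_
  rw [connH_smul_def, smul_toH, piMap_toH, LinearMap.smul_apply, piMap_toH]
  rfl

/-- The derivation `t d/dt` maps the ring `𝓞` to itself. -/
theorem exists_opD_mulOp (f : ringO ε) :
    ∃ g : ringO ε, elD ε * oToD ε f = oToD ε f * elD ε + oToD ε g := by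
  obtain ⟨φ, hφ, hφ', h⟩ := f.2
  refine ⟨⟨fun t => t * deriv φ t, fun t => t * deriv φ t,
    differentiableOn_id.mul (hφ.deriv (isOpen_punctDisc ε)),
    (MeromorphicAt.id 0).mul hφ'.deriv, fun _ => rfl⟩, ?_⟩
  refine Subtype.ext (LinearMap.ext fun u => HolG.ext fun z => ?_)
  have hz := eMap_mem z.2
  have h1 : ext0 (mulOp ε f u).fn =ᶠ[𝓝 (z : ℂ)] fun w => φ (eMap w) * ext0 u.fn w :=
    ext0_eventuallyEq z.2 fun w => by rw [mulOp_fn, h, ext0_coe]; rfl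
  have h2 : HasDerivAt φ (deriv φ (eMap z)) (eMap z) :=
    (hφ.differentiableAt ((isOpen_punctDisc ε).mem_nhds hz)).hasDerivAt
  have h3 := (h2.comp (z : ℂ) (hasDerivAt_eMap z)).mul (holG_diffAt u z).hasDerivAt
  change tpi⁻¹ * deriv (ext0 (mulOp ε f u).fn) z =
    f.1 (eG z) * (tpi⁻¹ * deriv (ext0 u.fn) z) + (eMap z * deriv φ (eMap z)) * u.fn z
  have h4 : deriv (fun w => φ (eMap w) * ext0 u.fn w) z = _ := h3.deriv
  rw [h1.deriv_eq, h4, h, ext0_coe]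
  simp only [eG, Function.comp]
  field_simp [tpi_ne_zero]
  ring

/-- An inverse in `𝓞` of the leading coefficient. -/
theorem exists_inverse_leading (hq0 : ∀ t ∈ punctDisc ε, ratVal (q 0) t ≠ 0) :
    ∃ g : ringO ε, g * ratO ε (q 0) (hq 0) = 1 := by
  obtain ⟨φ, hφ, hφ', h⟩ := (ratO ε (q 0) (hq 0)).2
  have h' : ∀ t (ht : t ∈ punctDisc ε), ratVal (q 0) t = φ t := fun t ht => h ⟨t, ht⟩
  refine ⟨⟨fun t => (φ t)⁻¹, fun t => (φ t)⁻¹, hφ.inv fun t ht => h' t ht ▸ hq0 t ht, hφ'.inv,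
    fun _ => rfl⟩, Subtype.ext (funext fun t => ?_)⟩
  change (φ t)⁻¹ * ratVal (q 0) t = 1
  rw [h' t t.2]
  exact inv_mul_cancel₀ (h' t t.2 ▸ hq0 t t.2)

theorem elD_smul_classD (j : ℕ) : elD ε • classD q hq j = classD q hq (j + 1) := by
  rw [classD_eq_toH, classD_eq_toH, smul_toH, pow_succ']

/-- As q₀ is a unit of 𝓞, the relation L = 0 in H can be solved for D^m. -/
theorem classD_order_mem (hq0 : ∀ t ∈ punctDisc ε, ratVal (q 0) t ≠ 0) :
    classD q hq m ∈ Submodule.span (ringO ε) (Set.range fun j : Fin m => classD q hq j) := by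
  have h0 : ∑ j : Fin (m + 1), ratO ε (q j) (hq j) • classD q hq (m - (j : ℕ)) = 0 := by
    have : (Submodule.span (ringD ε) {opL q hq}).mkQ (opL q hq) = 0 :=
      (Submodule.Quotient.mk_eq_zero _).2 (Submodule.mem_span_singleton_self _)
    rw [opL, map_sum] at this
    exact this
  rw [Fin.sum_univ_succ] at h0
  simp only [Fin.val_zero, Nat.sub_zero, Fin.val_succ] at h0
  obtain ⟨g, hg⟩ := exists_inverse_leading (hq := hq) hq0
  have h1 := eq_neg_of_add_eq_zero_left h0
  have h2 : classD q hq m = g • (ratO ε (q 0) (hq 0) • classD q hq m) := by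
    rw [smul_smul, hg, one_smul]
  rw [h2, h1]
  refine Submodule.smul_mem _ _ (Submodule.neg_mem _ (Submodule.sum_mem _ fun j _ =>
    Submodule.smul_mem _ _ (Submodule.subset_span ⟨⟨m - ((j : ℕ) + 1), by omega⟩, rfl⟩)))

/-- The span contains the class of 1 and is stable under 𝓞 and, by the Leibniz rule and the
reduction of D^m, under D; so it is stable under 𝓓. -/
theorem span_classD (hm : 0 < m) (hq0 : ∀ t ∈ punctDisc ε, ratVal (q 0) t ≠ 0) :
    Submodule.span (ringO ε) (Set.range fun j : Fin m => classD q hq j) = ⊤ := by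
  set T := Submodule.span (ringO ε) (Set.range fun j : Fin m => classD q hq j) with hT
  have hDT : ∀ h ∈ T, elD ε • h ∈ T := by
    intro h hh
    induction hh using Submodule.span_induction with
    | mem x hx =>
      obtain ⟨j, rfl⟩ := hx
      simp only
      rw [elD_smul_classD]
      rcases Nat.lt_or_ge ((j : ℕ) + 1) m with hj | hj
      · exact Submodule.subset_span ⟨⟨j + 1, hj⟩, rfl⟩
      · rw [show (j : ℕ) + 1 = m by omega]
        exact classD_order_mem hq0
    | zero => rw [smul_zero]; exact T.zero_mem
    | add x y _ _ hx hy => rw [smul_add]; exact T.add_mem hx hy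
    | smul f x hx' hx =>
      obtain ⟨g, hg⟩ := exists_opD_mulOp f
      rw [connH_smul_def, smul_smul, hg, add_smul, ← smul_smul, ← connH_smul_def, ← connH_smul_def]
      exact T.add_mem (T.smul_mem f hx) (T.smul_mem g hx')
  have hall : ∀ P : ringD ε, ∀ h ∈ T, P • h ∈ T := by
    rintro ⟨P, hP⟩
    induction hP using Algebra.adjoin_induction with
    | mem x hx =>
      rcases hx with ⟨f, rfl⟩ | hx
      · exact fun h hh => T.smul_mem f hh
      · obtain rfl : x = opD ε := hx
        exact hDT
    | algebraMap c => exact fun h hh => T.smul_mem (algebraMap ℂ (ringO ε) c) hh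
    | add x y hx hy h1 h2 =>
      intro h hh
      have : (⟨x + y, add_mem hx hy⟩ : ringD ε) • h = (⟨x, hx⟩ : ringD ε) • h +
        (⟨y, hy⟩ : ringD ε) • h := by rw [← add_smul]; rfl
      rw [this]
      exact T.add_mem (h1 h hh) (h2 h hh)
    | mul x y hx hy h1 h2 =>
      intro h hh
      have : (⟨x * y, mul_mem hx hy⟩ : ringD ε) • h = (⟨x, hx⟩ : ringD ε) •
        (⟨y, hy⟩ : ringD ε) • h := by rw [smul_smul]; rfl
      rw [this]
      exact h1 _ (h2 h hh)
  rw [eq_top_iff]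
  rintro h -
  obtain ⟨P, rfl⟩ := toH_surjective h
  have h1 : classD q hq 0 ∈ T := Submodule.subset_span ⟨⟨0, hm⟩, rfl⟩
  have h2 := hall P _ h1
  rwa [classD_eq_toH, smul_toH, pow_zero, mul_one] at h2

theorem piMap_sum (z : upperG ε) (v : Fin m → ringO ε) (u : solG q hq) :
    piMap q hq z (∑ j, v j • classD q hq j) u =
      ∑ j, (v j).1 (eG z) * ((opD ε ^ (j : ℕ)) u.1).fn z := by
  rw [map_sum, LinearMap.sum_apply]
  refine Finset.sum_congr rfl fun j _ => ?_
  rw [piMap_smul, LinearMap.smul_apply, piMap_classD, smul_eq_mul]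

/-- A relation acts as zero on every solution. Applied to a solution whose jet at z is the i-th unit
vector, it gives v_i(e(z)) = 0, and e is onto Δ*. -/
theorem linearIndependent_classD
    (hsurj : ∀ z : upperG ε, Function.Surjective (jetG q hq z)) :
    LinearIndependent (ringO ε) fun j : Fin m => classD q hq j := by
  rw [Fintype.linearIndependent_iff]
  intro v hv i
  refine Subtype.ext (funext fun t => ?_)
  obtain ⟨z, rfl⟩ := eG_surjective t
  obtain ⟨u, hu⟩ := hsurj z (Pi.single i 1)
  have h1 := piMap_sum z v u
  rw [hv, map_zero, LinearMap.zero_apply] at h1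
  simp only [← jetG_apply z u, hu, Pi.single_apply, mul_ite, mul_one, mul_zero,
    Finset.sum_ite_eq', Finset.mem_univ, if_true] at h1
  exact h1.symm

end Free

/-! ### Logarithm of the monodromy in a basis -/

section BasisShift

variable {V : Type*} [AddCommGroup V] [Module ℂ V] {m : ℕ}

/-- The `k`-th vector of a basis, extended by zero to all natural numbers. -/
def natVec (φ : Module.Basis (Fin m) ℂ V) (k : ℕ) : V := if h : k < m then φ ⟨k, h⟩ else 0

theorem natVec_coe (φ : Module.Basis (Fin m) ℂ V) (k : Fin m) : natVec φ k = φ k := dif_pos k.2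

theorem natVec_of_lt (φ : Module.Basis (Fin m) ℂ V) {k : ℕ} (h : k < m) :
    natVec φ k = φ ⟨k, h⟩ := dif_pos h

/-- The endomorphism `φ_{k+1} ↦ φ_k`, `φ_0 ↦ 0`. -/
def shiftDown (φ : Module.Basis (Fin m) ℂ V) : Module.End ℂ V :=
  φ.constr ℂ fun k => if (k : ℕ) = 0 then 0 else natVec φ (k - 1)

theorem shiftDown_zero (φ : Module.Basis (Fin m) ℂ V) : shiftDown φ (natVec φ 0) = 0 := by
  unfold natVec
  split_ifs with h
  · rw [shiftDown, Module.Basis.constr_basis, if_pos rfl]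
  · exact map_zero _

theorem shiftDown_succ (φ : Module.Basis (Fin m) ℂ V) {k : ℕ} (h : k + 1 < m) :
    shiftDown φ (natVec φ (k + 1)) = natVec φ k := by
  rw [natVec_of_lt φ h, shiftDown, Module.Basis.constr_basis]
  rfl

theorem shiftDown_pow (φ : Module.Basis (Fin m) ℂ V) (h : ℕ) :
    ∀ k < m, (shiftDown φ ^ h) (natVec φ k) = if h ≤ k then natVec φ (k - h) else 0 := by
  induction h with
  | zero => intro k _; simp
  | succ h ih =>
    intro k hk
    rw [pow_succ, Module.End.mul_apply]
    cases k with
    | zero => rw [shiftDown_zero, map_zero, if_neg (by omega)]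
    | succ k =>
      rw [shiftDown_succ φ hk, ih k (by omega)]
      simp only [Nat.add_le_add_iff_right, Nat.add_sub_add_right]

theorem ext_natVec {M : Type*} [AddCommGroup M] [Module ℂ M] (φ : Module.Basis (Fin m) ℂ V)
    {f g : V →ₗ[ℂ] M} (h : ∀ k < m, f (natVec φ k) = g (natVec φ k)) : f = g :=
  φ.ext fun k => by simpa only [natVec_coe] using h k k.2

theorem shiftDown_pow_eq_zero (φ : Module.Basis (Fin m) ℂ V) : shiftDown φ ^ m = 0 :=
  ext_natVec φ fun k hk => by
    rw [shiftDown_pow φ m k hk, if_neg (by omega), LinearMap.zero_apply]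

theorem smul_shiftDown_pow_eq_zero (φ : Module.Basis (Fin m) ℂ V) (w : ℂ) :
    (w • shiftDown φ) ^ m = 0 := by
  rw [smul_pow, shiftDown_pow_eq_zero, smul_zero]

theorem sum_range_ite_le {M : Type*} [AddCommMonoid M] {k : ℕ} (hk : k < m) (f : ℕ → ℕ → M) :
    ∑ h ∈ Finset.range m, (if h ≤ k then f h (k - h) else 0) =
      ∑ x ∈ Finset.HasAntidiagonal.antidiagonal k, f x.1 x.2 := by
  rw [Finset.Nat.sum_antidiagonal_eq_sum_range_succ_mk, ← Finset.sum_filter]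
  refine Finset.sum_congr (Finset.ext fun h => ?_) fun _ _ => rfl
  simp only [Finset.mem_filter, Finset.mem_range]
  omega

theorem expNil_smul_shiftDown (φ : Module.Basis (Fin m) ℂ V) (w : ℂ) {k : ℕ} (hk : k < m) :
    expNil (w • shiftDown φ) (natVec φ k) =
      ∑ x ∈ Finset.HasAntidiagonal.antidiagonal k,
        (w ^ x.1 / (x.1.factorial : ℂ)) • natVec φ x.2 := by
  rw [expNil_eq_sum (smul_shiftDown_pow_eq_zero φ w), LinearMap.sum_apply,
    ← sum_range_ite_le hk fun h l => (w ^ h / (h.factorial : ℂ)) • natVec φ l]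
  refine Finset.sum_congr rfl fun h _ => ?_
  rw [LinearMap.smul_apply, smul_pow, LinearMap.smul_apply, shiftDown_pow φ h k hk]
  split_ifs
  · rw [smul_smul, div_eq_inv_mul]
  · rw [smul_zero, smul_zero]

theorem logUni_eq_smul_shiftDown (φ : Module.Basis (Fin m) ℂ V) {w : ℂ} {σ : Module.End ℂ V}
    (hσ : ∀ k < m, σ (natVec φ k) = ∑ x ∈ Finset.HasAntidiagonal.antidiagonal k,
      (w ^ x.1 / (x.1.factorial : ℂ)) • natVec φ x.2) :
    logUni σ = w • shiftDown φ := by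
  have : σ = expNil (w • shiftDown φ) :=
    ext_natVec φ fun k hk => by rw [hσ k hk, expNil_smul_shiftDown φ w hk]
  rw [this, logUni_expNil ⟨m, smul_shiftDown_pow_eq_zero φ w⟩]

theorem dualMap_pow_apply (N : Module.End ℂ V) (h : ℕ) (lam : Module.Dual ℂ V) (u : V) :
    ((N.dualMap ^ h : Module.End ℂ (Module.Dual ℂ V)) lam) u = lam ((N ^ h) u) := by
  induction h generalizing lam with
  | zero => rfl
  | succ h ih => rw [pow_succ, Module.End.mul_apply, ih, pow_succ']; rfl

theorem expNil_dualMap_apply (φ : Module.Basis (Fin m) ℂ V) (w x : ℂ) (lam : Module.Dual ℂ V)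
    {k : ℕ} (hk : k < m) :
    expNil (x • ((w • shiftDown φ).dualMap : Module.End ℂ (Module.Dual ℂ V))) lam (natVec φ k) =
      ∑ y ∈ Finset.HasAntidiagonal.antidiagonal k,
        (w * x) ^ y.1 / (y.1.factorial : ℂ) * lam (natVec φ y.2) := by
  have h0 : (x • ((w • shiftDown φ).dualMap : Module.End ℂ (Module.Dual ℂ V))) ^ m = 0 := by
    refine LinearMap.ext fun l => LinearMap.ext fun u => ?_
    rw [smul_pow, LinearMap.smul_apply, LinearMap.smul_apply, dualMap_pow_apply,
      smul_shiftDown_pow_eq_zero]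
    simp
  rw [expNil_eq_sum h0, LinearMap.sum_apply, LinearMap.sum_apply,
    ← sum_range_ite_le hk fun h l => (w * x) ^ h / (h.factorial : ℂ) * lam (natVec φ l)]
  refine Finset.sum_congr rfl fun h _ => ?_
  rw [LinearMap.smul_apply, LinearMap.smul_apply, smul_pow, LinearMap.smul_apply,
    LinearMap.smul_apply, dualMap_pow_apply, smul_pow, LinearMap.smul_apply,
    shiftDown_pow φ h k hk]
  split_ifs
  · rw [map_smul, smul_eq_mul, smul_eq_mul, smul_eq_mul, mul_pow]
    ring
  · simp

theorem natCoord_dualBasis (φ : Module.Basis (Fin m) ℂ V) {j : ℕ} (hj : j < m)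
    (lam : Module.Dual ℂ V) : natCoord φ.dualBasis j lam = lam (natVec φ j) := by
  rw [natCoord_of_lt _ hj, Module.Basis.coord_apply, Module.Basis.dualBasis_repr, natVec_of_lt φ hj]

/-- The transpose of lowering the index is raising it on the dual basis. -/
theorem isBlock_dualMap (φ : Module.Basis (Fin m) ℂ V) {w : ℂ} (hw : w ≠ 0) :
    IsBlock φ.dualBasis (w • shiftDown φ).dualMap w where
  ne_zero := hw
  coord_zero lam := by
    rcases Nat.eq_zero_or_pos m with h | h
    · rw [natCoord_of_le _ h.le, LinearMap.zero_apply]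
    · rw [natCoord_dualBasis φ h, LinearMap.dualMap_apply, LinearMap.smul_apply, shiftDown_zero,
        smul_zero, map_zero]
  coord_succ j lam hj := by
    rw [natCoord_dualBasis φ hj, natCoord_dualBasis φ (by omega), LinearMap.dualMap_apply,
      LinearMap.smul_apply, shiftDown_succ φ hj, map_smul, smul_eq_mul]

end BasisShift

/-! ### The period matrix -/

section Period

open PowerSeries

variable {K : Subfield ℂ} {m : ℕ} {ε : ℝ} {q : Fin (m + 1) → RatFunc K}
  {hq : ∀ j, ∀ t ∈ punctDisc ε, NoPole (q j) t}

/-- The filter `Im z → +∞` on `G`. -/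
abbrev imTop (ε : ℝ) : Filter (upperG ε) := comap (fun z : upperG ε => (z : ℂ).im) atTop

theorem imTop_neBot (hε : 0 < ε) : (imTop ε).NeBot := by
  refine comap_neBot fun s hs => ?_
  obtain ⟨a, ha⟩ := mem_atTop_sets.1 hs
  set b := max a (-Real.log ε / (2 * Real.pi) + 1)
  refine ⟨⟨⟨0, b⟩, ?_⟩, ha b (le_max_left _ _)⟩
  rw [upperG_eq hε, Set.mem_ofPred_eq]
  exact (lt_add_one _).trans_le (le_max_right _ _)

theorem tendsto_eMap : Tendsto (fun z : upperG ε => eMap z) (imTop ε) (𝓝 0) := by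
  rw [tendsto_zero_iff_norm_tendsto_zero]
  simp only [norm_eMap]
  refine Real.tendsto_exp_neg_atTop_nhds_zero.comp ?_
  exact tendsto_comap.const_mul_atTop Real.two_pi_pos

/-- The matrix of the values at `t` of the power series `(t d/dt + s)^j Φ`, modulo `s^m`. -/
def periodMatrix (q : Fin (m + 1) → RatFunc K) (t : ℂ) : Matrix (Fin m) (Fin m) ℂ :=
  Matrix.of fun j k => psv (thetaS^[(j : ℕ)] (phiSer q) k) t

/-- Since a_0 = 1, the constant term in t of (θ+s)^j Φ is s^j. -/
theorem periodMatrix_zero : periodMatrix q 0 = 1 := by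
  ext j k
  rw [periodMatrix, Matrix.of_apply, psv_zero_right, coeff_thetaS_phiSer, aSer_zero, Nat.cast_zero,
    map_zero, add_zero, mul_one, coeff_X_pow, Matrix.one_apply]
  simp only [Fin.ext_iff, eq_comm]

theorem tendsto_periodMatrix (hε : 0 < ε) (hΦ : ∀ k, ConvS ε (phiSer q k)) :
    Tendsto (fun z : upperG ε => periodMatrix q (eMap z)) (imTop ε) (𝓝 1) := by
  rw [← periodMatrix_zero (q := q)]
  refine tendsto_pi_nhds.2 fun j => tendsto_pi_nhds.2 fun k => ?_
  obtain ⟨d, hd, -⟩ := hasDerivAt_psv (t := 0) (convS_thetaS_iterate hΦ j k) (by simpa using hε)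
  exact hd.continuousAt.tendsto.comp tendsto_eMap

theorem eventually_det_periodMatrix (hε : 0 < ε) (hΦ : ∀ k, ConvS ε (phiSer q k)) :
    ∀ᶠ z : upperG ε in imTop ε, (periodMatrix q (eMap z)).det ≠ 0 := by
  have h : Tendsto (fun z : upperG ε => (periodMatrix q (eMap z)).det) (imTop ε)
      (𝓝 (1 : Matrix (Fin m) (Fin m) ℂ).det) :=
    (continuous_id.matrix_det.tendsto _).comp (tendsto_periodMatrix hε hΦ)
  exact h.eventually_ne (by simp)

theorem tendsto_inv_periodMatrix (hε : 0 < ε) (hΦ : ∀ k, ConvS ε (phiSer q k)) :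
    Tendsto (fun z : upperG ε => (periodMatrix q (eMap z))⁻¹) (imTop ε) (𝓝 1) := by
  have h := tendsto_periodMatrix hε hΦ
  have h1 : Tendsto (fun z : upperG ε => (periodMatrix q (eMap z)).det) (imTop ε)
      (𝓝 (1 : Matrix (Fin m) (Fin m) ℂ).det) := (continuous_id.matrix_det.tendsto _).comp h
  have h2 : Tendsto (fun z : upperG ε => (periodMatrix q (eMap z)).adjugate) (imTop ε)
      (𝓝 (1 : Matrix (Fin m) (Fin m) ℂ).adjugate) :=
    (continuous_id.matrix_adjugate.tendsto _).comp h
  have h3 := (h1.inv₀ (by simp)).smul h2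
  simp only [Matrix.det_one, inv_one, Matrix.adjugate_one, one_smul] at h3
  simpa only [Matrix.inv_def, Ring.inverse_eq_inv'] using h3

/-- The Frobenius solutions on `G`. -/
def frobG (hΦ : ∀ k, ConvS ε (phiSer q k)) (hmem : ∀ k < m, logHol hΦ k ∈ solG q hq) (k : Fin m) :
    solG q hq := ⟨logHol hΦ k, hmem k k.2⟩

/-- At a point z high enough for P(e(z)) to be invertible, suitable combinations of the Frobenius
solutions have the columns of this matrix as jets. They are independent, and m independent solutions
span. -/
theorem span_frobG (hε : 0 < ε) (hΦ : ∀ k, ConvS ε (phiSer q k))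
    (hmem : ∀ k < m, logHol hΦ k ∈ solG q hq) (b : Module.Basis (Fin m) ℂ (solG q hq)) :
    Submodule.span ℂ (Set.range (frobG hΦ hmem)) = ⊤ := by
  have := Module.Finite.of_basis b
  have := imTop_neBot hε
  obtain ⟨z, hz⟩ := (eventually_det_periodMatrix hε hΦ).exists
  set u : ℕ → solG q hq := fun l => if h : l < m then frobG hΦ hmem ⟨l, h⟩ else 0 with hu
  -- The coefficients of exp(-2πizs), with z frozen at the chosen point, cancel the logarithms in
  -- the jets there.
  set v : Fin m → solG q hq := fun k => ∑ x ∈ Finset.HasAntidiagonal.antidiagonal (k : ℕ),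
    ((-(tpi * (z : ℂ))) ^ x.1 / (x.1.factorial : ℂ)) • u x.2 with hv
  have hvspan : ∀ k, v k ∈ Submodule.span ℂ (Set.range (frobG hΦ hmem)) := fun k => by
    refine Submodule.sum_mem _ fun x hx => Submodule.smul_mem _ _ ?_
    have h1 := Finset.HasAntidiagonal.mem_antidiagonal.1 hx
    have h2 : x.2 < m := by have := k.2; omega
    simp only [hu, dif_pos h2]
    exact Submodule.subset_span ⟨_, rfl⟩
  have hjet : ∀ k, jetG q hq z (v k) = (periodMatrix q (eMap z)).col k := fun k => by
    funext j
    rw [hv, map_sum, Finset.sum_apply, Matrix.col_apply, periodMatrix, Matrix.of_apply,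
      ← sum_neg_pow_mul_logFn]
    refine Finset.sum_congr rfl fun x hx => ?_
    have h1 := Finset.HasAntidiagonal.mem_antidiagonal.1 hx
    have h2 : x.2 < m := by have := k.2; omega
    rw [map_smul, Pi.smul_apply, smul_eq_mul, jetG_apply]
    simp only [hu, dif_pos h2]
    rw [frobG, opD_pow_logFn hΦ x.2 (logHol_fn hΦ x.2)]
  have hli : LinearIndependent ℂ v := by
    refine LinearIndependent.of_comp (jetG q hq z) ?_
    have : jetG q hq z ∘ v = (periodMatrix q (eMap z)).col := funext hjet
    rw [this]
    exact Matrix.linearIndependent_cols_of_det_ne_zero hz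
  have htop := hli.span_eq_top_of_card_eq_finrank' (by
    rw [Module.finrank_eq_card_basis b])
  rw [eq_top_iff, ← htop]
  exact Submodule.span_le.2 (by rintro _ ⟨k, rfl⟩; exact hvspan k)

/-- The basis of Frobenius solutions on `G`. -/
def frobBasis (hε : 0 < ε) (hΦ : ∀ k, ConvS ε (phiSer q k))
    (hmem : ∀ k < m, logHol hΦ k ∈ solG q hq) (b : Module.Basis (Fin m) ℂ (solG q hq)) :
    Module.Basis (Fin m) ℂ (solG q hq) :=
  basisOfTopLeSpanOfCardEqFinrank (frobG hΦ hmem) (span_frobG hε hΦ hmem b).ge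
    (Module.finrank_eq_card_basis b).symm

theorem frobBasis_apply (hε : 0 < ε) (hΦ : ∀ k, ConvS ε (phiSer q k))
    (hmem : ∀ k < m, logHol hΦ k ∈ solG q hq) (b : Module.Basis (Fin m) ℂ (solG q hq)) (k : Fin m) :
    (frobBasis hε hΦ hmem b k).1 = logHol hΦ k := by
  rw [frobBasis, coe_basisOfTopLeSpanOfCardEqFinrank]
  rfl

theorem monodromyG_natVec (hΦ : ∀ k, ConvS ε (phiSer q k)) {ψ : Module.Basis (Fin m) ℂ (solG q hq)}
    (hψ : ∀ k : Fin m, (ψ k).1 = logHol hΦ k) {k : ℕ} (hk : k < m) :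
    monodromyG q hq (natVec ψ k) = ∑ x ∈ Finset.HasAntidiagonal.antidiagonal k,
      (tpi ^ x.1 / (x.1.factorial : ℂ)) • natVec ψ x.2 := by
  have hψ' : ∀ l < m, (natVec ψ l).1 = logHol hΦ l := fun l hl => by
    rw [natVec_of_lt ψ hl, hψ]
  refine Subtype.ext (HolG.ext fun z => ?_)
  change (natVec ψ k).1.fn (shiftG z) =
    (evG z ∘ₗ (solG q hq).subtype) (∑ x ∈ Finset.HasAntidiagonal.antidiagonal k,
      (tpi ^ x.1 / (x.1.factorial : ℂ)) • natVec ψ x.2)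
  rw [hψ' k hk, logHol_fn, map_sum]
  change logFn (phiSer q) k ((z : ℂ) + 1) = _
  rw [logFn_add_one]
  refine Finset.sum_congr rfl fun x hx => ?_
  have h1 := Finset.HasAntidiagonal.mem_antidiagonal.1 hx
  rw [map_smul, smul_eq_mul]
  change _ = _ * (natVec ψ x.2).1.fn z
  rw [hψ' x.2 (by omega), logHol_fn]

end Period

/-! ### The limiting filtration -/

section Limit

variable {K : Subfield ℂ} {m : ℕ} {ε : ℝ} {q : Fin (m + 1) → RatFunc K}
  {hq : ∀ j, ∀ t ∈ punctDisc ε, NoPole (q j) t} {p : ℂ}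

theorem natVec_map {V W : Type*} [AddCommGroup V] [Module ℂ V] [AddCommGroup W] [Module ℂ W]
    (ψ : Module.Basis (Fin m) ℂ V) (f : V ≃ₗ[ℂ] W) (k : ℕ) :
    natVec (ψ.map f) k = f (natVec ψ k) := by
  unfold natVec
  split_ifs
  · exact Module.Basis.map_apply _ _ _
  · exact (map_zero f).symm

/-- A basis of germs of solutions that corresponds to the Frobenius solutions on `G`. -/
def IsFrobBasis (hΦ : ∀ k, ConvS ε (phiSer q k)) (c : solAt q p ≃ₗ[ℂ] solG q hq)
    (φ : Module.Basis (Fin m) ℂ (solAt q p)) : Prop :=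
  ∀ k : Fin m, (c (φ k)).1 = logHol hΦ k

variable {hΦ : ∀ k, ConvS ε (phiSer q k)} {c : solAt q p ≃ₗ[ℂ] solG q hq}
  {φ : Module.Basis (Fin m) ℂ (solAt q p)}

theorem IsFrobBasis.natVec (hφ : IsFrobBasis hΦ c φ) {k : ℕ} (hk : k < m) :
    (c (natVec φ k)).1 = logHol hΦ k := by
  rw [natVec_of_lt φ hk]
  exact hφ ⟨k, hk⟩

theorem IsFrobBasis.logUni_monodromyAt (hφ : IsFrobBasis hΦ c φ) :
    logUni (monodromyAt c) = tpi • shiftDown φ := by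
  refine logUni_eq_smul_shiftDown φ fun k hk => ?_
  have h1 := monodromyG_natVec hΦ (ψ := φ.map c)
    (fun k => by rw [Module.Basis.map_apply]; exact hφ k) hk
  change c.symm (monodromyG q hq (c (LimMHS.natVec φ k))) = _
  rw [← natVec_map, h1, map_sum]
  refine Finset.sum_congr rfl fun x _ => ?_
  rw [map_smul, natVec_map, LinearEquiv.symm_apply_apply]

theorem IsFrobBasis.dualN_eq (hφ : IsFrobBasis hΦ c φ) :
    dualN c = (tpi • shiftDown φ).dualMap := by
  rw [dualN, hφ.logUni_monodromyAt]

theorem IsFrobBasis.isBlock (hφ : IsFrobBasis hΦ c φ) : IsBlock φ.dualBasis (dualN c) tpi :=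
  hφ.dualN_eq ▸ isBlock_dualMap φ tpi_ne_zero

/-- N acts on the generating series as 2πis, so exp(-zN) cancels the factor exp(2πizs) and only
single-valued functions of e(z) remain. -/
theorem IsFrobBasis.schmidMap_sum (hφ : IsFrobBasis hΦ c φ) (z : upperG ε) (v : Fin m → ringO ε)
    (k : Fin m) :
    schmidMap c z (∑ j, v j • classD q hq j) (φ k) =
      ∑ j, (v j).1 (eG z) * periodMatrix q (eMap z) j k := by
  rw [schmidMap, LinearMap.comp_apply, LinearMap.comp_apply, hφ.dualN_eq, ← natVec_coe φ k,
    expNil_dualMap_apply φ _ _ _ k.2]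
  have h1 : ∀ x ∈ Finset.HasAntidiagonal.antidiagonal (k : ℕ),
      (tpi * -(z : ℂ)) ^ x.1 / (x.1.factorial : ℂ) *
        (c.toLinearMap.dualMap (piMap q hq z (∑ j, v j • classD q hq j))) (LimMHS.natVec φ x.2) =
      ∑ j, (v j).1 (eG z) * ((-(tpi * (z : ℂ))) ^ x.1 / (x.1.factorial : ℂ) *
        logFn (thetaS^[(j : ℕ)] (phiSer q)) x.2 z) := fun x hx => by
    have h2 := Finset.HasAntidiagonal.mem_antidiagonal.1 hx
    have h3 : x.2 < m := by have := k.2; omega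
    rw [LinearMap.dualMap_apply, LinearEquiv.coe_coe, piMap_sum, Finset.mul_sum]
    refine Finset.sum_congr rfl fun j _ => ?_
    rw [hφ.natVec h3, opD_pow_logFn hΦ x.2 (logHol_fn hΦ x.2), mul_neg]
    ring
  rw [Finset.sum_congr rfl h1, Finset.sum_comm]
  refine Finset.sum_congr rfl fun j _ => ?_
  rw [← Finset.mul_sum, sum_neg_pow_mul_logFn]
  rfl

theorem IsFrobBasis.schmidMap_classD (hφ : IsFrobBasis hΦ c φ) (z : upperG ε) (j k : Fin m) :
    schmidMap c z (classD q hq j) (φ k) = periodMatrix q (eMap z) j k := by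
  have h := hφ.schmidMap_sum z (Pi.single j 1) k
  have h1 : ∑ i, (Pi.single j 1 : Fin m → ringO ε) i • classD q hq i = classD q hq j := by
    rw [Finset.sum_eq_single j, Pi.single_eq_same, one_smul]
    · intro i _ hij
      rw [Pi.single_eq_of_ne hij, zero_smul]
    · simp
  have h2 : ∀ i, ((Pi.single j 1 : Fin m → ringO ε) i).1 (eG z) = if i = j then 1 else 0 :=
    fun i => by
      rw [Pi.single_apply]
      split_ifs <;> rfl
  rw [h1] at h
  simpa only [h2, ite_mul, one_mul, zero_mul, Finset.sum_ite_eq', Finset.mem_univ, if_true] using h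

theorem schmidMap_smul (z : upperG ε) (f : ringO ε) (h : connH q hq) :
    schmidMap c z (f • h) = f.1 (eG z) • schmidMap c z h := by
  simp only [schmidMap, LinearMap.comp_apply, piMap_smul, map_smul]

theorem isSchmidLimit_iff_basis (φ : Module.Basis (Fin m) ℂ (solAt q p)) {h : connH q hq}
    {lam : Module.Dual ℂ (solAt q p)} : IsSchmidLimit c h lam ↔
      ∀ k, Tendsto (fun z => schmidMap c z h (φ k)) (imTop ε) (𝓝 (lam (φ k))) := by
  refine ⟨fun H k => H (φ k), fun H u => ?_⟩
  rw [← φ.sum_repr u]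
  simp only [map_sum, map_smul, smul_eq_mul]
  exact tendsto_finsetSum _ fun k _ => (H k).const_mul _

/-- The coordinates of the twisted class are the row vector v times P(e(z)). Both P(e(z)) and its
inverse tend to 1, so convergence can be transferred in both directions. -/
theorem IsFrobBasis.isSchmidLimit_iff (hφ : IsFrobBasis hΦ c φ) (hε : 0 < ε)
    {v : Fin m → ringO ε} {lam : Module.Dual ℂ (solAt q p)} :
    IsSchmidLimit c (∑ j, v j • classD q hq j) lam ↔
      ∀ j, Tendsto (fun z => (v j).1 (eG z)) (imTop ε) (𝓝 (lam (φ j))) := by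
  rw [isSchmidLimit_iff_basis φ]
  simp only [hφ.schmidMap_sum]
  constructor
  · intro H j
    have h1 : Tendsto (fun z : upperG ε => ∑ k, (∑ i, (v i).1 (eG z) * periodMatrix q (eMap z) i k) *
        (periodMatrix q (eMap z))⁻¹ k j) (imTop ε)
        (𝓝 (∑ k, lam (φ k) * (1 : Matrix (Fin m) (Fin m) ℂ) k j)) :=
      tendsto_finsetSum _ fun k _ => (H k).mul
        (tendsto_pi_nhds.1 (tendsto_pi_nhds.1 (tendsto_inv_periodMatrix hε hΦ) k) j)
    have h2 : ∑ k, lam (φ k) * (1 : Matrix (Fin m) (Fin m) ℂ) k j = lam (φ j) := by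
      simp [Matrix.one_apply]
    rw [h2] at h1
    refine h1.congr' ?_
    filter_upwards [eventually_det_periodMatrix hε hΦ] with z hz
    have h3 := congrFun (Matrix.vecMul_vecMul (fun i => (v i).1 (eG z)) (periodMatrix q (eMap z))
      (periodMatrix q (eMap z))⁻¹) j
    rw [Matrix.mul_nonsing_inv _ (isUnit_iff_ne_zero.2 hz), Matrix.vecMul_one] at h3
    rw [← h3]
    rfl
  · intro H k
    have h1 : Tendsto (fun z : upperG ε => ∑ i, (v i).1 (eG z) * periodMatrix q (eMap z) i k)
        (imTop ε) (𝓝 (∑ i, lam (φ i) * (1 : Matrix (Fin m) (Fin m) ℂ) i k)) :=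
      tendsto_finsetSum _ fun i _ => (H i).mul
        (tendsto_pi_nhds.1 (tendsto_pi_nhds.1 (tendsto_periodMatrix hε hΦ) i) k)
    have h2 : ∑ i, lam (φ i) * (1 : Matrix (Fin m) (Fin m) ℂ) i k = lam (φ k) := by
      simp [Matrix.one_apply]
    rwa [h2] at h1

theorem classD_mem_filF {k : ℤ} {j : Fin m} (hj : (j : ℤ) ≤ m - 1 - k) :
    classD q hq j ∈ filF q hq k := Submodule.subset_span ⟨j, hj, j.2, rfl⟩

/-- The moving bases are the images of the D^j with j ≤ m-1-k: they are rows of P(e(z)), independent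
once the determinant is nonzero, and tend to the φ_j^∨. -/
theorem IsFrobBasis.tendstoGrass (hφ : IsFrobBasis hΦ c φ) (hε : 0 < ε) (k : ℤ) :
    TendstoGrass (imTop ε) (schmidFil c k) (dualFil ℂ φ k) := by
  classical
  let S := {j : Fin m // (j : ℤ) ≤ m - 1 - k}
  let e : Fin (Fintype.card S) ≃ S := (Fintype.equivFin S).symm
  have hinj : Function.Injective fun i => (e i).1 := Subtype.val_injective.comp e.injective
  refine ⟨Fintype.card S, fun z i => schmidMap c z (classD q hq (e i).1),
    fun i => φ.dualBasis (e i).1, ?_, φ.dualBasis.linearIndependent.comp _ hinj, ?_, ?_⟩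
  · filter_upwards [eventually_det_periodMatrix hε hΦ] with z hz
    constructor
    · let ev : Module.Dual ℂ (solAt q p) →ₗ[ℂ] (Fin m → ℂ) :=
        LinearMap.pi fun k => Module.Dual.eval ℂ (solAt q p) (φ k)
      refine LinearIndependent.of_comp ev ?_
      have h1 := (Matrix.linearIndependent_rows_of_det_ne_zero hz).comp _ hinj
      have h2 : (ev ∘ fun i => schmidMap c z (classD q hq (e i).1)) =
          (periodMatrix q (eMap z)).row ∘ fun i => (e i).1 :=
        funext fun i => funext fun k => hφ.schmidMap_classD z (e i).1 k
      rw [h2]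
      exact h1
    · apply le_antisymm
      · refine Submodule.span_le.2 ?_
        rintro _ ⟨i, rfl⟩
        exact Submodule.subset_span ⟨_, classD_mem_filF (e i).2, rfl⟩
      · refine Submodule.span_le.2 ?_
        rintro _ ⟨h, hh, rfl⟩
        rw [SetLike.mem_coe, filF] at hh
        rw [SetLike.mem_coe]
        induction hh using Submodule.span_induction with
        | mem x hx =>
          obtain ⟨j, hj, hjm, rfl⟩ := hx
          refine Submodule.subset_span ⟨e.symm ⟨⟨j, hjm⟩, hj⟩, ?_⟩
          simp only [Equiv.apply_symm_apply]
        | zero => rw [map_zero]; exact Submodule.zero_mem _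
        | add x y _ _ hx hy => rw [map_add]; exact Submodule.add_mem _ hx hy
        | smul f x _ hx => rw [schmidMap_smul]; exact Submodule.smul_mem _ _ hx
  · rw [dualFil]
    congr 1
    ext x
    constructor
    · rintro ⟨i, rfl⟩
      exact ⟨(e i).1, (e i).2, rfl⟩
    · rintro ⟨j, hj, rfl⟩
      exact ⟨e.symm ⟨j, hj⟩, by simp only [Equiv.apply_symm_apply]⟩
  · intro i
    have h1 : IsSchmidLimit c (classD q hq (e i).1) (φ.dualBasis (e i).1) := by
      refine (isSchmidLimit_iff_basis φ).2 fun k => ?_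
      simp only [hφ.schmidMap_classD]
      have h2 : φ.dualBasis (e i).1 (φ k) = (1 : Matrix (Fin m) (Fin m) ℂ) (e i).1 k := by
        rw [Module.Basis.dualBasis_apply_self, Matrix.one_apply]
        simp only [eq_comm]
      rw [h2]
      exact tendsto_pi_nhds.1 (tendsto_pi_nhds.1 (tendsto_periodMatrix hε hΦ) _) k
    exact h1

/-! ### Limits of classes -/

theorem repr_eq_zero_of_mem_filF {b : Module.Basis (Fin m) (ringO ε) (connH q hq)}
    (hb : ∀ j, b j = classD q hq j) {k : ℤ} {h : connH q hq} (hh : h ∈ filF q hq k) {j : Fin m}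
    (hj : (m : ℤ) - 1 - k < j) : b.repr h j = 0 := by
  have : filF q hq k ≤ LinearMap.ker (b.coord j) := Submodule.span_le.2 (by
    rintro _ ⟨i, hi, him, rfl⟩
    rw [SetLike.mem_coe, LinearMap.mem_ker, ← hb ⟨i, him⟩, Module.Basis.coord_apply,
      Module.Basis.repr_self, Finsupp.single_apply, if_neg]
    rintro rfl
    simp only at hj
    omega)
  exact this hh

theorem repr_sum {b : Module.Basis (Fin m) (ringO ε) (connH q hq)}
    (hb : ∀ j, b j = classD q hq j) (h : connH q hq) :
    ∑ j, b.repr h j • classD q hq j = h := by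
  simp only [← hb]
  exact b.sum_repr h

theorem repr_of_sum {b : Module.Basis (Fin m) (ringO ε) (connH q hq)}
    (hb : ∀ j, b j = classD q hq j) (v : Fin m → ringO ε) (j : Fin m) :
    b.repr (∑ i, v i • classD q hq i) j = v j := by
  simp only [← hb]
  exact congrFun (b.repr_sum_self v) j

theorem IsFrobBasis.limit_apply (hφ : IsFrobBasis hΦ c φ) (hε : 0 < ε)
    {b : Module.Basis (Fin m) (ringO ε) (connH q hq)} (hb : ∀ j, b j = classD q hq j)
    {h : connH q hq} {lam : Module.Dual ℂ (solAt q p)} (hlim : IsSchmidLimit c h lam) (j : Fin m) :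
    Tendsto (fun z => (b.repr h j).1 (eG z)) (imTop ε) (𝓝 (lam (φ j))) := by
  rw [← repr_sum hb h] at hlim
  exact (hφ.isSchmidLimit_iff hε).1 hlim j

theorem IsFrobBasis.limit_eq_zero (hφ : IsFrobBasis hΦ c φ) (hε : 0 < ε)
    {b : Module.Basis (Fin m) (ringO ε) (connH q hq)} (hb : ∀ j, b j = classD q hq j) {k : ℤ}
    {h : connH q hq} (hh : h ∈ filF q hq k) {lam : Module.Dual ℂ (solAt q p)}
    (hlim : IsSchmidLimit c h lam) {j : Fin m} (hj : (m : ℤ) - 1 - k < j) : lam (φ j) = 0 := by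
  have := imTop_neBot hε
  have h1 := hφ.limit_apply hε hb hlim j
  rw [repr_eq_zero_of_mem_filF hb hh hj] at h1
  exact tendsto_nhds_unique h1 tendsto_const_nhds

theorem dual_eq_sum (φ : Module.Basis (Fin m) ℂ (solAt q p)) (lam : Module.Dual ℂ (solAt q p)) :
    lam = ∑ j, lam (φ j) • φ.dualBasis j := by
  conv_lhs => rw [← φ.dualBasis.sum_repr lam]
  simp only [Module.Basis.dualBasis_repr]

theorem IsFrobBasis.limit_set (hφ : IsFrobBasis hΦ c φ) (hε : 0 < ε)
    {b : Module.Basis (Fin m) (ringO ε) (connH q hq)} (hb : ∀ j, b j = classD q hq j) (k : ℤ) :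
    {lam | ∃ h ∈ filF q hq k, IsSchmidLimit c h lam} =
      (dualFil ℂ φ k : Set (Module.Dual ℂ (solAt q p))) := by
  ext lam
  constructor
  · rintro ⟨h, hh, hlim⟩
    rw [SetLike.mem_coe, dual_eq_sum φ lam]
    refine Submodule.sum_mem _ fun j _ => ?_
    rcases le_or_gt (j : ℤ) (m - 1 - k) with hj | hj
    · exact Submodule.smul_mem _ _ (Submodule.subset_span ⟨j, hj, rfl⟩)
    · rw [hφ.limit_eq_zero hε hb hh hlim hj, zero_smul]
      exact Submodule.zero_mem _
  · intro hlam
    -- Constant coefficients already realize every functional in the limit filtration.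
    refine ⟨∑ j, algebraMap ℂ (ringO ε) (lam (φ j)) • classD q hq j,
      Submodule.sum_mem _ fun j _ => ?_, (hφ.isSchmidLimit_iff hε).2 fun j => tendsto_const_nhds⟩
    rcases le_or_gt (j : ℤ) (m - 1 - k) with hj | hj
    · exact Submodule.smul_mem _ _ (classD_mem_filF hj)
    -- Over ℂ, `dualFil` unfolds to the filtration by initial vectors of the dual basis.
    · have h1 := mem_basisFil.1 (show lam ∈ basisFil φ.dualBasis k from hlam) j hj
      rw [natCoord_dualBasis φ j.2, natVec_coe] at h1
      rw [h1, map_zero, zero_smul]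
      exact Submodule.zero_mem _

/-- A finite limit at `0` of a rational function over `K` belongs to `K`. -/
theorem mem_of_tendsto_ratVal (hε : 0 < ε) {r : RatFunc K}
    (hr : ∀ t ∈ punctDisc ε, NoPole r t) {x : ℂ}
    (h : Tendsto (fun z : upperG ε => ratVal r (eMap z)) (imTop ε) (𝓝 x)) : x ∈ K := by
  have := imTop_neBot hε
  have hpoly : ∀ f : Polynomial K, Tendsto (fun z : upperG ε => f.eval₂ K.subtype (eMap z))
      (imTop ε) (𝓝 ((f.eval 0 : K) : ℂ)) := fun f => by
    have h1 : Continuous fun t => f.eval₂ K.subtype t := by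
      simp only [Polynomial.eval₂_eq_eval_map]
      exact Polynomial.continuous _
    have h2 : f.eval₂ K.subtype 0 = ((f.eval 0 : K) : ℂ) := by
      rw [← map_zero K.subtype, Polynomial.eval₂_at_apply]
      rfl
    rw [← h2]
    exact (h1.tendsto 0).comp tendsto_eMap
  have hprod := h.mul (hpoly r.denom)
  have heq : (fun z : upperG ε => ratVal r (eMap z) * r.denom.eval₂ K.subtype (eMap z)) =
      fun z : upperG ε => r.num.eval₂ K.subtype (eMap z) := funext fun z => by
    rw [ratVal_eq, div_mul_cancel₀ _ (hr _ (eMap_mem z.2))]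
  rw [heq] at hprod
  have hval := tendsto_nhds_unique hprod (hpoly r.num)
  -- If the denominator vanished at 0, the finite limit would force the numerator to vanish there
  -- too, against coprimality.
  have hd : (r.denom.eval 0 : K) ≠ 0 := by
    intro hd
    rw [hd, ZeroMemClass.coe_zero, mul_zero] at hval
    have hn : (r.num.eval 0 : K) = 0 := by exact_mod_cast hval.symm
    obtain ⟨a, b, hab⟩ := r.isCoprime_num_denom
    have := congrArg (Polynomial.eval 0) hab
    rw [Polynomial.eval_add, Polynomial.eval_mul, Polynomial.eval_mul, hn, hd] at this
    simp at this
  have hd' : ((r.denom.eval 0 : K) : ℂ) ≠ 0 := by exact_mod_cast hd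
  rw [eq_div_of_mul_eq hd' hval]
  exact K.div_mem (Subtype.property _) (Subtype.property _)

theorem isAlgClass_classD (j : Fin m) : IsAlgClass q hq (classD q hq j) := by
  refine ⟨fun i => if i = j then 1 else 0, fun i t _ => ?_, ?_⟩
  · by_cases h : i = j <;> simp [NoPole, h]
  · rw [Finset.sum_eq_single j]
    · have : ∀ (r : RatFunc K) (hr : ∀ t ∈ punctDisc ε, NoPole r t), r = 1 → ratO ε r hr = 1 := by
        rintro _ hr rfl
        refine Subtype.ext (funext fun t => ?_)
        change ratVal 1 (t : ℂ) = 1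
        simp [ratVal]
      rw [this _ _ (if_pos rfl), one_smul]
    · intro i _ hij
      have : ∀ (r : RatFunc K) (hr : ∀ t ∈ punctDisc ε, NoPole r t), r = 0 → ratO ε r hr = 0 := by
        rintro _ hr rfl
        refine Subtype.ext (funext fun t => ?_)
        change ratVal 0 (t : ℂ) = 0
        simp [ratVal]
      rw [this _ _ (if_neg hij), zero_smul]
    · simp

/-- The coordinates of a limit of an algebraic class are limits at 0 of rational functions over K,
hence lie in K. The classes D^j give the generators. -/
theorem IsFrobBasis.limit_span (hφ : IsFrobBasis hΦ c φ) (hε : 0 < ε)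
    {b : Module.Basis (Fin m) (ringO ε) (connH q hq)} (hb : ∀ j, b j = classD q hq j) (k : ℤ) :
    Submodule.span K {lam | ∃ h ∈ filF q hq k, IsAlgClass q hq h ∧ IsSchmidLimit c h lam} =
      dualFil K φ k := by
  apply le_antisymm
  · refine Submodule.span_le.2 ?_
    rintro lam ⟨h, hh, ⟨v, hv, rfl⟩, hlim⟩
    rw [SetLike.mem_coe, dual_eq_sum φ lam]
    refine Submodule.sum_mem _ fun j _ => ?_
    rcases le_or_gt (j : ℤ) (m - 1 - k) with hj | hj
    · have h1 := hφ.limit_apply hε hb hlim j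
      rw [repr_of_sum hb] at h1
      have h2 : lam (φ j) ∈ K := mem_of_tendsto_ratVal hε (hv j) h1
      exact Submodule.smul_mem (dualFil K φ k) (⟨lam (φ j), h2⟩ : K)
        (Submodule.subset_span ⟨j, hj, rfl⟩)
    · rw [hφ.limit_eq_zero hε hb hh hlim hj, zero_smul]
      exact Submodule.zero_mem _
  · refine Submodule.span_mono ?_
    rintro _ ⟨j, hj, rfl⟩
    refine ⟨classD q hq j, classD_mem_filF hj, isAlgClass_classD j,
      (isSchmidLimit_iff_basis φ).2 fun k => ?_⟩
    simp only [hφ.schmidMap_classD]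
    have h2 : φ.dualBasis j (φ k) = (1 : Matrix (Fin m) (Fin m) ℂ) j k := by
      rw [Module.Basis.dualBasis_apply_self, Matrix.one_apply]
      simp only [eq_comm]
    rw [h2]
    exact tendsto_pi_nhds.1 (tendsto_pi_nhds.1 (tendsto_periodMatrix hε hΦ) _) k

/-- The Frobenius solutions near `p`. -/
theorem frobSol_eq_descend (hΦ : ∀ k, ConvS ε (phiSer q k)) {ℓ : ℂ → ℂ} (hp : p ∈ punctDisc ε)
    (hℓ : AnalyticAt ℂ ℓ p) (hℓexp : ∀ᶠ t in 𝓝 p, Complex.exp (ℓ t) = t) (k : ℕ) :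
    descend ℓ (logHol hΦ k) =ᶠ[𝓝 p] frobSol q ℓ k := by
  filter_upwards [eventually_liftG hp hℓ hℓexp] with t ⟨_, h2, h3, _⟩
  have h4 : tpi * liftG ℓ t = ℓ t := mul_div_cancel₀ _ tpi_ne_zero
  rw [descend, ext0_of_mem _ h3, logHol_fn, logFn_eq, h4, eMap_liftG h2,
    Finset.Nat.sum_antidiagonal_eq_sum_range_succ_mk, frobSol]
  rfl

end Limit

end LimMHS

end

/-! ### The theorem on the limiting mixed Hodge structure -/

open LimMHS in
theorem mainTheorem10 (K : Subfield ℂ) (m : ℕ) (q : Fin (m + 1) → RatFunc K)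
    (ε : ℝ) (hε : 0 < ε)
    (hq : ∀ j, ∀ t ∈ punctDisc ε, NoPole (q j) t)
    (hq0 : ∀ t ∈ punctDisc ε, ratVal (q 0) t ≠ 0)
    (hreg : ∀ j, NoPole (q j / q 0) 0)
    (hexp : localExponents q = {0})
    (hMUM : IsMaxUnipotent m (monodromyG q hq))
    (p : ℂ) (hp : p ∈ punctDisc ε)
    (ℓ : ℂ → ℂ) (hℓ : AnalyticAt ℂ ℓ p) (hℓexp : ∀ᶠ t in 𝓝 p, Complex.exp (ℓ t) = t) :
    (∀ k < m, PowerSeries.constantCoeff (frobSeries q k) = if k = 0 then 1 else 0) ∧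
    (∀ k < m, ∀ t : ℂ, ‖t‖ < ε →
      Summable fun n : ℕ => ((PowerSeries.coeff n (frobSeries q k) : K) : ℂ) * t ^ n) ∧
    (∃ b : Module.Basis (Fin m) (ringO ε) (connH q hq), ∀ j, b j = classD q hq j) ∧
    ∃ (c : solAt q p ≃ₗ[ℂ] solG q hq) (φ : Module.Basis (Fin m) ℂ (solAt q p)),
      IsContinuation ℓ c ∧
      (∀ k, (φ k : Germ (𝓝 p) ℂ) = (frobSol q ℓ k : Germ (𝓝 p) ℂ)) ∧
      (∀ k : ℤ,
        TendstoGrass (comap (fun z : upperG ε => (z : ℂ).im) atTop) (schmidFil c k)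
          (dualFil ℂ φ k) ∧
        {lam | ∃ h ∈ filF q hq k, IsSchmidLimit c h lam} =
          (dualFil ℂ φ k : Set (Module.Dual ℂ (solAt q p))) ∧
        Submodule.span K {lam | ∃ h ∈ filF q hq k, IsAlgClass q hq h ∧ IsSchmidLimit c h lam} =
          dualFil K φ k) ∧
      IsNilpotent (dualN c) ∧
      (∀ W : ℤ → Submodule ℂ (Module.Dual ℂ (solAt q p)),
        IsJacobson (dualN c) (fun k => W (k + (m - 1))) ↔ W = weightFil c) ∧
      (∃ conj : Module.Dual ℂ (solAt q p) →ₛₗ[starRingEnd ℂ] Module.Dual ℂ (solAt q p),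
        IsMixedHodge conj (weightFil c) (dualFil ℂ φ)) ∧
      (∀ conj : Module.Dual ℂ (solAt q p) →ₛₗ[starRingEnd ℂ] Module.Dual ℂ (solAt q p),
        (∀ x, conj (conj x) = x) → (∀ n, (weightFil c n).map conj = weightFil c n) →
          IsMixedHodge conj (weightFil c) (dualFil ℂ φ)) ∧
      GrIsTate m (weightFil c) (dualFil ℂ φ) := by
  have hq00 : q 0 ≠ 0 := ne_zero_of_ratVal (hq0 p hp)
  have hm : 0 < m := pos_of_localExponents hq00 hexp
  have hconv : ∀ j, ConvS ε (qSer q j) := fun j => (convS_qSer hε hq hq0 hreg j).1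
  have hΦ : ∀ k, ConvS ε (phiSer q k) := convS_phiSer hm hq00 hexp hconv
  have hmem : ∀ k < m, logHol hΦ k ∈ solG q hq := fun k hk =>
    logHol_mem_solG hε hq0 hreg hexp hΦ hk
  -- What is kept of maximal unipotence is the basis, i.e. the dimension m of the solution space;
  -- the actual monodromy is computed from the Frobenius solutions.
  obtain ⟨b, -⟩ := hMUM
  let r := LinearEquiv.ofBijective (restrictSol q hq hp hℓ hℓexp)
    (restrictSol_bijective hε hm hq0 b hp hℓ hℓexp)
  -- Analytic continuation is the inverse of restriction from G to germs at p.
  let c : solAt q p ≃ₗ[ℂ] solG q hq := r.symm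
  let φ : Module.Basis (Fin m) ℂ (solAt q p) := (frobBasis hε hΦ hmem b).map r
  have hφ : IsFrobBasis hΦ c φ := fun k => by
    rw [Module.Basis.map_apply, LinearEquiv.symm_apply_apply, frobBasis_apply]
  have hN : IsBlock φ.dualBasis (dualN c) tpi := hφ.isBlock
  have hspan := span_classD (hq := hq) hm hq0
  have hli := linearIndependent_classD (hq := hq) (jetG_surjective hε hm hq0 b)
  have hB : ∀ j, Module.Basis.mk hli hspan.ge j = classD q hq j := Module.Basis.mk_apply hli hspan.ge
  -- By definition `weightFil c` is `blockW m (dualN c)` and `dualFil ℂ φ` is `basisFil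
  -- φ.dualBasis`, so the results on a single Jordan block apply as they stand.
  refine ⟨fun k _ => ?_, fun k _ t ht => ?_, ⟨_, hB⟩, c, φ, fun u => ?_, fun k => ?_,
    fun k => ⟨hφ.tendstoGrass hε k, hφ.limit_set hε hB k, hφ.limit_span hε hB k⟩,
    ⟨m, hN.pow_eq_zero⟩, hN.isJacobson_iff hm, ?_, fun conj hcc hW => hN.isMixedHodge hcc hW,
    hN.grIsTate⟩
  · rw [← PowerSeries.coeff_zero_eq_constantCoeff_apply, frobSeries, PowerSeries.coeff_mk,
      frobCoeff, PowerSeries.coeff_one]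
  · exact (hΦ k).summable ht
  · exact congrArg Subtype.val (r.apply_symm_apply u).symm
  · have h1 : (φ k : Germ (𝓝 p) ℂ) = (descend ℓ (frobBasis hε hΦ hmem b k).1 : ℂ → ℂ) := by
      rw [Module.Basis.map_apply]
      rfl
    rw [h1, frobBasis_apply]
    exact Germ.coe_eq.2 (frobSol_eq_descend hΦ hp hℓ hℓexp k)
  · obtain ⟨conj, hcc, hW⟩ := hN.exists_conj
    exact ⟨conj, hN.isMixedHodge hcc hW⟩
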